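/- Let $3\le d\le 5$, $\mu_1>0$, $\mu_2\in\mathbb R$ with $\mu:=\frac{\mu_1(2-\mu_1)}4+\mu_2\ge 0$, and let $p_1:=1+\frac4{d-2}$. Put $\nu:=\frac12\sqrt{1-4\mu}$ if $\mu\le\frac14$ and $\nu:=\frac i2\sqrt{4\mu-1}$ if $\mu>\frac14$. Consider, for $\lambda\in\{1,-1\}$ and $(u_0,u_1)\in H^1(\mathbb R^d)\times L^2(\mathbb R^d)$, the damped energy-critical wave equation $$\partial_t^2u-\Delta u+\frac{\mu_1}{1+t}\partial_tu+\frac{\mu_2}{(1+t)^2}u=\lambda|u|^{\frac4{d-2}}u,\qquad (u(0),\partial_tu(0))=(u_0,u_1),\qquad (t,x)\in(0,\infty)\times\mathbb R^d. \tag{NLDW}$$ A global solution is a (real- or complex-valued) $u\in C([0,\infty);H^1)$ with $u\in L^{p_1}([0,T];L^{2p_1})$ for all $T<\infty$ that attains the data (the velocity being the derivative in $L^2$) and satisfies Duhamel's formula $$u(t)=\mathcal D_0(t,0)u_0+\mathcal D_1(t,0)u_1+\int_0^t\mathcal D_1(t,s)\,\lambda|u(s)|^{\frac4{d-2}}u(s)\,ds\quad\text{in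 }L^2,$$ where $w(t)=\mathcal D_0(t,s)f+\mathcal D_1(t,s)g$ denotes the solution of $\partial_t^2w-\Delta w+\frac{\mu_1}{1+t}\partial_tw+\frac{\mu_2}{(1+t)^2}w=0$ with $(w,\partial_tw)(s)=(f,g)$. Let $\mathcal W(t)=\begin{pmatrix}\cos(t|\nabla|)&|\nabla|^{-1}\sin(t|\nabla|)\\-|\nabla|\sin(t|\nabla|)&\cos(t|\nabla|)\end{pmatrix}$ be the free wave group, with components $(\mathcal W(t)\vec v)_1$ and $(\mathcal W(t)\vec v)_2$, and let $\dot H^1$ be the homogeneous Sobolev space. Let $u$ be a global solution of (NLDW) with $\|(1+t)^{\mu_1/2}u\|_{L^{p_1}([0,\infty);L^{2p_1})}<\infty$, and set $o(t):=\|(1+s)^{\mu_1/2}u(s)\|_{L^{p_1}_s([t,\infty);L^{2p_1})}$. Then $o(t)\to0$ as $t\to\infty$, $u$ is differentiable in time on $[0,\infty)$ with values in $L^2$, and there are $\vec v_+\in\dot H^1\times L^2$ (real-valued if $u$ is) and a constant $C$ such that for all $t\ge0$ $$\Big\|u(t)-(1+t)^{-\frac{\mu_1}2}(\mathcal W(t)\vec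 v_+)_1\Big\|_{\dot H^1}\le C\Big(\mu\,R(t)+(1+t)^{-\frac{2\mu_1}{d-2}-\frac{\mu_1}2}\,o(t)\Big),$$ $$\Big\|\partial_tu(t)-(1+t)^{-\frac{\mu_1}2}(\mathcal W(t)\vec v_+)_2\Big\|_{L^2}\le C\Big((\mu+\mu_1)\,R(t)+(1+t)^{-\frac{2\mu_1}{d-2}-\frac{\mu_1}2}\,o(t)\Big),$$ where $$R(t)=\begin{cases}(1+t)^{\max\{-\frac12+\operatorname{Re}\nu,\,-\frac{2\mu_1}{d-2}\}-\frac{\mu_1}2},&\mu\ne\frac14,\\[2pt](1+t)^{\max\{-\frac12,\,-\frac{2\mu_1}{d-2}\}-\frac{\mu_1}2}\,(1+\log(1+t)),&\mu=\frac14.\end{cases}$$ The constant $C$ depends only on $d,\mu_1,\mu_2$, $\|u_0\|_{H^1}$, $\|u_1\|_{L^2}$ and $\|(1+t)^{\mu_1/2}u\|_{L^{p_1}([0,\infty);L^{2p_1})}$. -/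

import Mathlib

open Set MeasureTheory Filter Topology
open scoped ENNReal NNReal FourierTransform SchwartzMap

/-! ### Global solvability of planar linear systems

These auxiliary facts show that the propagators defined below really exist. -/

theorem clampPair_lipschitz (R : ℝ) : LipschitzWith 1
    (fun x : ℝ × ℝ => (max (-R) (min R x.1), max (-R) (min R x.2))) := by
  have h : LipschitzWith 1 (fun x : ℝ => max (-R) (min R x)) :=
    (LipschitzWith.id.const_min R).const_max (-R)
  have := (h.comp LipschitzWith.prod_fst).prodMk (h.comp LipschitzWith.prod_snd)
  simpa using this

/-- Linear first-order systems in the plane with continuous bounded coefficients have solutions on compact time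
intervals. -/
theorem exists_linear_ode_Icc (A : ℝ → (ℝ × ℝ) →L[ℝ] (ℝ × ℝ)) (hA : Continuous A) (K : NNReal)
    (hK : ∀ t, ‖A t‖ ≤ K) (s : ℝ) (x₀ : ℝ × ℝ) (T : ℝ) (hsT : |s| < T) :
    ∃ Y : ℝ → ℝ × ℝ, Y s = x₀ ∧ ∀ t ∈ Ioo (-T) T, HasDerivAt Y (A t (Y t)) t := by
  set R : ℝ := ‖x₀‖ * Real.exp (K * (2 * T)) with hR
  have hT : 0 < T := lt_of_le_of_lt (abs_nonneg s) hsT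
  have hs := abs_lt.1 hsT
  have hR0 : 0 ≤ R := by positivity
  set ρ : ℝ × ℝ → ℝ × ℝ := fun x => (max (-R) (min R x.1), max (-R) (min R x.2)) with hρ
  have hρL : LipschitzWith 1 ρ := clampPair_lipschitz R
  have hρ0 : ρ 0 = 0 := by simp [hρ, hR0]
  have hρn : ∀ x, ‖ρ x‖ ≤ ‖x‖ := fun x => by
    have := hρL.dist_le_mul x 0
    simpa [hρ0] using this
  have hρR : ∀ x, ‖ρ x‖ ≤ R := fun x => by
    rw [Prod.norm_def]
    refine max_le ?_ ?_ <;> simp only [hρ, Real.norm_eq_abs, abs_le] <;>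
      exact ⟨le_max_left _ _, max_le (by linarith) (min_le_left _ _)⟩
  have hρid : ∀ x, ‖x‖ ≤ R → ρ x = x := fun x hx => by
    rw [Prod.norm_def] at hx
    have h1 := abs_le.1 ((le_max_left _ _).trans hx)
    have h2 := abs_le.1 ((le_max_right _ _).trans hx)
    simp [hρ, h1, h2]
  let L : NNReal := K * ⟨R, hR0⟩
  let a : NNReal := L * ⟨2 * T, by positivity⟩
  have hPL : IsPicardLindelof (fun t x => A t (ρ x)) (tmin := -T) (tmax := T)
      ⟨s, hs.1.le, hs.2.le⟩ x₀ a 0 L K := by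
    refine ⟨fun t _ => ?_, fun x _ => ?_, fun t _ x _ => ?_, ?_⟩
    · have h1 : LipschitzWith K (A t) := (A t).lipschitz.weaken (by exact_mod_cast hK t)
      have := h1.comp hρL
      rw [mul_one] at this
      exact this.lipschitzOnWith
    · exact (hA.clm_apply continuous_const).continuousOn
    · refine ((A t).le_opNorm _).trans ?_
      change _ ≤ (K : ℝ) * R
      exact mul_le_mul (hK t) (hρR x) (norm_nonneg _) K.2
    · change (L : ℝ) * max (T - s) (s - -T) ≤ (L : ℝ) * (2 * T) - 0
      rw [sub_zero]
      refine mul_le_mul_of_nonneg_left (max_le ?_ ?_) L.2 <;> linarith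
  obtain ⟨Y, hY0, hY⟩ := hPL.exists_eq_forall_mem_Icc_hasDerivWithinAt₀
  have hYd : ∀ t ∈ Ioo (-T) T, HasDerivAt Y (A t (ρ (Y t))) t := fun t ht =>
    (hY t (Ioo_subset_Icc_self ht)).hasDerivAt (Icc_mem_nhds ht.1 ht.2)
  have hbd : ∀ t, ‖A t (ρ (Y t))‖ ≤ K * ‖Y t‖ + 0 := fun t => by
    rw [add_zero]
    exact ((A t).le_opNorm _).trans (mul_le_mul (hK t) (hρn _) (norm_nonneg _) K.2)
  have hexp : ∀ τ, 0 ≤ τ → τ ≤ 2 * T → gronwallBound ‖x₀‖ K 0 τ ≤ R := fun τ _ h => by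
    rw [gronwallBound_ε0, hR]
    gcongr
  refine ⟨Y, hY0, fun t ht => ?_⟩
  have key : ‖Y t‖ ≤ R := by
    rcases le_total s t with hst | hst
    · have hsub : ∀ r ∈ Icc s t, r ∈ Ioo (-T) T := fun r hr =>
        ⟨hs.1.trans_le hr.1, hr.2.trans_lt ht.2⟩
      have := norm_le_gronwallBound_of_norm_deriv_right_le (f := Y) (δ := ‖x₀‖) (K := K) (ε := 0)
        (f' := fun r => A r (ρ (Y r))) (a := s) (b := t)
        (fun r hr => (hYd r (hsub r hr)).continuousAt.continuousWithinAt)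
        (fun r hr => (hYd r (hsub r (Ico_subset_Icc_self hr))).hasDerivWithinAt)
        (by simp [hY0]) (fun r _ => hbd r) t ⟨hst, le_rfl⟩
      exact this.trans (hexp _ (by linarith) (by linarith [ht.2, hs.1]))
    · have hsub : ∀ r ∈ Icc (-s) (-t), -r ∈ Ioo (-T) T := fun r hr =>
        ⟨by linarith [ht.1, hr.2], by linarith [hr.1, hs.2]⟩
      have hd : ∀ r ∈ Icc (-s) (-t), HasDerivAt (fun r => Y (-r)) (-(A (-r) (ρ (Y (-r))))) r := by
        intro r hr
        have := (hYd (-r) (hsub r hr)).scomp r (hasDerivAt_neg r)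
        simpa [Function.comp_def] using this
      have := norm_le_gronwallBound_of_norm_deriv_right_le (f := fun r => Y (-r)) (δ := ‖x₀‖)
        (K := K) (ε := 0) (f' := fun r => -(A (-r) (ρ (Y (-r))))) (a := -s) (b := -t)
        (fun r hr => (hd r hr).continuousAt.continuousWithinAt)
        (fun r hr => (hd r (Ico_subset_Icc_self hr)).hasDerivWithinAt)
        (by simp [hY0]) (fun r _ => by rw [norm_neg]; exact hbd (-r)) (-t)
        ⟨by linarith, le_rfl⟩
      rw [neg_neg] at this
      exact this.trans (hexp _ (by linarith) (by linarith [ht.1, hs.2]))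
  have := hYd t ht
  rwa [hρid _ key] at this

theorem exists_linear_ode (A : ℝ → (ℝ × ℝ) →L[ℝ] (ℝ × ℝ)) (hA : Continuous A) (K : NNReal)
    (hK : ∀ t, ‖A t‖ ≤ K) (s : ℝ) (x₀ : ℝ × ℝ) :
    ∃ Y : ℝ → ℝ × ℝ, Y s = x₀ ∧ ∀ t, HasDerivAt Y (A t (Y t)) t := by
  choose Y hY0 hY using fun n : ℕ => exists_linear_ode_Icc A hA K hK s x₀ (|s| + 1 + n)
    (by have : (0:ℝ) ≤ n := Nat.cast_nonneg n
        linarith)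
  have huniq : ∀ m n : ℕ, m ≤ n → EqOn (Y m) (Y n) (Ioo (-(|s| + 1 + m)) (|s| + 1 + m)) := by
    intro m n hmn
    have hmn' : (m : ℝ) ≤ n := Nat.cast_le.2 hmn
    have hm : (0 : ℝ) ≤ m := Nat.cast_nonneg m
    refine ODE_solution_unique_of_mem_Ioo (v := fun t x => A t x) (s := fun _ => univ) (K := K)
      (t₀ := s) (fun t _ => ((A t).lipschitz.weaken (by exact_mod_cast hK t)).lipschitzOnWith)
      ⟨by linarith [neg_abs_le s], by linarith [le_abs_self s]⟩
      (fun t ht => ⟨hY m t ht, trivial⟩) (fun t ht => ⟨hY n t ⟨?_, ?_⟩, trivial⟩)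
      (by rw [hY0, hY0])
    · linarith [ht.1]
    · linarith [ht.2]
  refine ⟨fun t => Y ⌈|t|⌉₊ t, hY0 _, fun t => ?_⟩
  set N : ℕ := ⌈|t|⌉₊ + 1 with hN
  have hloc : ∀ r ∈ Ioo (t - 1) (t + 1), Y ⌈|r|⌉₊ r = Y N r := by
    intro r hr
    have hr1 : |r| ≤ |t| + 1 := by
      have : |r - t| ≤ 1 := abs_le.2 ⟨by linarith [hr.1], by linarith [hr.2]⟩
      have := abs_add_le (r - t) t
      simp only [sub_add_cancel] at this
      linarith
    have hle : ⌈|r|⌉₊ ≤ N := by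
      rw [hN, Nat.ceil_le]
      push_cast
      linarith [Nat.le_ceil |t|]
    refine huniq _ _ hle ?_
    have h1 := Nat.le_ceil |r|
    have h2 := abs_nonneg s
    exact ⟨by linarith [neg_abs_le r], by linarith [le_abs_self r]⟩
  have hmem : Ioo (t - 1) (t + 1) ∈ 𝓝 t := Ioo_mem_nhds (by linarith) (by linarith)
  have heq : (fun r => Y ⌈|r|⌉₊ r) =ᶠ[𝓝 t] Y N := Filter.eventually_of_mem hmem hloc
  have hval : Y ⌈|t|⌉₊ t = Y N t := hloc t ⟨by linarith, by linarith⟩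
  have hd : HasDerivAt (Y N) (A t (Y N t)) t := by
    refine hY N t ?_
    have h1 := Nat.le_ceil |t|
    have h2 := abs_nonneg s
    have h3 : (N : ℝ) = ⌈|t|⌉₊ + 1 := by rw [hN]; push_cast; ring
    exact ⟨by rw [h3]; linarith [neg_abs_le t], by rw [h3]; linarith [le_abs_self t]⟩
  have := hd.congr_of_eventuallyEq heq
  simpa [hval] using this

/-! ### Modes of the linear damped wave equation -/

/-- `y` (with derivative `y'`) solves on `[0, ∞)` the initial value problem
`y'' + μ₁ / (1 + t) y' + (r² + μ₂ / (1 + t)²) y = 0`, `y s = a`, `y' s = b`, which is the linear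
equation `∂ₜ²u - Δu + μ₁ / (1 + t) ∂ₜu + μ₂ / (1 + t)² u = 0` at a spatial frequency of size `r`. -/
def IsDampedMode (μ₁ μ₂ r s a b : ℝ) (y y' : ℝ → ℝ) : Prop :=
  y s = a ∧ y' s = b ∧ ∀ t : ℝ, 0 ≤ t →
    HasDerivWithinAt y (y' t) (Ici 0) t ∧
    HasDerivWithinAt y' (-(μ₁ / (1 + t)) * y' t - (r ^ 2 + μ₂ / (1 + t) ^ 2) * y t) (Ici 0) t

/-- The matrix of the first-order system for `(y, y')`, with `t` replaced by `|t|`. -/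
noncomputable def dampedMatrix (μ₁ μ₂ r t : ℝ) : (ℝ × ℝ) →L[ℝ] (ℝ × ℝ) :=
  (ContinuousLinearMap.snd ℝ ℝ ℝ).prod 0
    + (-(μ₁ / (1 + |t|))) •
      (0 : (ℝ × ℝ) →L[ℝ] ℝ).prod (ContinuousLinearMap.snd ℝ ℝ ℝ)
    + (-(r ^ 2 + μ₂ / (1 + |t|) ^ 2)) •
      (0 : (ℝ × ℝ) →L[ℝ] ℝ).prod (ContinuousLinearMap.fst ℝ ℝ ℝ)

theorem dampedMatrix_apply (μ₁ μ₂ r t : ℝ) (x : ℝ × ℝ) :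
    dampedMatrix μ₁ μ₂ r t x =
      (x.2, -(μ₁ / (1 + |t|)) * x.2 - (r ^ 2 + μ₂ / (1 + |t|) ^ 2) * x.1) := by
  ext
  · simp [dampedMatrix]
  · simp [dampedMatrix]
    ring

theorem continuous_dampedMatrix (μ₁ μ₂ r : ℝ) : Continuous (dampedMatrix μ₁ μ₂ r) := by
  have h : ∀ t : ℝ, 1 + |t| ≠ 0 := fun t => by positivity
  unfold dampedMatrix
  have h1 : Continuous fun t : ℝ => -(μ₁ / (1 + |t|)) :=
    (continuous_const.div (continuous_const.add continuous_abs) h).neg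
  have h2 : Continuous fun t : ℝ => -(r ^ 2 + μ₂ / (1 + |t|) ^ 2) := by
    have h3 : Continuous fun t : ℝ => (1 + |t|) ^ 2 := by fun_prop
    exact (continuous_const.add (continuous_const.div h3 fun t => pow_ne_zero 2 (h t))).neg
  exact (continuous_const.add (h1.smul continuous_const)).add (h2.smul continuous_const)

theorem exists_bound_dampedMatrix (μ₁ μ₂ r : ℝ) :
    ∃ K : ℝ≥0, ∀ t, ‖dampedMatrix μ₁ μ₂ r t‖ ≤ K := by
  set B₀ : (ℝ × ℝ) →L[ℝ] (ℝ × ℝ) := (ContinuousLinearMap.snd ℝ ℝ ℝ).prod 0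
  set B₁ : (ℝ × ℝ) →L[ℝ] (ℝ × ℝ) :=
    (0 : (ℝ × ℝ) →L[ℝ] ℝ).prod (ContinuousLinearMap.snd ℝ ℝ ℝ)
  set B₂ : (ℝ × ℝ) →L[ℝ] (ℝ × ℝ) :=
    (0 : (ℝ × ℝ) →L[ℝ] ℝ).prod (ContinuousLinearMap.fst ℝ ℝ ℝ)
  refine ⟨⟨‖B₀‖ + |μ₁| * ‖B₁‖ + (r ^ 2 + |μ₂|) * ‖B₂‖, by positivity⟩, fun t => ?_⟩
  have h1 : (1 : ℝ) ≤ 1 + |t| := by linarith [abs_nonneg t]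
  have hb : ‖-(μ₁ / (1 + |t|))‖ ≤ |μ₁| := by
    rw [norm_neg, Real.norm_eq_abs, abs_div, abs_of_pos (by linarith : 0 < 1 + |t|)]
    exact div_le_self (abs_nonneg _) h1
  have hc : ‖-(r ^ 2 + μ₂ / (1 + |t|) ^ 2)‖ ≤ r ^ 2 + |μ₂| := by
    rw [norm_neg, Real.norm_eq_abs]
    refine (abs_add_le _ _).trans ?_
    rw [abs_of_nonneg (sq_nonneg r), abs_div,
      abs_of_pos (by positivity : 0 < (1 + |t|) ^ 2)]
    have := div_le_self (abs_nonneg μ₂) (one_le_pow₀ h1 : 1 ≤ (1 + |t|) ^ 2)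
    linarith
  change ‖B₀ + _ • B₁ + _ • B₂‖ ≤ ‖B₀‖ + |μ₁| * ‖B₁‖ + (r ^ 2 + |μ₂|) * ‖B₂‖
  refine (norm_add_le _ _).trans (add_le_add ((norm_add_le _ _).trans (add_le_add le_rfl ?_)) ?_)
  · rw [norm_smul]
    exact mul_le_mul_of_nonneg_right hb (norm_nonneg _)
  · rw [norm_smul]
    exact mul_le_mul_of_nonneg_right hc (norm_nonneg _)

theorem exists_isDampedMode (μ₁ μ₂ r s a b : ℝ) :
    ∃ y y' : ℝ → ℝ, IsDampedMode μ₁ μ₂ r s a b y y' := by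
  obtain ⟨K, hK⟩ := exists_bound_dampedMatrix μ₁ μ₂ r
  obtain ⟨Y, hY0, hY⟩ := exists_linear_ode _ (continuous_dampedMatrix μ₁ μ₂ r) K hK s (a, b)
  refine ⟨fun t => (Y t).1, fun t => (Y t).2, by simp [hY0], by simp [hY0], fun t ht => ?_⟩
  have h := hY t
  rw [dampedMatrix_apply, abs_of_nonneg ht] at h
  have h1 := (ContinuousLinearMap.fst ℝ ℝ ℝ).hasFDerivAt.comp_hasDerivAt t h
  have h2 := (ContinuousLinearMap.snd ℝ ℝ ℝ).hasFDerivAt.comp_hasDerivAt t h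
  exact ⟨h1.hasDerivWithinAt, h2.hasDerivWithinAt⟩

/-- Uniqueness of the mode, which makes the choice below immaterial. -/
theorem IsDampedMode.eqOn {μ₁ μ₂ r s a b : ℝ} (hs : 0 ≤ s) {y y' z z' : ℝ → ℝ}
    (hy : IsDampedMode μ₁ μ₂ r s a b y y') (hz : IsDampedMode μ₁ μ₂ r s a b z z') :
    ∀ t, 0 ≤ t → y t = z t ∧ y' t = z' t := by
  obtain ⟨K, hK⟩ := exists_bound_dampedMatrix μ₁ μ₂ r
  have hL : ∀ t, LipschitzWith K (fun x => dampedMatrix μ₁ μ₂ r t x) := fun t =>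
    (dampedMatrix μ₁ μ₂ r t).lipschitz.weaken (by exact_mod_cast hK t)
  have key : ∀ w w' : ℝ → ℝ, IsDampedMode μ₁ μ₂ r s a b w w' → ∀ t, 0 ≤ t →
      HasDerivWithinAt (fun t => (w t, w' t)) (dampedMatrix μ₁ μ₂ r t (w t, w' t)) (Ici 0) t := by
    intro w w' hw t ht
    rw [dampedMatrix_apply, abs_of_nonneg ht]
    exact (hw.2.2 t ht).1.prodMk (hw.2.2 t ht).2
  have h0 : (y s, y' s) = (z s, z' s) := by rw [hy.1, hy.2.1, hz.1, hz.2.1]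
  have fin : ∀ t, 0 ≤ t → (y t, y' t) = (z t, z' t) := by
    intro t ht
    rcases le_total s t with hst | hst
    · have hcont : ∀ w w' : ℝ → ℝ, IsDampedMode μ₁ μ₂ r s a b w w' →
          ContinuousOn (fun t => (w t, w' t)) (Icc s t) := fun w w' hw r hr =>
        (key w w' hw r (hs.trans hr.1)).continuousWithinAt.mono
          (fun q hq => hs.trans hq.1)
      exact ODE_solution_unique hL (hcont y y' hy)
        (fun r hr => (key y y' hy r (hs.trans hr.1)).mono
          (fun q hq => (hs.trans hr.1).trans hq)) (hcont z z' hz)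
        (fun r hr => (key z z' hz r (hs.trans hr.1)).mono
          (fun q hq => (hs.trans hr.1).trans hq)) h0 ⟨hst, le_rfl⟩
    · have hcont : ∀ w w' : ℝ → ℝ, IsDampedMode μ₁ μ₂ r s a b w w' →
          ContinuousOn (fun t => (w t, w' t)) (Icc t s) := fun w w' hw r hr =>
        (key w w' hw r (ht.trans hr.1)).continuousWithinAt.mono
          (fun q hq => ht.trans hq.1)
      have hd : ∀ w w' : ℝ → ℝ, IsDampedMode μ₁ μ₂ r s a b w w' → ∀ q ∈ Ioc t s,
          HasDerivWithinAt (fun t => (w t, w' t)) (dampedMatrix μ₁ μ₂ r q (w q, w' q)) (Iic q) q :=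
        fun w w' hw q hq => ((key w w' hw q (ht.trans hq.1.le)).hasDerivAt
          (Ici_mem_nhds (ht.trans_lt hq.1))).hasDerivWithinAt
      exact ODE_solution_unique_of_mem_Icc_left (s := fun _ => univ)
        (fun r _ => (hL r).lipschitzOnWith) (hcont y y' hy) (hd y y' hy) (fun _ _ => trivial)
        (hcont z z' hz) (hd z z' hz) (fun _ _ => trivial) h0 ⟨le_rfl, hst⟩
  exact fun t ht => Prod.ext_iff.1 (fin t ht)

/-- The solution `y` of the initial value problem in `IsDampedMode`; its values on `[0, ∞)` do not
depend on the choice. -/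
noncomputable def dampedMode (μ₁ μ₂ r s a b : ℝ) : ℝ → ℝ :=
  (exists_isDampedMode μ₁ μ₂ r s a b).choose

/-! ### Function spaces and Fourier multipliers -/

abbrev Space (d : ℕ) : Type := EuclideanSpace ℝ (Fin d)

/-- Complex-valued `L²(ℝᵈ)`. -/
abbrev LTwo (d : ℕ) : Type := Lp ℂ 2 (volume : Measure (Space d))

/-- The element of `L²` whose Fourier transform is `h` (for `h` in `L²`). Mathlib's Fourier
transform uses the kernel `exp (-2πi x·ξ)`, so that `|∇|` has the symbol `2π|ξ|`. -/
noncomputable def ofFourier {d : ℕ} (h : Space d → ℂ) : LTwo d :=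
  open Classical in
  if hh : MemLp h 2 volume then 𝓕⁻ (hh.toLp h) else 0

/-- The Fourier multiplier with symbol `m` on `L²`. -/
noncomputable def multiplier {d : ℕ} (m : Space d → ℂ) (f : LTwo d) : LTwo d :=
  ofFourier (fun ξ => m ξ * (𝓕 f : LTwo d) ξ)

/-- The norm of `H¹(ℝᵈ)`, infinite outside `H¹`. -/
noncomputable def hOneNorm {d : ℕ} (f : LTwo d) : ℝ≥0∞ :=
  eLpNorm (fun ξ => ((√(1 + (2 * Real.pi * ‖ξ‖) ^ 2) : ℝ) : ℂ) * (𝓕 f : LTwo d) ξ) 2 volume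

/-- The Fourier transform of the tempered distribution `T` is the locally integrable function
`g`. -/
def HasFourierFun {d : ℕ} (T : 𝓢'(Space d, ℂ)) (g : Space d → ℂ) : Prop :=
  LocallyIntegrable g volume ∧ ∀ φ : 𝓢(Space d, ℂ),
    Integrable (fun ξ => φ ξ * g ξ) volume ∧ (𝓕 T) φ = ∫ ξ, φ ξ * g ξ

/-- The norm `‖|∇| T‖_{L²}` of the homogeneous Sobolev space `Ḣ¹(ℝᵈ)` of tempered distributions
with locally integrable Fourier transform; it is infinite outside `Ḣ¹`. The infimum is over the
representatives of one almost everywhere class. -/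
noncomputable def hDotOneNorm {d : ℕ} (T : 𝓢'(Space d, ℂ)) : ℝ≥0∞ :=
  ⨅ (g : Space d → ℂ) (_ : HasFourierFun T g),
    eLpNorm (fun ξ => ((2 * Real.pi * ‖ξ‖ : ℝ) : ℂ) * g ξ) 2 volume

def MemHDotOne {d : ℕ} (T : 𝓢'(Space d, ℂ)) : Prop := hDotOneNorm T < ∞

/-- The Fourier transform of `T` as a function (unique almost everywhere), if it is one. -/
noncomputable def fourierFun {d : ℕ} (T : 𝓢'(Space d, ℂ)) : Space d → ℂ :=
  open Classical in
  if h : ∃ g, HasFourierFun T g then h.choose else 0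

/-- The tempered distribution whose Fourier transform is the function `g`, if there is one (it is
then unique). -/
noncomputable def distOfFourier {d : ℕ} (g : Space d → ℂ) : 𝓢'(Space d, ℂ) :=
  open Classical in
  if h : ∃ T, HasFourierFun T g then h.choose else 0

theorem HasFourierFun.dist_unique {d : ℕ} {S T : 𝓢'(Space d, ℂ)} {g : Space d → ℂ}
    (hS : HasFourierFun S g) (hT : HasFourierFun T g) : S = T := by
  have h : 𝓕 S = 𝓕 T := by
    ext φ
    rw [(hS.2 φ).2, (hT.2 φ).2]
  have hS' : 𝓕⁻ (𝓕 S) = S := FourierTransform.fourierInv_fourier_eq S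
  have hT' : 𝓕⁻ (𝓕 T) = T := FourierTransform.fourierInv_fourier_eq T
  rw [← hS', h, hT']

/-! ### The free wave group -/

/-- First component `cos(t|∇|) φ₀ + |∇|⁻¹ sin(t|∇|) φ₁` of the free wave with data
`(φ₀, φ₁) ∈ Ḣ¹ × L²`. -/
noncomputable def waveFst {d : ℕ} (t : ℝ) (φ₀ : 𝓢'(Space d, ℂ)) (φ₁ : LTwo d) : 𝓢'(Space d, ℂ) :=
  distOfFourier fun ξ =>
    ((Real.cos (t * (2 * Real.pi * ‖ξ‖)) : ℝ) : ℂ) * fourierFun φ₀ ξ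
      + ((Real.sin (t * (2 * Real.pi * ‖ξ‖)) / (2 * Real.pi * ‖ξ‖) : ℝ) : ℂ) * (𝓕 φ₁ : LTwo d) ξ

/-- Second component `-|∇| sin(t|∇|) φ₀ + cos(t|∇|) φ₁` (the time derivative) of the free wave with
data `(φ₀, φ₁) ∈ Ḣ¹ × L²`. -/
noncomputable def waveSnd {d : ℕ} (t : ℝ) (φ₀ : 𝓢'(Space d, ℂ)) (φ₁ : LTwo d) : LTwo d :=
  ofFourier fun ξ =>
    ((-(2 * Real.pi * ‖ξ‖) * Real.sin (t * (2 * Real.pi * ‖ξ‖)) : ℝ) : ℂ) * fourierFun φ₀ ξ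
      + ((Real.cos (t * (2 * Real.pi * ‖ξ‖)) : ℝ) : ℂ) * (𝓕 φ₁ : LTwo d) ξ

/-! ### The energy-critical damped wave equation -/

/-- The exponent `p₁ = 1 + 4 / (d - 2)`. -/
noncomputable def critExp (d : ℕ) : ℝ := 1 + 4 / ((d : ℝ) - 2)

/-- The norm of `L^p(I; L^q(ℝᵈ))`. -/
noncomputable def spaceTimeNorm {d : ℕ} (p q : ℝ) (I : Set ℝ) (w : ℝ → LTwo d) : ℝ≥0∞ :=
  (∫⁻ t in I, eLpNorm (w t) (ENNReal.ofReal q) volume ^ p) ^ (1 / p)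

/-- The nonlinearity `lam |f|^(4/(d-2)) f`, for `f` such that it is in `L²`. -/
noncomputable def nonlinearity {d : ℕ} (lam : ℝ) (f : LTwo d) : LTwo d :=
  open Classical in
  if h : MemLp (fun x => ((lam * ‖f x‖ ^ (4 / ((d : ℝ) - 2)) : ℝ) : ℂ) * f x) 2 volume then
    h.toLp _ else 0

/-- The propagator mapping `f` to the value at time `t` of the solution of
`∂ₜ²w - Δw + μ₁ / (1 + t) ∂ₜw + μ₂ / (1 + t)² w = 0`, `(w, ∂ₜw) = (f, 0)` at time `s`. -/
noncomputable def dampedPropagatorZero {d : ℕ} (μ₁ μ₂ t s : ℝ) : LTwo d → LTwo d :=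
  multiplier fun ξ => ((dampedMode μ₁ μ₂ (2 * Real.pi * ‖ξ‖) s 1 0 t : ℝ) : ℂ)

/-- The propagator mapping `f` to the value at time `t` of the solution of
`∂ₜ²w - Δw + μ₁ / (1 + t) ∂ₜw + μ₂ / (1 + t)² w = 0`, `(w, ∂ₜw) = (0, f)` at time `s`. -/
noncomputable def dampedPropagatorOne {d : ℕ} (μ₁ μ₂ t s : ℝ) : LTwo d → LTwo d :=
  multiplier fun ξ => ((dampedMode μ₁ μ₂ (2 * Real.pi * ‖ξ‖) s 0 1 t : ℝ) : ℂ)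

/-- `u` is a global (mild) solution of
`∂ₜ²u - Δu + μ₁ / (1 + t) ∂ₜu + μ₂ / (1 + t)² u = lam |u|^(4/(d-2)) u` on `[0, ∞) × ℝᵈ`
with data `(u₀, u₁) ∈ H¹ × L²`: it is continuous in time with values in `H¹`, lies locally in time
in `L^{p₁} L^{2p₁}`, attains its data, and satisfies Duhamel's formula. -/
structure IsGlobalSolution {d : ℕ} (μ₁ μ₂ lam : ℝ) (u₀ u₁ : LTwo d) (u : ℝ → LTwo d) : Prop where
  mem_hOne : ∀ t, 0 ≤ t → hOneNorm (u t) < ∞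
  continuous_hOne : ∀ t₀, 0 ≤ t₀ →
    Tendsto (fun t => hOneNorm (u t - u t₀)) (𝓝[Ici 0] t₀) (𝓝 0)
  mem_spaceTime : ∀ T, 0 ≤ T → spaceTimeNorm (critExp d) (2 * critExp d) (Icc 0 T) u < ∞
  initial_value : u 0 = u₀
  initial_velocity : HasDerivWithinAt u u₁ (Ici 0) 0
  integrable : ∀ t, 0 ≤ t → IntervalIntegrable
    (fun s => dampedPropagatorOne μ₁ μ₂ t s (nonlinearity lam (u s))) volume 0 t
  duhamel : ∀ t, 0 ≤ t → u t = dampedPropagatorZero μ₁ μ₂ t 0 u₀ + dampedPropagatorOne μ₁ μ₂ t 0 u₁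
    + ∫ s in (0 : ℝ)..t, dampedPropagatorOne μ₁ μ₂ t s (nonlinearity lam (u s))

/-! ### The decay rates -/

/-- `μ = μ₁ (2 - μ₁) / 4 + μ₂`. -/
noncomputable def massParam (μ₁ μ₂ : ℝ) : ℝ := μ₁ * (2 - μ₁) / 4 + μ₂

noncomputable def nu (μ : ℝ) : ℂ :=
  if μ ≤ 1 / 4 then ((1 / 2 * √(1 - 4 * μ) : ℝ) : ℂ)
  else Complex.I / 2 * ((√(4 * μ - 1) : ℝ) : ℂ)

/-- The rate of the contribution of the linear mass term. -/
noncomputable def massRate (d : ℕ) (μ₁ μ t : ℝ) : ℝ :=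
  if μ = 1 / 4 then
    (1 + t) ^ (max (-(1 / 2)) (-(2 * μ₁ / ((d : ℝ) - 2))) - μ₁ / 2) * (1 + Real.log (1 + t))
  else
    (1 + t) ^ (max (-(1 / 2) + (nu μ).re) (-(2 * μ₁ / ((d : ℝ) - 2))) - μ₁ / 2)

/-- `(1 + t)^{μ₁/2} u(t)`. -/
noncomputable def liouville {d : ℕ} (μ₁ : ℝ) (u : ℝ → LTwo d) : ℝ → LTwo d :=
  fun t => (1 + t) ^ (μ₁ / 2) • u t

/-- `‖(1 + t)^{μ₁/2} u‖` in `L^{p₁}([T, ∞); L^{2p₁}(ℝᵈ))`. -/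
noncomputable def tailNorm {d : ℕ} (μ₁ : ℝ) (u : ℝ → LTwo d) (T : ℝ) : ℝ≥0∞ :=
  spaceTimeNorm (critExp d) (2 * critExp d) (Ici T) (liouville μ₁ u)

/-- Real-valuedness of a tempered distribution. -/
def IsRealDist {d : ℕ} (T : 𝓢'(Space d, ℂ)) : Prop :=
  ∀ φ : 𝓢(Space d, ℂ), (∀ x, (φ x).im = 0) → (T φ).im = 0

def IsRealFun {d : ℕ} (f : LTwo d) : Prop := ∀ᵐ x, (f x).im = 0

/-! ### Monotonicity on the half-line -/

/-! Put `v = (1+t)^(μ₁/2) u`. The damping disappears: `v` solves a wave equation with mass term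
`μ/(1+t)² v` and source `λ (1+t)^(-α) |v|^(4/(d-2)) v`, where `α = 2μ₁/(d-2)`. The theorem compares
this equation with the free wave equation, frequency by frequency and in `L²` only. No dispersive
estimate enters, because the `L^{p₁}L^{2p₁}` norm to the power `p₁` is exactly the `L¹L²` norm of
`|v|^(4/(d-2)) v`.

Linear part. A mode of frequency `r` solves `z'' + (r² + μ/(1+t)²) z = 0`. Uniformly in `r` it grows
at most like `(1+t)^β`, `β = 1/2 + Re ν`, up to a logarithm at `μ = 1/4` (`exists_massMode_growth`).
Undoing the free evolution turns the mode into a profile whose derivative is the mass term alone, of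
size `μ (1+t)^(β-2)`. Hence the profile of a mode started at time `s` with energy `E²` moves after
time `t` by at most a constant times `μ (1+t)^(β-1) (1+s)^(1-β) E` (`exists_profile_variation`,
`exists_family_bounds`).

Nonlinear part. By Duhamel, `v` superposes modes started at time `0` and at the times `s` of the
source. Between `t` and `t'` the modes started before `t` vary by the amount above, and those
started in `(t, t']` carry at most the energy of their source (`norm_profile_cutoff_sub_le`). For a
source `(1+s)^(-α) F(s)` with `F` integrable, the past contributes `μ (1+t)^(max(β-1, -α))`
(`profileRate_mul_past_le`) and the future `(1+t)^(-α) o(t)^{p₁}`. So the profile is Cauchy, its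
limit is `v₊`, and the rate is explicit (`exists_free_wave`, `exists_scattering`).

Dividing by `(1+t)^(μ₁/2)` gives the `Ḣ¹` estimate. In `∂ₜu` there is the extra term `μ₁/(2(1+t))
v`, which by the growth bound has `μ₁` times the same rate; hence the factor `μ + μ₁`.
Real-valuedness is Hermitian symmetry on the Fourier side, which real radial multipliers and `L²`
limits preserve. -/

theorem le_of_hasDerivWithinAt_nonpos {f f' : ℝ → ℝ} {s t : ℝ} (hs : 0 ≤ s) (hst : s ≤ t)
    (hf : ∀ x ∈ Icc s t, HasDerivWithinAt f (f' x) (Ici 0) x)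
    (h : ∀ x ∈ Icc s t, f' x ≤ 0) : f t ≤ f s := by
  have hanti : AntitoneOn f (Icc s t) := by
    have hd : ∀ x ∈ Ioo s t, HasDerivAt f (f' x) x := fun x hx =>
      (hf x (Ioo_subset_Icc_self hx)).hasDerivAt (Ici_mem_nhds (hs.trans_lt hx.1))
    refine antitoneOn_of_deriv_nonpos (convex_Icc s t) (fun x hx => ?_) ?_ ?_
    · exact (hf x hx).continuousWithinAt.mono fun y hy => hs.trans hy.1
    · rw [interior_Icc]
      exact fun x hx => (hd x hx).differentiableAt.differentiableWithinAt
    · rw [interior_Icc]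
      intro x hx
      rw [(hd x hx).deriv]
      exact h x (Ioo_subset_Icc_self hx)
  exact hanti ⟨le_rfl, hst⟩ ⟨hst, le_rfl⟩ hst

theorem abs_sub_le_of_hasDerivWithinAt {f f' g g' : ℝ → ℝ} {s t : ℝ} (hs : 0 ≤ s) (hst : s ≤ t)
    (hf : ∀ x ∈ Icc s t, HasDerivWithinAt f (f' x) (Ici 0) x)
    (hg : ∀ x ∈ Icc s t, HasDerivWithinAt g (g' x) (Ici 0) x)
    (h : ∀ x ∈ Icc s t, |f' x| ≤ g' x) : |f t - f s| ≤ g t - g s := by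
  have h1 := le_of_hasDerivWithinAt_nonpos hs hst (f := fun x => f x - g x)
    (fun x hx => (hf x hx).sub (hg x hx)) (fun x hx => by linarith [le_abs_self (f' x), h x hx])
  have h2 := le_of_hasDerivWithinAt_nonpos hs hst (f := fun x => -f x - g x)
    (fun x hx => (hf x hx).neg.sub (hg x hx))
    (fun x hx => by linarith [neg_abs_le (f' x), h x hx])
  exact abs_le.2 ⟨by linarith, by linarith⟩

theorem hasDerivAt_one_add_rpow {a t : ℝ} (ht : 0 ≤ t) :
    HasDerivAt (fun t : ℝ => (1 + t) ^ a) (a * (1 + t) ^ (a - 1)) t := by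
  have h := (((hasDerivAt_id t).const_add 1)).rpow_const (p := a)
    (Or.inl (by simp only [id]; positivity))
  simpa using h

/-! ### Modes of the Klein-Gordon equation with mass `μ / (1 + t)²` -/

/-- `z`, with derivative `z'`, solves `z'' + (r² + μ / (1 + t)²) z = 0` on `[0, ∞)`. -/
structure IsMassMode (μ r : ℝ) (z z' : ℝ → ℝ) : Prop where
  hasDeriv : ∀ t, 0 ≤ t → HasDerivWithinAt z (z' t) (Ici 0) t
  hasDeriv' : ∀ t, 0 ≤ t → HasDerivWithinAt z' (-(r ^ 2 + μ / (1 + t) ^ 2) * z t) (Ici 0) t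

/-- The energy changes only through the explicit time dependence of the mass, which decreases
because `μ ≥ 0`. -/
theorem IsMassMode.energy_le {μ r : ℝ} {z z' : ℝ → ℝ} (h : IsMassMode μ r z z') (hμ : 0 ≤ μ)
    {s t : ℝ} (hs : 0 ≤ s) (hst : s ≤ t) :
    z' t ^ 2 + (r ^ 2 + μ / (1 + t) ^ 2) * z t ^ 2
      ≤ z' s ^ 2 + (r ^ 2 + μ / (1 + s) ^ 2) * z s ^ 2 := by
  have hq : ∀ x : ℝ, 0 ≤ x → HasDerivAt (fun x : ℝ => r ^ 2 + μ / (1 + x) ^ 2)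
      (-(2 * μ / (1 + x) ^ 3)) x := by
    intro x hx
    have hx1 : (1 + x) ≠ 0 := by positivity
    have h2 := (((((hasDerivAt_id x).const_add 1).pow 2).inv (pow_ne_zero 2 hx1)).const_mul
      μ).const_add (r ^ 2)
    refine (h2.congr_deriv ?_)
    simp
    field_simp
  refine le_of_hasDerivWithinAt_nonpos hs hst
    (f := fun t => z' t ^ 2 + (r ^ 2 + μ / (1 + t) ^ 2) * z t ^ 2)
    (f' := fun x => -(2 * μ / (1 + x) ^ 3) * z x ^ 2) (fun x hx => ?_) (fun x hx => ?_)
  · have hx0 := hs.trans hx.1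
    have := ((h.hasDeriv' x hx0).pow 2).add
      ((hq x hx0).hasDerivWithinAt.mul ((h.hasDeriv x hx0).pow 2))
    refine this.congr_deriv ?_
    simp
    ring
  · have hx0 := hs.trans hx.1
    have : 0 ≤ 2 * μ / (1 + x) ^ 3 * z x ^ 2 := by positivity
    linarith

/-- Uniform bound for radially damped oscillators `w'' + 2b/(1+t) w' + r² w = 0` with `b ≥ 0`;
`H` is a primitive of `(1+t)^{-2b}`. -/
theorem abs_le_of_damped_oscillator {b r : ℝ} (hb : 0 ≤ b) {w w' H : ℝ → ℝ}
    (hw : ∀ t, 0 ≤ t → HasDerivWithinAt w (w' t) (Ici 0) t)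
    (hw' : ∀ t, 0 ≤ t → HasDerivWithinAt w' (-(2 * b / (1 + t)) * w' t - r ^ 2 * w t) (Ici 0) t)
    (hH : ∀ t, 0 ≤ t → HasDerivWithinAt H ((1 + t) ^ (-(2 * b))) (Ici 0) t)
    {s t : ℝ} (hs : 0 ≤ s) (hst : s ≤ t) :
    |w t| ≤ 6 * (|w s| + |w' s| * ((1 + s) ^ (2 * b) * (H t - H s))) := by
  -- `H'` is nonincreasing, so on `[x, y]` it is at least its value at `y`.
  have hHmono : ∀ x y, 0 ≤ x → x ≤ y → (y - x) * (1 + y) ^ (-(2 * b)) ≤ H y - H x := by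
    intro x y hx hxy
    have := le_of_hasDerivWithinAt_nonpos hx hxy (f := fun q => q * (1 + y) ^ (-(2 * b)) - H q)
      (f' := fun q => 1 * (1 + y) ^ (-(2 * b)) - (1 + q) ^ (-(2 * b)))
      (fun q hq => ((hasDerivWithinAt_id q _).mul_const _).sub (hH q (hx.trans hq.1)))
      (fun q hq => by
        have h0 : 0 ≤ q := hx.trans hq.1
        have := Real.rpow_le_rpow_of_nonpos (by positivity : 0 < 1 + q)
          (by linarith [hq.2] : 1 + q ≤ 1 + y) (by linarith : -(2 * b) ≤ 0)
        linarith)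
    linarith
  -- monotone quantity `w'² + r² w²`
  have hG : ∀ x y, 0 ≤ x → x ≤ y → w' y ^ 2 + r ^ 2 * w y ^ 2 ≤ w' x ^ 2 + r ^ 2 * w x ^ 2 := by
    intro x y hx hxy
    refine le_of_hasDerivWithinAt_nonpos hx hxy (f := fun t => w' t ^ 2 + r ^ 2 * w t ^ 2)
      (f' := fun q => -(4 * b / (1 + q)) * w' q ^ 2) (fun q hq => ?_) (fun q hq => ?_)
    · have hq0 := hx.trans hq.1
      refine (((hw' q hq0).pow 2).add (((hw q hq0).pow 2).const_mul (r ^ 2))).congr_deriv ?_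
      simp
      ring
    · have hq0 := hx.trans hq.1
      have : 0 ≤ 4 * b / (1 + q) * w' q ^ 2 := by positivity
      linarith
  -- short times
  have hshort : ∀ T, s ≤ T → r ^ 2 * (T - s) ^ 2 ≤ 1 / 2 → ∃ S, 0 ≤ S ∧
      S ≤ 2 * (|w s| + |w' s| * ((1 + s) ^ (2 * b) * (H T - H s))) ∧
      (∀ x ∈ Icc s T, |w x| ≤ S) ∧
      ∀ x ∈ Icc s T, |w' x| ≤ |w' s| * ((1 + s) ^ (2 * b) * (1 + x) ^ (-(2 * b)))
        + r ^ 2 * S * (T - s) := by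
    intro T hsT hr
    have hcont : ContinuousOn (fun x => |w x|) (Icc s T) := fun x hx =>
      ((hw x (hs.trans hx.1)).continuousWithinAt.mono fun y hy => hs.trans hy.1).abs
    obtain ⟨m, hm, hmax⟩ := isCompact_Icc.exists_isMaxOn ⟨s, le_rfl, hsT⟩ hcont
    have hS : ∀ x ∈ Icc s T, |w x| ≤ |w m| := fun x hx => hmax hx
    have hd : ∀ x ∈ Icc s T, |w' x| ≤ |w' s| * ((1 + s) ^ (2 * b) * (1 + x) ^ (-(2 * b)))
        + r ^ 2 * |w m| * (T - s) := by
      intro x hx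
      have hx0 : 0 ≤ x := hs.trans hx.1
      -- `(1+q)^(2b)` is the integrating factor of the friction: `((1+q)^(2b) w')' = -r² (1+q)^(2b)
      -- w`.
      have hkey := abs_sub_le_of_hasDerivWithinAt hs hx.1
        (f := fun q => (1 + q) ^ (2 * b) * w' q)
        (f' := fun q => -(r ^ 2 * ((1 + q) ^ (2 * b) * w q)))
        (g := fun q => q * (r ^ 2 * ((1 + x) ^ (2 * b) * |w m|)))
        (g' := fun q => 1 * (r ^ 2 * ((1 + x) ^ (2 * b) * |w m|)))
        (fun q hq => ?_) (fun q _ => (hasDerivWithinAt_id q _).mul_const _) (fun q hq => ?_)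
      · have hp : (0:ℝ) < (1 + x) ^ (2 * b) := by positivity
        have h1 : (1 + x) ^ (2 * b) * |w' x| ≤ (1 + s) ^ (2 * b) * |w' s|
            + (x - s) * (r ^ 2 * ((1 + x) ^ (2 * b) * |w m|)) := by
          have h2 := abs_sub_abs_le_abs_sub ((1 + x) ^ (2 * b) * w' x) ((1 + s) ^ (2 * b) * w' s)
          rw [abs_mul, abs_mul, abs_of_pos hp,
            abs_of_pos (by positivity : (0:ℝ) < (1 + s) ^ (2 * b))] at h2
          linarith
        have hinv : (1 + x) ^ (-(2 * b)) = ((1 + x) ^ (2 * b))⁻¹ :=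
          Real.rpow_neg (by positivity) _
        rw [hinv]
        have h3 : |w' x| ≤ ((1 + s) ^ (2 * b) * |w' s|
            + (x - s) * (r ^ 2 * ((1 + x) ^ (2 * b) * |w m|))) / (1 + x) ^ (2 * b) := by
          rw [le_div_iff₀ hp]; linarith
        refine h3.trans ?_
        have h4 : ((1 + s) ^ (2 * b) * |w' s|
            + (x - s) * (r ^ 2 * ((1 + x) ^ (2 * b) * |w m|))) / (1 + x) ^ (2 * b)
            = |w' s| * ((1 + s) ^ (2 * b) * ((1 + x) ^ (2 * b))⁻¹) + r ^ 2 * |w m| * (x - s) := by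
          field_simp
        rw [h4]
        have : r ^ 2 * |w m| * (x - s) ≤ r ^ 2 * |w m| * (T - s) :=
          mul_le_mul_of_nonneg_left (by linarith [hx.2]) (by positivity)
        linarith
      · have hq0 : 0 ≤ q := hs.trans hq.1
        refine ((hasDerivAt_one_add_rpow hq0).hasDerivWithinAt.mul (hw' q hq0)).congr_deriv ?_
        have : (1 + q) ^ (2 * b) = (1 + q) * (1 + q) ^ (2 * b - 1) := by
          rw [Real.rpow_sub_one (by positivity)]
          field_simp
        rw [this]
        field_simp
        ring
      · have hq0 : 0 ≤ q := hs.trans hq.1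
        rw [abs_neg, abs_mul, abs_mul, abs_of_nonneg (sq_nonneg r),
          abs_of_pos (by positivity : (0:ℝ) < (1 + q) ^ (2 * b)), one_mul]
        have h1 := hS q ⟨hq.1, hq.2.trans hx.2⟩
        have h2 : (1 + q) ^ (2 * b) ≤ (1 + x) ^ (2 * b) :=
          Real.rpow_le_rpow (by positivity) (by linarith [hq.2]) (by positivity)
        exact mul_le_mul_of_nonneg_left (mul_le_mul h2 h1 (abs_nonneg _) (by positivity))
          (sq_nonneg r)
    have hm0 := hs.trans hm.1
    have hfin := abs_sub_le_of_hasDerivWithinAt hs hm.1 (f := w) (f' := w')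
      (g := fun q => |w' s| * ((1 + s) ^ (2 * b) * H q) + q * (r ^ 2 * |w m| * (T - s)))
      (g' := fun q => |w' s| * ((1 + s) ^ (2 * b) * (1 + q) ^ (-(2 * b)))
        + 1 * (r ^ 2 * |w m| * (T - s)))
      (fun q hq => hw q (hs.trans hq.1))
      (fun q hq => (((hH q (hs.trans hq.1)).const_mul _).const_mul _).add
        ((hasDerivWithinAt_id q _).mul_const _))
      (fun q hq => by rw [one_mul]; exact hd q ⟨hq.1, hq.2.trans hm.2⟩)
    have hHT : H m ≤ H T := by
      have := hHmono m T hm0 hm.2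
      have h0 : 0 ≤ (T - m) * (1 + T) ^ (-(2 * b)) :=
        mul_nonneg (by linarith [hm.2]) (by have := hm0.trans hm.2; positivity)
      linarith
    have h5 : |w' s| * ((1 + s) ^ (2 * b) * H m) ≤ |w' s| * ((1 + s) ^ (2 * b) * H T) := by
      gcongr
    -- On a short interval the restoring force costs at most half of the maximum `|w m|`, which is
    -- absorbed into the left side; this produces the factor 2.
    have h6 : (m - s) * (r ^ 2 * |w m| * (T - s)) ≤ 1 / 2 * |w m| := by
      calc (m - s) * (r ^ 2 * |w m| * (T - s)) ≤ (T - s) * (r ^ 2 * |w m| * (T - s)) :=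
            mul_le_mul_of_nonneg_right (by linarith [hm.2])
              (mul_nonneg (by positivity) (by linarith))
        _ = r ^ 2 * (T - s) ^ 2 * |w m| := by ring
        _ ≤ 1 / 2 * |w m| := by gcongr
    have h7 := abs_sub_abs_le_abs_sub (w m) (w s)
    refine ⟨|w m|, abs_nonneg _, ?_, hS, hd⟩
    nlinarith
  have hD0 : 0 ≤ (1 + s) ^ (2 * b) * (H t - H s) := by
    have := hHmono s t hs hst
    have ht := hs.trans hst
    have h0 : 0 ≤ (t - s) * (1 + t) ^ (-(2 * b)) := mul_nonneg (by linarith) (by positivity)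
    exact mul_nonneg (by positivity) (by linarith)
  have hX0 : 0 ≤ |w s| + |w' s| * ((1 + s) ^ (2 * b) * (H t - H s)) := by positivity
  rcases le_or_gt (r ^ 2 * (t - s) ^ 2) (1 / 2) with hr | hr
  · obtain ⟨S, -, hS, hwS, -⟩ := hshort t hst hr
    have := hwS t ⟨hst, le_rfl⟩
    linarith
  · have hr0 : r ≠ 0 := by
      rintro rfl
      norm_num at hr
    have hrp : 0 < |r| := abs_pos.2 hr0
    -- `s + δ` is the last time covered by the short-time estimate. Beyond it the monotone quantity
    -- takes over; it loses a factor `1/|r|` on `w'`, which is comparable to `δ`.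
    set δ : ℝ := √(1 / 2) / |r| with hδ
    have hδ2 : r ^ 2 * δ ^ 2 = 1 / 2 := by
      rw [hδ, div_pow, Real.sq_sqrt (by norm_num), sq_abs]
      field_simp
    have hδ0 : 0 < δ := by positivity
    have hδt : δ ≤ t - s := by
      by_contra! hc
      have : (t - s) ^ 2 ≤ δ ^ 2 := by
        have : 0 ≤ t - s := by linarith
        gcongr
      nlinarith [sq_nonneg r]
    have hδr : |r| * δ ≤ 1 := by
      have : (|r| * δ) ^ 2 ≤ 1 ^ 2 := by rw [mul_pow, sq_abs, hδ2]; norm_num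
      exact abs_le_of_sq_le_sq' this (by norm_num) |>.2
    have hδr' : 1 ≤ 2 * (|r| * δ) := by
      by_contra! hc
      have : (2 * (|r| * δ)) ^ 2 < 1 := by
        have : 0 ≤ 2 * (|r| * δ) := by positivity
        nlinarith
      rw [mul_pow, mul_pow, sq_abs, hδ2] at this
      norm_num at this
    obtain ⟨S, hS0, hS, hwS, hdS⟩ := hshort (s + δ) (by linarith) (by simp [hδ2])
    have hmem : s + δ ∈ Icc s (s + δ) := ⟨by linarith, le_rfl⟩
    have h1 := hwS _ hmem
    have h2 := hdS _ hmem
    have h3 := hG (s + δ) t (by linarith) (by linarith)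
    have h4 := hHmono s (s + δ) hs (by linarith)
    have h5 : H (s + δ) ≤ H t := by
      have := hHmono (s + δ) t (by linarith) (by linarith)
      have h0 : 0 ≤ (t - (s + δ)) * (1 + t) ^ (-(2 * b)) :=
        mul_nonneg (by linarith) (by have := hs.trans hst; positivity)
      linarith
    have hσ : (0:ℝ) < (1 + s) ^ (2 * b) := by positivity
    have h6 : |w' s| * ((1 + s) ^ (2 * b) * (H (s + δ) - H s))
        ≤ |w' s| * ((1 + s) ^ (2 * b) * (H t - H s)) := by gcongr
    set X := |w s| + |w' s| * ((1 + s) ^ (2 * b) * (H t - H s)) with hX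
    have hSX : S ≤ 2 * X := by linarith
    -- `δ |w'(s + δ)|` is controlled
    have h7 : δ * |w' (s + δ)| ≤ |w' s| * ((1 + s) ^ (2 * b) * (H t - H s)) + 1 / 2 * S := by
      have h8 : δ * |w' (s + δ)| ≤ |w' s| * ((1 + s) ^ (2 * b) * (δ * (1 + (s + δ)) ^ (-(2 * b))))
          + r ^ 2 * δ ^ 2 * S := by
        have := mul_le_mul_of_nonneg_left h2 hδ0.le
        calc _ ≤ _ := this
          _ = _ := by ring
      rw [hδ2] at h8
      have h9 : |w' s| * ((1 + s) ^ (2 * b) * (δ * (1 + (s + δ)) ^ (-(2 * b))))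
          ≤ |w' s| * ((1 + s) ^ (2 * b) * (H t - H s)) := by
        gcongr
        have : s + δ - s = δ := by ring
        rw [this] at h4
        linarith
      linarith
    -- Origin of the constant 6: `|w (s+δ)| ≤ S ≤ 2X`, and `2δ|w'(s+δ)| ≤ 2X + S ≤ 4X`.
    have h10 : |w t| ≤ |w (s + δ)| + 2 * (δ * |w' (s + δ)|) := by
      have h11 : r ^ 2 * w t ^ 2 ≤ w' (s + δ) ^ 2 + r ^ 2 * w (s + δ) ^ 2 := by
        linarith [sq_nonneg (w' t)]
      have h12 : w' (s + δ) ^ 2 ≤ r ^ 2 * (2 * (δ * |w' (s + δ)|)) ^ 2 := by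
        have : r ^ 2 * (2 * (δ * |w' (s + δ)|)) ^ 2 = 4 * (r ^ 2 * δ ^ 2) * w' (s + δ) ^ 2 := by
          rw [mul_pow, mul_pow, sq_abs]; ring
        rw [this, hδ2]
        nlinarith [sq_nonneg (w' (s + δ))]
      have h13 : w t ^ 2 ≤ (|w (s + δ)| + 2 * (δ * |w' (s + δ)|)) ^ 2 := by
        have h14 : r ^ 2 * w t ^ 2
            ≤ r ^ 2 * ((2 * (δ * |w' (s + δ)|)) ^ 2 + w (s + δ) ^ 2) := by linarith
        have h15 := le_of_mul_le_mul_left h14 (by positivity)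
        have h16 : 0 ≤ |w (s + δ)| * (2 * (δ * |w' (s + δ)|)) := by positivity
        nlinarith [sq_abs (w (s + δ))]
      exact abs_le_of_sq_le_sq h13 (by positivity)
    have h17 : |w' s| * ((1 + s) ^ (2 * b) * (H t - H s)) ≤ X := by
      linarith [abs_nonneg (w s)]
    linarith

/-- The exponent `1/2 + Re ν` of growth of the modes of low frequency. -/
noncomputable def growthExp (μ : ℝ) : ℝ := 1 / 2 + (nu μ).re

/-- The logarithmic correction at the critical mass `μ = 1/4`. -/
noncomputable def logFactor (μ t : ℝ) : ℝ := if μ = 1 / 4 then 1 + Real.log (1 + t) else 1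

theorem one_le_logFactor (μ : ℝ) {t : ℝ} (ht : 0 ≤ t) : 1 ≤ logFactor μ t := by
  unfold logFactor
  split_ifs
  · linarith [Real.log_nonneg (by linarith : (1:ℝ) ≤ 1 + t)]
  · exact le_rfl

theorem growthExp_of_le {μ : ℝ} (h : μ ≤ 1 / 4) : growthExp μ = 1 / 2 + 1 / 2 * √(1 - 4 * μ) := by
  rw [growthExp, nu, if_pos h, Complex.ofReal_re]

theorem growthExp_of_gt {μ : ℝ} (h : 1 / 4 < μ) : growthExp μ = 1 / 2 := by
  rw [growthExp, nu, if_neg (not_le.2 h)]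
  have : (Complex.I / 2 * ((√(4 * μ - 1) : ℝ) : ℂ)).re = 0 := by
    rw [Complex.re_mul_ofReal]
    simp
  rw [this, add_zero]

theorem half_le_growthExp (μ : ℝ) : 1 / 2 ≤ growthExp μ := by
  rcases le_or_gt μ (1 / 4) with h | h
  · rw [growthExp_of_le h]
    linarith [Real.sqrt_nonneg (1 - 4 * μ)]
  · exact (growthExp_of_gt h).ge

theorem growthExp_lt_one {μ : ℝ} (hμ : 0 < μ) : growthExp μ < 1 := by
  rcases le_or_gt μ (1 / 4) with h | h
  · rw [growthExp_of_le h]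
    have : √(1 - 4 * μ) < 1 := by
      rw [Real.sqrt_lt' one_pos]
      linarith
    linarith
  · rw [growthExp_of_gt h]
    norm_num

theorem growthExp_le_one {μ : ℝ} (hμ : 0 ≤ μ) : growthExp μ ≤ 1 := by
  rcases hμ.eq_or_lt with rfl | h
  · rw [growthExp_of_le (by norm_num)]
    norm_num
  · exact (growthExp_lt_one h).le

/-- The indicial equation: `(1+t)^b` solves the mode equation at frequency zero exactly when `b(b-1)
= -μ`, and `growthExp μ` is the larger root. -/
theorem growthExp_mul {μ : ℝ} (h : μ ≤ 1 / 4) : growthExp μ * (growthExp μ - 1) = -μ := by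
  rw [growthExp_of_le h]
  have := Real.sq_sqrt (by linarith : 0 ≤ 1 - 4 * μ)
  linear_combination this / 4

/-! ### Conjugation by powers of `1 + t` and growth of the modes -/

theorem IsMassMode.hasDeriv_rpow_mul {μ r : ℝ} {z z' : ℝ → ℝ} (h : IsMassMode μ r z z') (b : ℝ)
    {t : ℝ} (ht : 0 ≤ t) :
    HasDerivWithinAt (fun t => (1 + t) ^ (-b) * z t)
      ((1 + t) ^ (-b) * (z' t - b / (1 + t) * z t)) (Ici 0) t := by
  refine ((hasDerivAt_one_add_rpow ht).hasDerivWithinAt.mul (h.hasDeriv t ht)).congr_deriv ?_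
  rw [Real.rpow_sub_one (by positivity)]
  ring

/-- Conjugation trades mass for friction. If `b` solves the indicial equation the mass vanishes
altogether; for `b = 1/2` it becomes `μ - 1/4`. -/
theorem IsMassMode.hasDeriv_rpow_mul' {μ r : ℝ} {z z' : ℝ → ℝ} (h : IsMassMode μ r z z') (b : ℝ)
    {t : ℝ} (ht : 0 ≤ t) :
    HasDerivWithinAt (fun t => (1 + t) ^ (-b) * (z' t - b / (1 + t) * z t))
      (-(2 * b / (1 + t)) * ((1 + t) ^ (-b) * (z' t - b / (1 + t) * z t))
        - (r ^ 2 + (μ + b * (b - 1)) / (1 + t) ^ 2) * ((1 + t) ^ (-b) * z t)) (Ici 0) t := by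
  have ht1 : 1 + t ≠ 0 := by positivity
  have hinv : HasDerivAt (fun t : ℝ => b / (1 + t)) (-(b / (1 + t) ^ 2)) t := by
    refine ((((hasDerivAt_id t).const_add 1).inv ht1).const_mul b).congr_deriv ?_
    simp
    ring
  refine ((hasDerivAt_one_add_rpow ht).hasDerivWithinAt.mul
    ((h.hasDeriv' t ht).sub (hinv.hasDerivWithinAt.mul (h.hasDeriv t ht)))).congr_deriv ?_
  rw [Real.rpow_sub_one ht1]
  simp only [Pi.sub_apply, Pi.mul_apply]
  field_simp
  ring

/-- After conjugation by `(1+t)^b` only friction with coefficient `2b ≥ 0` remains, so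
`abs_le_of_damped_oscillator` applies. The number `l` measures the growth of the primitive `H`: it
is bounded for `2b > 1` and logarithmic for `2b = 1`. -/
theorem IsMassMode.abs_le_of_primitive {μ r b : ℝ} {z z' H : ℝ → ℝ} (h : IsMassMode μ r z z')
    (hb0 : 0 ≤ b) (hb1 : b ≤ 1) (hb : b * (b - 1) = -μ)
    (hH : ∀ t, 0 ≤ t → HasDerivWithinAt H ((1 + t) ^ (-(2 * b))) (Ici 0) t)
    {s t l : ℝ} (hs : 0 ≤ s) (hst : s ≤ t) (hl0 : 0 ≤ l)
    (hl : (1 + s) ^ (2 * b) * (H t - H s) ≤ (1 + s) * l) :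
    |z t| ≤ 6 * (1 + l) * (1 + t) ^ b * ((1 + s) ^ (-b) * (|z s| + (1 + s) * |z' s|)) := by
  have ht := hs.trans hst
  have key := abs_le_of_damped_oscillator hb0 (r := r)
    (w := fun t => (1 + t) ^ (-b) * z t)
    (w' := fun t => (1 + t) ^ (-b) * (z' t - b / (1 + t) * z t))
    (fun t ht => h.hasDeriv_rpow_mul b ht) (fun t ht => ?_) hH hs hst
  · have hσ : (0:ℝ) < (1 + s) ^ (-b) := by positivity
    have hτ : (0:ℝ) < (1 + t) ^ b := by positivity
    have h1 : |z' s - b / (1 + s) * z s| * (1 + s) ≤ (1 + s) * |z' s| + |z s| := by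
      have h2 : |z' s - b / (1 + s) * z s| ≤ |z' s| + b / (1 + s) * |z s| := by
        refine (abs_sub _ _).trans (le_of_eq ?_)
        rw [abs_mul, abs_of_nonneg (by positivity : 0 ≤ b / (1 + s))]
      calc |z' s - b / (1 + s) * z s| * (1 + s) ≤ (|z' s| + b / (1 + s) * |z s|) * (1 + s) := by
            gcongr
        _ = (1 + s) * |z' s| + b * |z s| := by field_simp
        _ ≤ _ := by nlinarith [abs_nonneg (z s)]
    have h3 : |(1 + s) ^ (-b) * (z' s - b / (1 + s) * z s)| * ((1 + s) ^ (2 * b) * (H t - H s))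
        ≤ (1 + s) ^ (-b) * (((1 + s) * |z' s| + |z s|) * l) := by
      rw [abs_mul, abs_of_pos hσ, mul_assoc]
      refine mul_le_mul_of_nonneg_left ?_ hσ.le
      calc _ ≤ |z' s - b / (1 + s) * z s| * ((1 + s) * l) := by gcongr
        _ = |z' s - b / (1 + s) * z s| * (1 + s) * l := by ring
        _ ≤ _ := by gcongr
    have h4 : |z t| = (1 + t) ^ b * |(1 + t) ^ (-b) * z t| := by
      rw [abs_mul, abs_of_pos (by positivity : (0:ℝ) < (1 + t) ^ (-b)), ← mul_assoc,
        ← Real.rpow_add (by positivity)]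
      simp
    rw [h4]
    have h5 : |(1 + t) ^ (-b) * z t| ≤ 6 * ((1 + s) ^ (-b) * |z s|
        + (1 + s) ^ (-b) * (((1 + s) * |z' s| + |z s|) * l)) := by
      refine key.trans ?_
      rw [abs_mul ((1 + s) ^ (-b)) (z s), abs_of_pos hσ]
      linarith
    calc _ ≤ (1 + t) ^ b * (6 * ((1 + s) ^ (-b) * |z s|
        + (1 + s) ^ (-b) * (((1 + s) * |z' s| + |z s|) * l))) := by gcongr
      _ = 6 * (1 + t) ^ b * (1 + s) ^ (-b) * (|z s| + ((1 + s) * |z' s| + |z s|) * l) := by ring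
      _ ≤ 6 * (1 + t) ^ b * (1 + s) ^ (-b) * ((1 + l) * (|z s| + (1 + s) * |z' s|)) := by
          refine mul_le_mul_of_nonneg_left ?_ (by positivity)
          nlinarith [abs_nonneg (z s), mul_nonneg (by linarith : 0 ≤ 1 + s) (abs_nonneg (z' s))]
      _ = _ := by ring
  · refine (h.hasDeriv_rpow_mul' b ht).congr_deriv ?_
    rw [hb]
    simp

/-- The indicial roots are complex here, so `b = 1/2` leaves the mass `κ² = μ - 1/4 > 0`. In the
time `τ = log(1+t)` the conjugated mode solves `w_ττ + ω² w = 0` with `ω² = r²(1+t)² + κ²`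
increasing, so `w² + w_τ²/ω²` is nonincreasing, and `ω² ≥ κ²` bounds its initial value uniformly in
`r`. -/
theorem IsMassMode.abs_le_of_large_mass {μ r : ℝ} {z z' : ℝ → ℝ} (h : IsMassMode μ r z z')
    (hμ : 1 / 4 < μ) {s t : ℝ} (hs : 0 ≤ s) (hst : s ≤ t) :
    |z t| ≤ (2 + 1 / √(μ - 1 / 4)) * (1 + t) ^ (1 / 2 : ℝ)
      * ((1 + s) ^ (-(1 / 2) : ℝ) * (|z s| + (1 + s) * |z' s|)) := by
  have ht := hs.trans hst
  set κ := √(μ - 1 / 4) with hκ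
  have hκ0 : 0 < κ := Real.sqrt_pos.2 (by linarith)
  have hκ2 : κ ^ 2 = μ - 1 / 4 := Real.sq_sqrt (by linarith)
  set w : ℝ → ℝ := fun t => (1 + t) ^ (-(1 / 2) : ℝ) * z t with hw
  set w' : ℝ → ℝ := fun t => (1 + t) ^ (-(1 / 2) : ℝ) * (z' t - 1 / 2 / (1 + t) * z t) with hw'
  have hG := le_of_hasDerivWithinAt_nonpos hs hst
    (f := fun t => w t ^ 2 + w' t ^ 2 * ((1 + t) ^ 2 * (r ^ 2 * (1 + t) ^ 2 + κ ^ 2)⁻¹))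
    (f' := fun t => -(2 * r ^ 2 * (1 + t) ^ 3 * ((r ^ 2 * (1 + t) ^ 2 + κ ^ 2)⁻¹) ^ 2 * w' t ^ 2))
    (fun q hq => ?_) (fun q hq => ?_)
  · have h1 : w t ^ 2 ≤ w s ^ 2 + (w' s * (1 + s) / κ) ^ 2 := by
      have h2 : 0 ≤ w' t ^ 2 * ((1 + t) ^ 2 * (r ^ 2 * (1 + t) ^ 2 + κ ^ 2)⁻¹) := by positivity
      have h3 : (r ^ 2 * (1 + s) ^ 2 + κ ^ 2)⁻¹ ≤ (κ ^ 2)⁻¹ :=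
        inv_anti₀ (by positivity) (by nlinarith [mul_nonneg (sq_nonneg r) (sq_nonneg (1 + s))])
      have h4 : w' s ^ 2 * ((1 + s) ^ 2 * (r ^ 2 * (1 + s) ^ 2 + κ ^ 2)⁻¹)
          ≤ w' s ^ 2 * ((1 + s) ^ 2 * (κ ^ 2)⁻¹) := by gcongr
      have h5 : (w' s * (1 + s) / κ) ^ 2 = w' s ^ 2 * ((1 + s) ^ 2 * (κ ^ 2)⁻¹) := by
        field_simp
      rw [h5]
      linarith
    have h6 : |w t| ≤ |w s| + |w' s * (1 + s) / κ| := by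
      refine abs_le_of_sq_le_sq (h1.trans ?_) (by positivity)
      rw [← sq_abs (w s), ← sq_abs (w' s * (1 + s) / κ)]
      nlinarith [mul_nonneg (abs_nonneg (w s)) (abs_nonneg (w' s * (1 + s) / κ))]
    have hσ : (0:ℝ) < (1 + s) ^ (-(1 / 2) : ℝ) := by positivity
    have h4 : |z t| = (1 + t) ^ (1 / 2 : ℝ) * |w t| := by
      rw [hw, abs_mul, abs_of_pos (by positivity : (0:ℝ) < (1 + t) ^ (-(1 / 2) : ℝ)), ← mul_assoc,
        ← Real.rpow_add (by positivity)]
      simp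
    have h7 : |w' s * (1 + s) / κ|
        ≤ (1 + s) ^ (-(1 / 2) : ℝ) * ((1 / κ) * ((1 + s) * |z' s|) + 1 / κ * (1 / 2 * |z s|)) := by
      have h2 : |z' s - 1 / 2 / (1 + s) * z s| ≤ |z' s| + 1 / 2 / (1 + s) * |z s| := by
        refine (abs_sub _ _).trans (le_of_eq ?_)
        rw [abs_mul, abs_of_nonneg (by positivity : 0 ≤ 1 / 2 / (1 + s))]
      rw [hw', abs_div, abs_mul, abs_mul, abs_of_pos hσ, abs_of_pos hκ0,
        abs_of_pos (by linarith : 0 < 1 + s)]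
      calc _ ≤ (1 + s) ^ (-(1 / 2) : ℝ) * (|z' s| + 1 / 2 / (1 + s) * |z s|) * (1 + s) / κ := by
            gcongr
        _ = _ := by field_simp
    have h8 : |w s| = (1 + s) ^ (-(1 / 2) : ℝ) * |z s| := by
      rw [hw, abs_mul, abs_of_pos hσ]
    rw [h4, mul_comm (2 + 1 / κ), mul_assoc]
    refine mul_le_mul_of_nonneg_left ?_ (by positivity)
    refine (h6.trans (add_le_add h8.le h7)).trans ?_
    have hk : 0 < 1 / κ := by positivity
    have e : (2 + 1 / κ) * ((1 + s) ^ (-(1 / 2) : ℝ) * (|z s| + (1 + s) * |z' s|))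
      - ((1 + s) ^ (-(1 / 2) : ℝ) * |z s| + (1 + s) ^ (-(1 / 2) : ℝ)
        * ((1 / κ) * ((1 + s) * |z' s|) + 1 / κ * (1 / 2 * |z s|)))
      = (1 + s) ^ (-(1 / 2) : ℝ) * (|z s| + 2 * ((1 + s) * |z' s|) + 1 / κ * (1 / 2 * |z s|)) := by
      ring
    have : 0 ≤ (1 + s) ^ (-(1 / 2) : ℝ)
        * (|z s| + 2 * ((1 + s) * |z' s|) + 1 / κ * (1 / 2 * |z s|)) := by positivity
    linarith
  · have hq0 : 0 ≤ q := hs.trans hq.1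
    have hq1 : (1 + q) ≠ 0 := by positivity
    have hd := h.hasDeriv_rpow_mul (1 / 2) hq0
    have hd' := h.hasDeriv_rpow_mul' (1 / 2) hq0
    have hne : r ^ 2 * (1 + q) ^ 2 + κ ^ 2 ≠ 0 := by positivity
    have hQ : HasDerivAt (fun q : ℝ => (1 + q) ^ 2 * (r ^ 2 * (1 + q) ^ 2 + κ ^ 2)⁻¹)
        (2 * (1 + q) * κ ^ 2 * ((r ^ 2 * (1 + q) ^ 2 + κ ^ 2)⁻¹) ^ 2) q := by
      have h1 : HasDerivAt (fun q : ℝ => (1 + q) ^ 2) (2 * (1 + q)) q := by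
        refine (((hasDerivAt_id q).const_add 1).pow 2).congr_deriv ?_
        simp
      refine (h1.mul (((h1.const_mul (r ^ 2)).add_const (κ ^ 2)).inv hne)).congr_deriv ?_
      simp only [Pi.inv_apply]
      field_simp
      ring
    refine ((hd.pow 2).add ((hd'.pow 2).mul hQ.hasDerivWithinAt)).congr_deriv ?_
    have e1 : (r ^ 2 + (μ + 1 / 2 * (1 / 2 - 1)) / (1 + q) ^ 2)
        = (r ^ 2 * (1 + q) ^ 2 + κ ^ 2) / (1 + q) ^ 2 := by
      rw [hκ2]
      field_simp
      ring
    rw [e1]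
    change _ = -(2 * r ^ 2 * (1 + q) ^ 3 * ((r ^ 2 * (1 + q) ^ 2 + κ ^ 2)⁻¹) ^ 2
      * ((1 + q) ^ (-(1 / 2) : ℝ) * (z' q - 1 / 2 / (1 + q) * z q)) ^ 2)
    simp only [Pi.pow_apply]
    generalize (1 + q) ^ (-(1 / 2) : ℝ) * (z' q - 1 / 2 / (1 + q) * z q) = p
    generalize (1 + q) ^ (-(1 / 2) : ℝ) * z q = v
    simp only [Nat.add_one_sub_one, pow_one, Nat.cast_ofNat]
    field_simp
    ring
  · have hq0 : 0 ≤ q := hs.trans hq.1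
    have : 0 ≤ 2 * r ^ 2 * (1 + q) ^ 3 * ((r ^ 2 * (1 + q) ^ 2 + κ ^ 2)⁻¹) ^ 2 * w' q ^ 2 := by
      positivity
    linarith

/-- All modes grow at most like `(1 + t)^{1/2 + Re ν}`, with a logarithm at `μ = 1/4`, uniformly in
the frequency. -/
theorem exists_massMode_growth {μ : ℝ} (hμ : 0 ≤ μ) : ∃ C : ℝ, 0 ≤ C ∧
    ∀ (r : ℝ) (z z' : ℝ → ℝ), IsMassMode μ r z z' → ∀ s t : ℝ, 0 ≤ s → s ≤ t →
      |z t| ≤ C * ((1 + t) ^ growthExp μ * logFactor μ t)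
        * ((1 + s) ^ (-growthExp μ) * (|z s| + (1 + s) * |z' s|)) := by
  -- The cases are those of the indicial roots: real and distinct (then `2b > 1` and `(1+t)^(-2b)`
  -- is integrable), double (its primitive is the logarithm), and complex.
  rcases lt_trichotomy μ (1 / 4) with h | h | h
  · set b := growthExp μ with hb
    have hb2 : 0 < 2 * b - 1 := by
      rw [hb, growthExp_of_le h.le]
      have := Real.sqrt_pos.2 (by linarith : 0 < 1 - 4 * μ)
      linarith
    refine ⟨6 * (1 + 1 / (2 * b - 1)), by positivity, fun r z z' hz s t hs hst => ?_⟩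
    rw [logFactor, if_neg h.ne, mul_one]
    refine hz.abs_le_of_primitive (H := fun t => -(1 + t) ^ (1 - 2 * b) / (2 * b - 1))
      (by linarith) (growthExp_le_one hμ) (growthExp_mul h.le) (fun t ht => ?_) hs hst
      (by positivity) ?_
    · refine ((hasDerivAt_one_add_rpow ht).neg.div_const _).hasDerivWithinAt.congr_deriv ?_
      have : 1 - 2 * b - 1 = -(2 * b) := by ring
      rw [this]
      field_simp
      ring
    · have ht := hs.trans hst
      have h1 : (1 + s) ^ (2 * b) * (1 + s) ^ (1 - 2 * b) = 1 + s := by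
        rw [← Real.rpow_add (by positivity)]
        simp
      have h2 : (0:ℝ) ≤ (1 + s) ^ (2 * b) * ((1 + t) ^ (1 - 2 * b) / (2 * b - 1)) := by positivity
      have h3 : (1 + s) ^ (2 * b)
          * (-(1 + t) ^ (1 - 2 * b) / (2 * b - 1) - -(1 + s) ^ (1 - 2 * b) / (2 * b - 1))
          = ((1 + s) ^ (2 * b) * (1 + s) ^ (1 - 2 * b)) * (1 / (2 * b - 1))
            - (1 + s) ^ (2 * b) * ((1 + t) ^ (1 - 2 * b) / (2 * b - 1)) := by ring
      rw [h3, h1]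
      linarith
  · have hb : growthExp μ = 1 / 2 := by
      rw [growthExp_of_le h.le, h]
      norm_num
    refine ⟨6, by norm_num, fun r z z' hz s t hs hst => ?_⟩
    have ht := hs.trans hst
    have e : 6 * ((1 + t) ^ (1 / 2 : ℝ) * (1 + Real.log (1 + t)))
        = 6 * (1 + Real.log (1 + t)) * (1 + t) ^ (1 / 2 : ℝ) := by ring
    rw [logFactor, if_pos h, hb, e]
    refine hz.abs_le_of_primitive (H := fun t => Real.log (1 + t)) (b := 1 / 2)
      (l := Real.log (1 + t)) (by norm_num) (by norm_num) (by rw [h]; norm_num) (fun t ht => ?_) hs hst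
      (Real.log_nonneg (by linarith)) ?_
    · have h1 : HasDerivAt (fun t : ℝ => Real.log (1 + t)) (1 / (1 + t)) t :=
        ((hasDerivAt_id t).const_add 1).log (by simp only [id]; positivity)
      refine h1.hasDerivWithinAt.congr_deriv ?_
      rw [Real.rpow_neg (by positivity)]
      norm_num
    · have : Real.log (1 + s) ≥ 0 := Real.log_nonneg (by linarith)
      norm_num
      nlinarith
  · refine ⟨2 + 1 / √(μ - 1 / 4), by positivity, fun r z z' hz s t hs hst => ?_⟩
    rw [logFactor, if_neg h.ne', mul_one, growthExp_of_gt h]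
    exact hz.abs_le_of_large_mass h hs hst

/-! ### Wave profiles of a mode -/

/-- The components of `𝒲(-t)(z, z')`, the first one multiplied by the frequency. -/
noncomputable def profileFst (r t a b : ℝ) : ℝ := Real.cos (r * t) * (r * a) - Real.sin (r * t) * b

noncomputable def profileSnd (r t a b : ℝ) : ℝ := Real.sin (r * t) * (r * a) + Real.cos (r * t) * b

theorem profile_sq_add (r t a b : ℝ) :
    profileFst r t a b ^ 2 + profileSnd r t a b ^ 2 = (r * a) ^ 2 + b ^ 2 := by
  unfold profileFst profileSnd
  linear_combination ((r * a) ^ 2 + b ^ 2) * Real.sin_sq_add_cos_sq (r * t)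

theorem abs_profileFst_le (r t a b : ℝ) : |profileFst r t a b| ≤ √((r * a) ^ 2 + b ^ 2) :=
  Real.abs_le_sqrt (by rw [← profile_sq_add r t]; nlinarith [sq_nonneg (profileSnd r t a b)])

theorem abs_profileSnd_le (r t a b : ℝ) : |profileSnd r t a b| ≤ √((r * a) ^ 2 + b ^ 2) :=
  Real.abs_le_sqrt (by rw [← profile_sq_add r t]; nlinarith [sq_nonneg (profileFst r t a b)])

/-- The rotation by the angle `rt` cancels the `r²` part of the equation, so that only the mass term
drives the profile. -/
theorem IsMassMode.hasDeriv_profile {μ r : ℝ} {z z' : ℝ → ℝ} (h : IsMassMode μ r z z') {t : ℝ}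
    (ht : 0 ≤ t) :
    HasDerivWithinAt (fun t => profileFst r t (z t) (z' t))
      (Real.sin (r * t) * (μ / (1 + t) ^ 2 * z t)) (Ici 0) t ∧
    HasDerivWithinAt (fun t => profileSnd r t (z t) (z' t))
      (-(Real.cos (r * t) * (μ / (1 + t) ^ 2 * z t))) (Ici 0) t := by
  have hl : HasDerivAt (fun t : ℝ => r * t) r t := by
    simpa using (hasDerivAt_id t).const_mul r
  have hc := hl.cos.hasDerivWithinAt (s := Ici 0)
  have hs := hl.sin.hasDerivWithinAt (s := Ici 0)
  have hz := (h.hasDeriv t ht).const_mul r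
  have hz' := h.hasDeriv' t ht
  constructor
  · refine ((hc.mul hz).sub (hs.mul hz')).congr_deriv ?_
    ring
  · refine ((hs.mul hz).add (hc.mul hz')).congr_deriv ?_
    ring

/-- Insert the growth bound into the derivative of the profile and integrate over `[t, t']`. The
factor `μ` is kept in front, so that profiles are constant for `μ = 0`. -/
theorem exists_profile_variation {μ : ℝ} (hμ : 0 ≤ μ) : ∃ C : ℝ, 0 ≤ C ∧
    ∀ (r : ℝ) (z z' : ℝ → ℝ), IsMassMode μ r z z' → ∀ s t t' : ℝ, 0 ≤ s → s ≤ t → t ≤ t' →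
      |profileFst r t' (z t') (z' t') - profileFst r t (z t) (z' t)|
        ≤ μ * C * ((1 + t) ^ (growthExp μ - 1) * logFactor μ t)
          * ((1 + s) ^ (-growthExp μ) * (|z s| + (1 + s) * |z' s|)) ∧
      |profileSnd r t' (z t') (z' t') - profileSnd r t (z t) (z' t)|
        ≤ μ * C * ((1 + t) ^ (growthExp μ - 1) * logFactor μ t)
          * ((1 + s) ^ (-growthExp μ) * (|z s| + (1 + s) * |z' s|)) := by
  obtain ⟨K, hK0, hK⟩ := exists_massMode_growth hμ
  -- a primitive of the majorant
  obtain ⟨Φ, C, hC, hΦ, hΦb⟩ : ∃ (Φ : ℝ → ℝ) (C : ℝ), 0 ≤ C ∧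
      (∀ x, 0 ≤ x → HasDerivWithinAt Φ
        (μ * ((1 + x) ^ (growthExp μ - 2) * logFactor μ x)) (Ici 0) x) ∧
      ∀ x y, 0 ≤ x → x ≤ y → Φ y - Φ x ≤ μ * C * ((1 + x) ^ (growthExp μ - 1) * logFactor μ x) := by
    -- For `μ = 0` the exponent `growthExp μ` equals 1 and `(1+x)^(-1)` is not integrable; there the
    -- factor `μ` makes the majorant vanish.
    rcases hμ.eq_or_lt with rfl | hμ'
    · refine ⟨fun _ => 0, 0, le_rfl, fun x hx => ?_, fun x y hx hxy => by simp⟩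
      rw [zero_mul]
      exact hasDerivWithinAt_const _ _ _
    by_cases h : μ = 1 / 4
    · have hb : growthExp μ = 1 / 2 := by
        rw [growthExp_of_le h.le, h]
        norm_num
      rw [hb]
      -- The 6 is forced by differentiating: `3 + log - 2 = 1 + log` is the logarithmic factor of
      -- the majorant.
      refine ⟨fun x => -(μ * ((1 + x) ^ (1 / 2 - 1 : ℝ) * (6 + 2 * Real.log (1 + x)))), 6,
        by norm_num, fun x hx => ?_, fun x y hx hxy => ?_⟩
      · have h1 : HasDerivAt (fun t : ℝ => Real.log (1 + t)) (1 / (1 + x)) x :=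
          ((hasDerivAt_id x).const_add 1).log (by simp only [id]; positivity)
        refine (((hasDerivAt_one_add_rpow hx).mul ((h1.const_mul 2).const_add 6)).const_mul
          μ).neg.hasDerivWithinAt.congr_deriv ?_
        have e : (1 / 2 - 1 : ℝ) = (1 / 2 - 2 : ℝ) + 1 := by norm_num
        rw [logFactor, if_pos h, e, Real.rpow_add_one (by positivity)]
        norm_num
        field_simp
        ring
      · have hy := hx.trans hxy
        have h2 : 0 ≤ μ * ((1 + y) ^ (1 / 2 - 1 : ℝ) * (6 + 2 * Real.log (1 + y))) := by
          have := Real.log_nonneg (by linarith : (1:ℝ) ≤ 1 + y)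
          positivity
        have h3 : μ * ((1 + x) ^ (1 / 2 - 1 : ℝ) * (6 + 2 * Real.log (1 + x)))
            ≤ μ * 6 * ((1 + x) ^ (1 / 2 - 1 : ℝ) * logFactor μ x) := by
          rw [logFactor, if_pos h, mul_assoc, mul_left_comm 6]
          have := Real.log_nonneg (by linarith : (1:ℝ) ≤ 1 + x)
          gcongr
          linarith
        linarith
    · have hb := growthExp_lt_one hμ'
      have hb' : 0 < 1 - growthExp μ := by linarith
      simp only [logFactor, if_neg h, mul_one]
      refine ⟨fun x => -(μ * ((1 + x) ^ (growthExp μ - 1) / (1 - growthExp μ))),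
        1 / (1 - growthExp μ), by positivity, fun x hx => ?_, fun x y hx hxy => ?_⟩
      · refine (((hasDerivAt_one_add_rpow hx).div_const _).const_mul
          μ).neg.hasDerivWithinAt.congr_deriv ?_
        have e : growthExp μ - 1 - 1 = growthExp μ - 2 := by ring
        rw [e]
        field_simp
        ring
      · have hy := hx.trans hxy
        have h2 : 0 ≤ μ * ((1 + y) ^ (growthExp μ - 1) / (1 - growthExp μ)) := by positivity
        have e : μ * (1 / (1 - growthExp μ)) * (1 + x) ^ (growthExp μ - 1)
            = μ * ((1 + x) ^ (growthExp μ - 1) / (1 - growthExp μ)) := by ring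
        rw [e]
        linarith
  refine ⟨C * K, by positivity, fun r z z' hz s t t' hs hst htt' => ?_⟩
  have ht := hs.trans hst
  set D := (1 + s) ^ (-growthExp μ) * (|z s| + (1 + s) * |z' s|) with hD
  have hD0 : 0 ≤ D := by positivity
  have hbound : ∀ x ∈ Icc t t', μ / (1 + x) ^ 2 * |z x|
      ≤ K * D * (μ * ((1 + x) ^ (growthExp μ - 2) * logFactor μ x)) := by
    intro x hx
    have hx0 := ht.trans hx.1
    have e : (1 + x) ^ (growthExp μ - 2) = (1 + x) ^ growthExp μ / (1 + x) ^ 2 := by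
      rw [Real.rpow_sub (by positivity)]
      norm_num
    rw [e]
    calc _ ≤ μ / (1 + x) ^ 2 * (K * ((1 + x) ^ growthExp μ * logFactor μ x) * D) := by
          have := hK r z z' hz s x hs (hst.trans hx.1)
          gcongr
      _ = _ := by ring
  have hfin : K * D * Φ t' - K * D * Φ t
      ≤ μ * (C * K) * ((1 + t) ^ (growthExp μ - 1) * logFactor μ t) * D := by
    have := mul_le_mul_of_nonneg_left (hΦb t t' ht htt') (by positivity : 0 ≤ K * D)
    linarith
  have hcoef : ∀ x, 0 ≤ x → 0 ≤ μ / (1 + x) ^ 2 := fun x hx => by positivity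
  refine ⟨(abs_sub_le_of_hasDerivWithinAt ht htt'
    (fun x hx => (hz.hasDeriv_profile (ht.trans hx.1)).1)
    (fun x hx => (hΦ x (ht.trans hx.1)).const_mul (K * D)) (fun x hx => ?_)).trans hfin,
    (abs_sub_le_of_hasDerivWithinAt ht htt'
    (fun x hx => (hz.hasDeriv_profile (ht.trans hx.1)).2)
    (fun x hx => (hΦ x (ht.trans hx.1)).const_mul (K * D)) (fun x hx => ?_)).trans hfin⟩
  · refine le_trans ?_ (hbound x hx)
    rw [abs_mul, abs_mul, abs_of_nonneg (hcoef x (ht.trans hx.1))]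
    exact mul_le_of_le_one_left (mul_nonneg (hcoef x (ht.trans hx.1)) (abs_nonneg _))
      (Real.abs_sin_le_one _)
  · refine le_trans ?_ (hbound x hx)
    rw [abs_neg, abs_mul, abs_mul, abs_of_nonneg (hcoef x (ht.trans hx.1))]
    exact mul_le_of_le_one_left (mul_nonneg (hcoef x (ht.trans hx.1)) (abs_nonneg _))
      (Real.abs_cos_le_one _)

/-! ### Continuity of modes in the frequency -/

theorem IsMassMode.hasDeriv_pair {μ r : ℝ} {z z' : ℝ → ℝ} (h : IsMassMode μ r z z') {t : ℝ}
    (ht : 0 ≤ t) :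
    HasDerivWithinAt (fun t => (z t, z' t)) (dampedMatrix 0 μ r t (z t, z' t)) (Ici 0) t := by
  rw [dampedMatrix_apply, abs_of_nonneg ht]
  refine ((h.hasDeriv t ht).prodMk (h.hasDeriv' t ht)).congr_deriv ?_
  ext
  · rfl
  · simp
    ring

theorem IsMassMode.smul {μ r : ℝ} {z z' : ℝ → ℝ} (h : IsMassMode μ r z z') (c : ℝ) :
    IsMassMode μ r (fun t => c * z t) (fun t => c * z' t) :=
  ⟨fun t ht => (h.hasDeriv t ht).const_mul c, fun t ht =>
    ((h.hasDeriv' t ht).const_mul c).congr_deriv (by ring)⟩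

/-- Needed so that the modes define measurable Fourier symbols. Two frequencies give systems that
differ by `(r² - r₀²) z`; the growth bound controls `z` uniformly in `r` on `[s, t]`, and Gronwall's
inequality concludes. -/
theorem continuous_massMode {μ : ℝ} (hμ : 0 ≤ μ) {z z' : ℝ → ℝ → ℝ}
    (h : ∀ r, IsMassMode μ r (z r) (z' r)) {s a b : ℝ} (hs : 0 ≤ s) (ha : ∀ r, z r s = a)
    (hb : ∀ r, z' r s = b) {t : ℝ} (hst : s ≤ t) :
    Continuous fun r => (z r t, z' r t) := by
  obtain ⟨C, hC0, hC⟩ := exists_massMode_growth hμ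
  have ht := hs.trans hst
  obtain ⟨M, hM⟩ : ∃ M, ∀ r, ∀ x ∈ Icc s t, |z r x| ≤ M := by
    refine ⟨C * ((1 + t) ^ growthExp μ * (1 + Real.log (1 + t)))
      * ((1 + s) ^ (-growthExp μ) * (|a| + (1 + s) * |b|)), fun r x hx => ?_⟩
    have hx0 := hs.trans hx.1
    have h1 := hC r _ _ (h r) s x hs hx.1
    rw [ha, hb] at h1
    refine h1.trans ?_
    have hg := half_le_growthExp μ
    have hlt := Real.log_nonneg (by linarith : (1:ℝ) ≤ 1 + t)
    have hl : logFactor μ x ≤ 1 + Real.log (1 + t) := by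
      unfold logFactor
      split_ifs
      · have := Real.log_le_log (by linarith) (by linarith [hx.2] : 1 + x ≤ 1 + t)
        linarith
      · linarith
    have hl0 := one_le_logFactor μ hx0
    gcongr
    exact hx.2
  refine continuous_iff_continuousAt.2 fun r₀ => ?_
  obtain ⟨K, hK⟩ := exists_bound_dampedMatrix 0 μ r₀
  have hL : ∀ t, LipschitzWith K (fun x => dampedMatrix 0 μ r₀ t x) := fun t =>
    (dampedMatrix 0 μ r₀ t).lipschitz.weaken (by exact_mod_cast hK t)
  have hcont : ∀ r, ContinuousOn (fun t => (z r t, z' r t)) (Icc s t) := fun r x hx =>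
    ((h r).hasDeriv_pair (hs.trans hx.1)).continuousWithinAt.mono fun y hy => hs.trans hy.1
  have hderiv : ∀ r, ∀ x ∈ Ico s t, HasDerivWithinAt (fun t => (z r t, z' r t))
      (dampedMatrix 0 μ r x (z r x, z' r x)) (Ici x) x := fun r x hx =>
    ((h r).hasDeriv_pair (hs.trans hx.1)).mono fun y hy => (hs.trans hx.1).trans hy
  have key : ∀ r, dist (z r t, z' r t) (z r₀ t, z' r₀ t)
      ≤ gronwallBound 0 K (|r ^ 2 - r₀ ^ 2| * M + 0) (t - s) := by
    intro r
    refine dist_le_of_approx_trajectories_ODE hL (hcont r) (hderiv r) (fun x hx => ?_) (hcont r₀)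
      (hderiv r₀) (fun x _ => by rw [dist_self]) ?_ t ⟨hst, le_rfl⟩
    · rw [dampedMatrix_apply, dampedMatrix_apply, Prod.dist_eq, dist_self]
      refine max_le (mul_nonneg (abs_nonneg _)
        ((abs_nonneg _).trans (hM r x (Ico_subset_Icc_self hx)))) ?_
      rw [Real.dist_eq]
      have : -(0 / (1 + |x|)) * z' r x - (r ^ 2 + μ / (1 + |x|) ^ 2) * z r x
          - (-(0 / (1 + |x|)) * z' r x - (r₀ ^ 2 + μ / (1 + |x|) ^ 2) * z r x)
          = -((r ^ 2 - r₀ ^ 2) * z r x) := by ring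
      rw [this, abs_neg, abs_mul]
      exact mul_le_mul_of_nonneg_left (hM r x (Ico_subset_Icc_self hx)) (abs_nonneg _)
    · simp [ha, hb]
  rw [ContinuousAt, tendsto_iff_dist_tendsto_zero]
  refine squeeze_zero (fun _ => dist_nonneg) key ?_
  have h1 : Continuous fun r : ℝ => gronwallBound 0 K (|r ^ 2 - r₀ ^ 2| * M + 0) (t - s) :=
    (gronwallBound_continuous_ε 0 K (t - s)).comp (by fun_prop)
  have h2 := h1.tendsto r₀
  simpa [gronwallBound_ε0_δ0] using h2

/-! ### The Liouville transform of the damped modes -/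

noncomputable def dampedModeDeriv (μ₁ μ₂ r s a b : ℝ) : ℝ → ℝ :=
  (exists_isDampedMode μ₁ μ₂ r s a b).choose_spec.choose

theorem isDampedMode_dampedMode (μ₁ μ₂ r s a b : ℝ) :
    IsDampedMode μ₁ μ₂ r s a b (dampedMode μ₁ μ₂ r s a b) (dampedModeDeriv μ₁ μ₂ r s a b) :=
  (exists_isDampedMode μ₁ μ₂ r s a b).choose_spec.choose_spec

noncomputable def liouvilleMode (μ₁ μ₂ r s a b t : ℝ) : ℝ :=
  (1 + t) ^ (μ₁ / 2) * dampedMode μ₁ μ₂ r s a b t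

noncomputable def liouvilleModeDeriv (μ₁ μ₂ r s a b t : ℝ) : ℝ :=
  (1 + t) ^ (μ₁ / 2) * (dampedModeDeriv μ₁ μ₂ r s a b t
    + μ₁ / 2 / (1 + t) * dampedMode μ₁ μ₂ r s a b t)

/-- The power `μ₁/2` is the one that removes the first-order term; what it leaves of the
coefficients is the mass `massParam μ₁ μ₂`. -/
theorem isMassMode_liouvilleMode (μ₁ μ₂ r s a b : ℝ) :
    IsMassMode (massParam μ₁ μ₂) r (liouvilleMode μ₁ μ₂ r s a b)
      (liouvilleModeDeriv μ₁ μ₂ r s a b) := by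
  have h := (isDampedMode_dampedMode μ₁ μ₂ r s a b).2.2
  constructor
  · intro t ht
    refine ((hasDerivAt_one_add_rpow ht).hasDerivWithinAt.mul (h t ht).1).congr_deriv ?_
    rw [liouvilleModeDeriv, Real.rpow_sub_one (by positivity)]
    field_simp
    ring
  · intro t ht
    have ht1 : 1 + t ≠ 0 := by positivity
    have hinv : HasDerivAt (fun t : ℝ => μ₁ / 2 / (1 + t)) (-(μ₁ / 2 / (1 + t) ^ 2)) t := by
      refine ((((hasDerivAt_id t).const_add 1).inv ht1).const_mul (μ₁ / 2)).congr_deriv ?_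
      simp
      ring
    refine ((hasDerivAt_one_add_rpow ht).hasDerivWithinAt.mul
      ((h t ht).2.add (hinv.hasDerivWithinAt.mul (h t ht).1))).congr_deriv ?_
    rw [liouvilleMode, massParam, Real.rpow_sub_one ht1]
    simp only [Pi.add_apply, Pi.mul_apply]
    field_simp
    ring

theorem liouvilleMode_self (μ₁ μ₂ r s a b : ℝ) :
    liouvilleMode μ₁ μ₂ r s a b s = (1 + s) ^ (μ₁ / 2) * a := by
  rw [liouvilleMode, (isDampedMode_dampedMode μ₁ μ₂ r s a b).1]

theorem liouvilleModeDeriv_self (μ₁ μ₂ r s a b : ℝ) :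
    liouvilleModeDeriv μ₁ μ₂ r s a b s
      = (1 + s) ^ (μ₁ / 2) * (b + μ₁ / 2 / (1 + s) * a) := by
  rw [liouvilleModeDeriv, (isDampedMode_dampedMode μ₁ μ₂ r s a b).1,
    (isDampedMode_dampedMode μ₁ μ₂ r s a b).2.1]

theorem continuous_liouvilleMode {μ₁ μ₂ : ℝ} (hμ : 0 ≤ massParam μ₁ μ₂) {s t : ℝ} (hs : 0 ≤ s)
    (hst : s ≤ t) (a b : ℝ) :
    Continuous (fun r => liouvilleMode μ₁ μ₂ r s a b t) ∧
      Continuous (fun r => liouvilleModeDeriv μ₁ μ₂ r s a b t) := by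
  have h := continuous_massMode hμ (fun r => isMassMode_liouvilleMode μ₁ μ₂ r s a b) hs
    (fun r => liouvilleMode_self μ₁ μ₂ r s a b) (fun r => liouvilleModeDeriv_self μ₁ μ₂ r s a b)
    hst
  exact ⟨continuous_fst.comp h, continuous_snd.comp h⟩

/-! ### Families of modes with uniformly bounded energy -/

/-- Modes `z · r`, depending continuously on the frequency `r`, whose energy at time `s` is at most
`E²`. -/
structure IsModeFamily (μ s E : ℝ) (z z' : ℝ → ℝ → ℝ) : Prop where
  nonneg_time : 0 ≤ s
  nonneg_energy : 0 ≤ E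
  mode : ∀ r, IsMassMode μ r (fun t => z t r) (fun t => z' t r)
  cont : ∀ t, s ≤ t → Continuous (z t) ∧ Continuous (z' t)
  energy : ∀ r, z' s r ^ 2 + (r ^ 2 + μ / (1 + s) ^ 2) * z s r ^ 2 ≤ E ^ 2
  -- The energy weighs `z²` with `r² + μ/(1+s)²`, which degenerates at `r = 0` when `μ = 0`, so the
  -- size of `z` at time `s` is required separately.
  data : ∀ r, |z s r| + (1 + s) * |z' s r| ≤ (1 + s) * E

namespace IsModeFamily

variable {μ s E : ℝ} {z z' : ℝ → ℝ → ℝ}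

theorem energy_le (h : IsModeFamily μ s E z z') (hμ : 0 ≤ μ) {t : ℝ} (hst : s ≤ t) (r : ℝ) :
    (r * z t r) ^ 2 + z' t r ^ 2 ≤ E ^ 2 := by
  have h1 := (h.mode r).energy_le hμ h.nonneg_time hst
  have h2 := h.energy r
  have h3 : 0 ≤ μ / (1 + t) ^ 2 * z t r ^ 2 := by positivity
  nlinarith

theorem abs_deriv_le (h : IsModeFamily μ s E z z') (hμ : 0 ≤ μ) {t : ℝ} (hst : s ≤ t) (r : ℝ) :
    |z' t r| ≤ E :=
  abs_le_of_sq_le_sq (by nlinarith [h.energy_le hμ hst r, sq_nonneg (r * z t r)]) h.nonneg_energy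

theorem abs_sub_le (h : IsModeFamily μ s E z z') (hμ : 0 ≤ μ) {t t' : ℝ} (hst : s ≤ t)
    (htt' : t ≤ t') (r : ℝ) : |z t' r - z t r| ≤ E * (t' - t) := by
  have ht := h.nonneg_time.trans hst
  have := abs_sub_le_of_hasDerivWithinAt ht htt' (f := fun t => z t r) (g := fun t => E * t)
    (fun x hx => (h.mode r).hasDeriv x (ht.trans hx.1))
    (fun x _ => (hasDerivWithinAt_id x _).const_mul E)
    (fun x hx => by rw [mul_one]; exact h.abs_deriv_le hμ (hst.trans hx.1) r)
  linarith

/-- Crude linear growth, enough to make `z t` a bounded symbol down to frequency zero. -/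
theorem abs_le (h : IsModeFamily μ s E z z') (hμ : 0 ≤ μ) {t : ℝ} (hst : s ≤ t) (r : ℝ) :
    |z t r| ≤ E * (1 + t) := by
  have h1 := h.abs_sub_le hμ le_rfl hst r
  have h2 := h.data r
  have h3 := abs_sub_abs_le_abs_sub (z t r) (z s r)
  have h4 : 0 ≤ (1 + s) * |z' s r| := by have := h.nonneg_time; positivity
  linarith

theorem profile_le (h : IsModeFamily μ s E z z') (hμ : 0 ≤ μ) {t : ℝ} (hst : s ≤ t) (r : ℝ) :
    |profileFst r t (z t r) (z' t r)| ≤ E ∧ |profileSnd r t (z t r) (z' t r)| ≤ E := by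
  have := Real.sqrt_le_sqrt (h.energy_le hμ hst r)
  rw [Real.sqrt_sq h.nonneg_energy] at this
  exact ⟨(abs_profileFst_le _ _ _ _).trans this, (abs_profileSnd_le _ _ _ _).trans this⟩

theorem data_rpow_le (h : IsModeFamily μ s E z z') (β : ℝ) (r : ℝ) :
    (1 + s) ^ (-β) * (|z s r| + (1 + s) * |z' s r|) ≤ (1 + s) ^ (1 - β) * E := by
  have hs : 0 < 1 + s := by linarith [h.nonneg_time]
  have e : (1 + s) ^ (1 - β) = (1 + s) ^ (-β) * (1 + s) := by
    rw [← Real.rpow_add_one hs.ne']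
    ring_nf
  rw [e, mul_assoc]
  exact mul_le_mul_of_nonneg_left (h.data r) (by positivity)

end IsModeFamily

theorem exists_family_bounds {μ : ℝ} (hμ : 0 ≤ μ) : ∃ C : ℝ, 0 ≤ C ∧
    ∀ (s E : ℝ) (z z' : ℝ → ℝ → ℝ), IsModeFamily μ s E z z' → ∀ t t' : ℝ, s ≤ t → t ≤ t' →
      ∀ r, |z t r| ≤ C * ((1 + t) ^ growthExp μ * logFactor μ t) * ((1 + s) ^ (1 - growthExp μ) * E)
      ∧ |profileFst r t' (z t' r) (z' t' r) - profileFst r t (z t r) (z' t r)|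
        ≤ μ * C * ((1 + t) ^ (growthExp μ - 1) * logFactor μ t)
          * ((1 + s) ^ (1 - growthExp μ) * E)
      ∧ |profileSnd r t' (z t' r) (z' t' r) - profileSnd r t (z t r) (z' t r)|
        ≤ μ * C * ((1 + t) ^ (growthExp μ - 1) * logFactor μ t)
          * ((1 + s) ^ (1 - growthExp μ) * E) := by
  obtain ⟨C₁, h10, h1⟩ := exists_massMode_growth hμ
  obtain ⟨C₂, h20, h2⟩ := exists_profile_variation hμ
  refine ⟨C₁ + C₂, by positivity, fun s E z z' hz t t' hst htt' r => ?_⟩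
  have hs := hz.nonneg_time
  have ht := hs.trans hst
  have hl := one_le_logFactor μ ht
  have hd := hz.data_rpow_le (growthExp μ) r
  obtain ⟨h3, h4⟩ := h2 r _ _ (hz.mode r) s t t' hs hst htt'
  refine ⟨(h1 r _ _ (hz.mode r) s t hs hst).trans ?_, h3.trans ?_, h4.trans ?_⟩ <;>
  · refine mul_le_mul ?_ hd (by positivity) (by positivity)
    gcongr
    linarith

/-- Data `(0, 1)` at time `s` become `(0, (1+s)^(μ₁/2))` under the Liouville transform; this is the
energy bound. -/
theorem isModeFamily_kernel {μ₁ μ₂ : ℝ} (hμ : 0 ≤ massParam μ₁ μ₂) {s : ℝ} (hs : 0 ≤ s) :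
    IsModeFamily (massParam μ₁ μ₂) s ((1 + s) ^ (μ₁ / 2))
      (fun t r => liouvilleMode μ₁ μ₂ r s 0 1 t) (fun t r => liouvilleModeDeriv μ₁ μ₂ r s 0 1 t) where
  nonneg_time := hs
  nonneg_energy := by positivity
  mode r := isMassMode_liouvilleMode μ₁ μ₂ r s 0 1
  cont t hst := continuous_liouvilleMode hμ hs hst 0 1
  energy r := by simp [liouvilleMode_self, liouvilleModeDeriv_self]
  data r := by
    simp only [liouvilleMode_self, liouvilleModeDeriv_self, mul_zero, abs_zero, add_zero, mul_one,
      zero_add]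
    rw [abs_of_nonneg (by positivity)]

/-- The weight of `H¹`. -/
noncomputable def bracket (r : ℝ) : ℝ := √(1 + r ^ 2)

theorem bracket_sq (r : ℝ) : bracket r ^ 2 = 1 + r ^ 2 := Real.sq_sqrt (by positivity)

theorem bracket_pos (r : ℝ) : 0 < bracket r := Real.sqrt_pos.2 (by positivity)

theorem one_le_bracket (r : ℝ) : 1 ≤ bracket r :=
  Real.one_le_sqrt.2 (by nlinarith [sq_nonneg r])

theorem continuous_bracket : Continuous bracket := by
  unfold bracket
  fun_prop

/-- Data `(1, 0)` have energy of order `r²`. Dividing by `bracket r` makes it bounded in the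
frequency and moves the weight onto `u₀`, where the `H¹` norm pays for it. The term `μ₁/2` comes
from differentiating `(1+t)^(μ₁/2)` at time 0. -/
theorem isModeFamily_initial {μ₁ μ₂ : ℝ} (hμ₁ : 0 ≤ μ₁) (hμ : 0 ≤ massParam μ₁ μ₂) :
    IsModeFamily (massParam μ₁ μ₂) 0 (1 + μ₁ / 2 + massParam μ₁ μ₂)
      (fun t r => (bracket r)⁻¹ * liouvilleMode μ₁ μ₂ r 0 1 0 t)
      (fun t r => (bracket r)⁻¹ * liouvilleModeDeriv μ₁ μ₂ r 0 1 0 t) where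
  nonneg_time := le_rfl
  nonneg_energy := by positivity
  mode r := (isMassMode_liouvilleMode μ₁ μ₂ r 0 1 0).smul _
  cont t ht := by
    have h1 : Continuous fun r => (bracket r)⁻¹ :=
      continuous_bracket.inv₀ fun r => (bracket_pos r).ne'
    have h2 := continuous_liouvilleMode hμ le_rfl ht 1 0
    exact ⟨h1.mul h2.1, h1.mul h2.2⟩
  energy r := by
    simp only [liouvilleMode_self, liouvilleModeDeriv_self]
    norm_num
    set m := massParam μ₁ μ₂
    have hb := bracket_pos r
    have h1 : ((bracket r)⁻¹ * (μ₁ / 2)) ^ 2 + (r ^ 2 + m) * (bracket r ^ 2)⁻¹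
        = ((μ₁ / 2) ^ 2 + r ^ 2 + m) / (1 + r ^ 2) := by
      rw [mul_pow, inv_pow, bracket_sq]
      field_simp
      ring
    rw [h1, div_le_iff₀ (by positivity)]
    have h2 : (μ₁ / 2) ^ 2 + r ^ 2 + m ≤ (1 + (μ₁ / 2) ^ 2 + m) * (1 + r ^ 2) := by
      have : 0 ≤ ((μ₁ / 2) ^ 2 + m) * r ^ 2 := by positivity
      nlinarith
    refine h2.trans (mul_le_mul_of_nonneg_right ?_ (by positivity))
    nlinarith [mul_nonneg hμ₁ hμ]
  data r := by
    simp only [liouvilleMode_self, liouvilleModeDeriv_self]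
    norm_num
    have hb : |bracket r|⁻¹ ≤ 1 := by
      rw [abs_of_pos (bracket_pos r)]
      exact inv_le_one_of_one_le₀ (one_le_bracket r)
    have h0 : 0 ≤ |bracket r|⁻¹ := by positivity
    rw [abs_of_nonneg (by positivity : 0 ≤ μ₁ / 2)]
    nlinarith

/-! ### Radial multiplication operators on `L²` -/

structure IsSymbol (κ : ℝ → ℝ) : Prop where
  cont : Continuous κ
  bdd : ∃ C, ∀ r, |κ r| ≤ C

/-- The function `ξ ↦ κ(2π|ξ|)`. -/
noncomputable def radial {d : ℕ} (κ : ℝ → ℝ) (ξ : Space d) : ℂ := ((κ (2 * Real.pi * ‖ξ‖) : ℝ) : ℂ)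

theorem continuous_radial {d : ℕ} {κ : ℝ → ℝ} (h : Continuous κ) :
    Continuous (radial κ : Space d → ℂ) := by
  unfold radial
  exact Complex.continuous_ofReal.comp (h.comp (continuous_const.mul continuous_norm))

theorem norm_radial {d : ℕ} (κ : ℝ → ℝ) (ξ : Space d) :
    ‖radial κ ξ‖ = |κ (2 * Real.pi * ‖ξ‖)| := by
  rw [radial, Complex.norm_real, Real.norm_eq_abs]

theorem norm_toLp_le {d : ℕ} {h : Space d → ℂ} (hh : MemLp h 2 volume) (f : LTwo d) {C : ℝ}
    (hC : ∀ᵐ ξ, ‖h ξ‖ ≤ C * ‖f ξ‖) : ‖hh.toLp h‖ ≤ C * ‖f‖ := by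
  refine Lp.norm_le_mul_norm_of_ae_le_mul ?_
  filter_upwards [hh.coeFn_toLp, hC] with ξ h1 h2
  rwa [h1]

namespace IsSymbol

variable {d : ℕ} {κ κ₁ κ₂ : ℝ → ℝ}

theorem memLp (h : IsSymbol κ) (f : LTwo d) : MemLp (fun ξ => radial κ ξ * f ξ) 2 volume := by
  obtain ⟨C, hC⟩ := h.bdd
  refine (Lp.memLp f).of_le_mul (c := C)
    ((continuous_radial h.cont).aestronglyMeasurable.mul (Lp.aestronglyMeasurable f))
    (Eventually.of_forall fun ξ => ?_)
  rw [norm_mul, norm_radial]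
  exact mul_le_mul_of_nonneg_right (hC _) (norm_nonneg _)

theorem of_le (h : Continuous κ) {C : ℝ} (hC : ∀ r, |κ r| ≤ C) : IsSymbol κ := ⟨h, C, hC⟩

theorem const (c : ℝ) : IsSymbol fun _ => c := ⟨continuous_const, |c|, fun _ => le_rfl⟩

theorem add (h₁ : IsSymbol κ₁) (h₂ : IsSymbol κ₂) : IsSymbol fun r => κ₁ r + κ₂ r := by
  obtain ⟨C₁, h1⟩ := h₁.bdd
  obtain ⟨C₂, h2⟩ := h₂.bdd
  exact ⟨h₁.cont.add h₂.cont, C₁ + C₂, fun r => (abs_add_le _ _).trans (add_le_add (h1 r) (h2 r))⟩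

theorem sub (h₁ : IsSymbol κ₁) (h₂ : IsSymbol κ₂) : IsSymbol fun r => κ₁ r - κ₂ r := by
  obtain ⟨C₁, h1⟩ := h₁.bdd
  obtain ⟨C₂, h2⟩ := h₂.bdd
  exact ⟨h₁.cont.sub h₂.cont, C₁ + C₂, fun r => (abs_sub _ _).trans (add_le_add (h1 r) (h2 r))⟩

theorem mul (h₁ : IsSymbol κ₁) (h₂ : IsSymbol κ₂) : IsSymbol fun r => κ₁ r * κ₂ r := by
  obtain ⟨C₁, h1⟩ := h₁.bdd
  obtain ⟨C₂, h2⟩ := h₂.bdd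
  refine ⟨h₁.cont.mul h₂.cont, C₁ * C₂, fun r => ?_⟩
  rw [abs_mul]
  exact mul_le_mul (h1 r) (h2 r) (abs_nonneg _) ((abs_nonneg _).trans (h1 r))

theorem cos (t : ℝ) : IsSymbol fun r => Real.cos (r * t) :=
  of_le (C := 1) (by fun_prop) fun _ => Real.abs_cos_le_one _

theorem sin (t : ℝ) : IsSymbol fun r => Real.sin (r * t) :=
  of_le (C := 1) (by fun_prop) fun _ => Real.abs_sin_le_one _

end IsSymbol

/-- Multiplication by `κ(2π|ξ|)` on `L²`. -/
noncomputable def symbolOp {d : ℕ} (κ : ℝ → ℝ) : LTwo d →L[ℂ] LTwo d :=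
  open Classical in
  if h : IsSymbol κ then
    LinearMap.mkContinuousOfExistsBound
      { toFun := fun f => (h.memLp f).toLp _
        map_add' := fun f g => by
          rw [← MemLp.toLp_add (h.memLp f) (h.memLp g)]
          refine MemLp.toLp_congr _ _ ?_
          filter_upwards [Lp.coeFn_add f g] with ξ h1
          change _ = radial κ ξ * f ξ + radial κ ξ * g ξ
          rw [h1, Pi.add_apply, mul_add]
        map_smul' := fun c f => by
          rw [RingHom.id_apply, ← MemLp.toLp_const_smul c (h.memLp f)]
          refine MemLp.toLp_congr _ _ ?_
          filter_upwards [Lp.coeFn_smul c f] with ξ h1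
          simp [h1]
          ring }
      (by
        obtain ⟨C, hC⟩ := h.bdd
        refine ⟨C, fun f => norm_toLp_le (h.memLp f) f (Eventually.of_forall fun ξ => ?_)⟩
        rw [norm_mul, norm_radial]
        exact mul_le_mul_of_nonneg_right (hC _) (norm_nonneg _))
  else 0

section symbolOp

variable {d : ℕ} {κ κ₁ κ₂ : ℝ → ℝ}

theorem symbolOp_eq_toLp (h : IsSymbol κ) (f : LTwo d) : symbolOp κ f = (h.memLp f).toLp _ := by
  rw [symbolOp, dif_pos h]
  rfl

theorem coeFn_symbolOp (h : IsSymbol κ) (f : LTwo d) :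
    symbolOp κ f =ᵐ[volume] fun ξ => radial κ ξ * f ξ := by
  rw [symbolOp_eq_toLp h]
  exact MemLp.coeFn_toLp _

theorem norm_symbolOp_le (h : IsSymbol κ) {C : ℝ} (hC : ∀ r, |κ r| ≤ C) (f : LTwo d) :
    ‖symbolOp κ f‖ ≤ C * ‖f‖ := by
  rw [symbolOp_eq_toLp h]
  refine norm_toLp_le _ f (Eventually.of_forall fun ξ => ?_)
  rw [norm_mul, norm_radial]
  exact mul_le_mul_of_nonneg_right (hC _) (norm_nonneg _)

theorem symbolOp_add (h₁ : IsSymbol κ₁) (h₂ : IsSymbol κ₂) (f : LTwo d) :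
    symbolOp (fun r => κ₁ r + κ₂ r) f = symbolOp κ₁ f + symbolOp κ₂ f := by
  apply Lp.ext
  filter_upwards [coeFn_symbolOp (h₁.add h₂) f, coeFn_symbolOp h₁ f, coeFn_symbolOp h₂ f,
    Lp.coeFn_add (symbolOp κ₁ f) (symbolOp κ₂ f)] with ξ a b c e
  rw [a, e, Pi.add_apply, b, c]
  simp [radial]
  ring

theorem symbolOp_sub (h₁ : IsSymbol κ₁) (h₂ : IsSymbol κ₂) (f : LTwo d) :
    symbolOp (fun r => κ₁ r - κ₂ r) f = symbolOp κ₁ f - symbolOp κ₂ f := by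
  apply Lp.ext
  filter_upwards [coeFn_symbolOp (h₁.sub h₂) f, coeFn_symbolOp h₁ f, coeFn_symbolOp h₂ f,
    Lp.coeFn_sub (symbolOp κ₁ f) (symbolOp κ₂ f)] with ξ a b c e
  rw [a, e, Pi.sub_apply, b, c]
  simp [radial]
  ring

theorem symbolOp_mul (h₁ : IsSymbol κ₁) (h₂ : IsSymbol κ₂) (f : LTwo d) :
    symbolOp (fun r => κ₁ r * κ₂ r) f = symbolOp κ₁ (symbolOp κ₂ f) := by
  apply Lp.ext
  filter_upwards [coeFn_symbolOp (h₁.mul h₂) f, coeFn_symbolOp h₂ f,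
    coeFn_symbolOp h₁ (symbolOp κ₂ f)] with ξ a b c
  rw [a, c, b]
  simp [radial]
  ring

theorem symbolOp_const (c : ℝ) (f : LTwo d) : symbolOp (fun _ => c) f = c • f := by
  apply Lp.ext
  filter_upwards [coeFn_symbolOp (IsSymbol.const c) f, Lp.coeFn_smul c f] with ξ a b
  rw [a, b]
  simp [radial]

theorem ofFourier_eq {h : Space d → ℂ} {f : LTwo d} (hf : f =ᵐ[volume] h) :
    ofFourier h = 𝓕⁻ f := by
  have hm : MemLp h 2 volume := (memLp_congr_ae hf).1 (Lp.memLp f)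
  have : hm.toLp h = f := by
    apply Lp.ext
    filter_upwards [hm.coeFn_toLp, hf] with ξ a b
    rw [a, b]
  rw [ofFourier, dif_pos hm, this]

theorem multiplier_eq (h : IsSymbol κ) (f : LTwo d) :
    multiplier (fun ξ => ((κ (2 * Real.pi * ‖ξ‖) : ℝ) : ℂ)) f = 𝓕⁻ (symbolOp κ (𝓕 f)) :=
  ofFourier_eq (coeFn_symbolOp h _)

/-- Dominated convergence for multiplication operators. -/
theorem tendsto_symbolOp {ι : Type*} {l : Filter ι} [l.IsCountablyGenerated] {κ : ι → ℝ → ℝ}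
    {κ₀ : ℝ → ℝ} (h : ∀ᶠ i in l, IsSymbol (κ i)) (h₀ : IsSymbol κ₀) {C : ℝ}
    (hC : ∀ᶠ i in l, ∀ r, |κ i r - κ₀ r| ≤ C) (hlim : ∀ r, Tendsto (fun i => κ i r) l (𝓝 (κ₀ r)))
    (f : LTwo d) : Tendsto (fun i => symbolOp (κ i) f) l (𝓝 (symbolOp κ₀ f)) := by
  rw [Lp.tendsto_Lp_iff_tendsto_eLpNorm']
  have key : Tendsto (fun i => ∫⁻ ξ, ‖(radial (κ i) ξ - radial κ₀ ξ) * f ξ‖ₑ ^ (2:ℝ)) l (𝓝 0) := by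
    have h0 : (0 : ℝ≥0∞) = ∫⁻ _ : Space d, 0 := by simp
    rw [h0]
    refine tendsto_lintegral_filter_of_dominated_convergence'
      (fun ξ => ENNReal.ofReal C ^ (2:ℝ) * ‖f ξ‖ₑ ^ (2:ℝ)) ?_ ?_ ?_ ?_
    · filter_upwards [h] with i hi
      exact ((((continuous_radial hi.cont).sub
        (continuous_radial h₀.cont)).aestronglyMeasurable.mul
          (Lp.aestronglyMeasurable f)).enorm).pow_const _
    · filter_upwards [hC] with i hi
      refine Eventually.of_forall fun ξ => ?_
      rw [enorm_mul, ENNReal.mul_rpow_of_nonneg _ _ (by norm_num)]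
      gcongr
      rw [← ofReal_norm]
      refine ENNReal.ofReal_le_ofReal ?_
      have : radial (κ i) ξ - radial κ₀ ξ = radial (fun r => κ i r - κ₀ r) ξ := by simp [radial]
      rw [this, norm_radial]
      exact hi _
    · rw [lintegral_const_mul' _ _ (by simp)]
      refine ENNReal.mul_ne_top (by simp) ?_
      have := (Lp.memLp f).2
      rw [eLpNorm_eq_lintegral_rpow_enorm_toReal (by norm_num) (by norm_num)] at this
      exact (lintegral_rpow_enorm_lt_top_of_eLpNorm_lt_top (by norm_num) (by norm_num)
        (Lp.memLp f).2).ne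
    · refine Eventually.of_forall fun ξ => ?_
      have h1 : Tendsto (fun i => (radial (κ i) ξ - radial κ₀ ξ) * f ξ) l (𝓝 0) := by
        have h2 : Tendsto (fun i => radial (κ i) ξ) l (𝓝 (radial κ₀ ξ)) :=
          (Complex.continuous_ofReal.tendsto _).comp (hlim _)
        have h3 := (h2.sub_const (radial κ₀ ξ)).mul_const (f ξ)
        simpa using h3
      have h4 := (ENNReal.continuous_rpow_const (y := (2:ℝ))).tendsto _ |>.comp
        ((continuous_enorm.tendsto _).comp h1)
      simpa [Function.comp_def] using h4
  have key2 := (ENNReal.continuous_rpow_const (y := (1 / 2 : ℝ))).tendsto _ |>.comp key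
  rw [ENNReal.zero_rpow_of_pos (by norm_num)] at key2
  refine key2.congr' ?_
  filter_upwards [h] with i hi
  have e : eLpNorm (⇑(symbolOp (κ i) f) - ⇑(symbolOp κ₀ f)) 2 volume
      = eLpNorm (fun ξ => (radial (κ i) ξ - radial κ₀ ξ) * f ξ) 2 volume := by
    refine eLpNorm_congr_ae ?_
    filter_upwards [coeFn_symbolOp hi f, coeFn_symbolOp h₀ f] with ξ a b
    rw [Pi.sub_apply, a, b]
    ring
  rw [e, eLpNorm_eq_lintegral_rpow_enorm_toReal (by norm_num) (by norm_num)]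
  norm_num [Function.comp_def]

/-- The difference quotients of the symbol are bounded uniformly in `r` and converge pointwise, so
dominated convergence applies to each fixed `f`; the derivative is taken strongly, not in operator
norm. -/
theorem hasDerivAt_symbolOp {κ : ℝ → ℝ → ℝ} {κ' : ℝ → ℝ} {t : ℝ}
    (h : ∀ᶠ x in 𝓝 t, IsSymbol (κ x)) (h' : IsSymbol κ') {C : ℝ}
    (hC : ∀ᶠ x in 𝓝 t, ∀ r, |κ x r - κ t r| ≤ C * |x - t|)
    (hd : ∀ r, HasDerivAt (fun x => κ x r) (κ' r) t) (f : LTwo d) :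
    HasDerivAt (fun x => symbolOp (κ x) f) (symbolOp κ' f) t := by
  rw [hasDerivAt_iff_tendsto_slope]
  obtain ⟨C', hC'⟩ := h'.bdd
  have ht := h.self_of_nhds
  have hs : ∀ x, IsSymbol (κ x) → IsSymbol (fun r => (x - t)⁻¹ * (κ x r - κ t r)) := fun x hx =>
    (IsSymbol.const _).mul (hx.sub ht)
  have hle : 𝓝[≠] t ≤ 𝓝 t := nhdsWithin_le_nhds
  have key := tendsto_symbolOp (l := 𝓝[≠] t) (κ := fun x r => (x - t)⁻¹ * (κ x r - κ t r))
    (C := C + C') ((h.filter_mono hle).mono hs) h' ?_ (fun r => ?_) f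
  · refine key.congr' ?_
    filter_upwards [h.filter_mono hle] with x hx
    rw [symbolOp_mul (IsSymbol.const _) (hx.sub ht), symbolOp_const, symbolOp_sub hx ht]
    rfl
  · filter_upwards [hC.filter_mono hle, self_mem_nhdsWithin] with x hx hne r
    have hne' : 0 < |x - t| := abs_pos.2 (sub_ne_zero.2 hne)
    refine (abs_sub _ _).trans (add_le_add ?_ (hC' r))
    rw [abs_mul, abs_inv, inv_mul_le_iff₀ hne', mul_comm]
    exact hx r
  · have := hasDerivAt_iff_tendsto_slope.1 (hd r)
    exact this

end symbolOp

/-! ### The space-time norm of the solution -/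

/-- Fatou's lemma along an almost everywhere convergent subsequence. It supplies the measurability
in time of the `L^{2p₁}` norm of a curve that is merely continuous in `L²`. -/
theorem lowerSemicontinuous_eLpNorm {d : ℕ} (q : ℝ≥0∞) :
    LowerSemicontinuous fun f : LTwo d => eLpNorm f q volume := by
  refine lowerSemicontinuous_iff_isClosed_preimage.2 fun c => ?_
  refine IsSeqClosed.isClosed fun f f₀ hf hlim => ?_
  obtain ⟨ns, -, hns⟩ := (tendstoInMeasure_of_tendsto_Lp hlim).exists_seq_tendsto_ae
  exact Lp.eLpNorm_le_of_ae_tendsto (u := atTop) (Eventually.of_forall fun n => hf (ns n))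
    (fun n => Lp.aestronglyMeasurable _) hns

theorem norm_le_hOneNorm {d : ℕ} (f : LTwo d) : ‖f‖ₑ ≤ hOneNorm f := by
  have h1 : ‖f‖ₑ = ‖(𝓕 f : LTwo d)‖ₑ := by
    rw [← ofReal_norm, ← ofReal_norm, Lp.norm_fourier_eq]
  rw [h1, Lp.enorm_def]
  refine eLpNorm_mono fun ξ => ?_
  rw [norm_mul]
  refine le_mul_of_one_le_left (norm_nonneg _) ?_
  rw [Complex.norm_real, Real.norm_eq_abs]
  exact (one_le_bracket _).trans (le_abs_self _)

theorem IsGlobalSolution.continuousOn {d : ℕ} {μ₁ μ₂ lam : ℝ} {u₀ u₁ : LTwo d} {u : ℝ → LTwo d}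
    (h : IsGlobalSolution μ₁ μ₂ lam u₀ u₁ u) : ContinuousOn u (Ici 0) := by
  intro t ht
  rw [ContinuousWithinAt, tendsto_iff_edist_tendsto_0]
  refine tendsto_of_tendsto_of_tendsto_of_le_of_le tendsto_const_nhds (h.continuous_hOne t ht)
    (fun _ => zero_le) fun s => ?_
  rw [edist_eq_enorm_sub]
  exact norm_le_hOneNorm _

/-- The density of the space-time norm of `(1 + t)^{μ₁/2} u`. -/
noncomputable def forcing {d : ℕ} (μ₁ : ℝ) (u : ℝ → LTwo d) (s : ℝ) : ℝ≥0∞ :=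
  eLpNorm (liouville μ₁ u s) (ENNReal.ofReal (2 * critExp d)) volume ^ critExp d

theorem one_lt_critExp {d : ℕ} (hd : 3 ≤ d) : 1 < critExp d := by
  have : (3 : ℝ) ≤ d := by exact_mod_cast hd
  have : 0 < 4 / ((d : ℝ) - 2) := by
    apply div_pos <;> linarith
  unfold critExp
  linarith

/-- Pointwise the nonlinearity has modulus `|f|^{p₁}`. This makes `L^{p₁}L^{2p₁}` the right space:
it puts the source in `L¹L²`. -/
theorem eLpNorm_nonlinearity {d : ℕ} (hd : 3 ≤ d) {lam : ℝ} (hlam : lam = 1 ∨ lam = -1)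
    (f : LTwo d) :
    eLpNorm (fun x => ((lam * ‖f x‖ ^ (4 / ((d : ℝ) - 2)) : ℝ) : ℂ) * f x) 2 volume
      = eLpNorm f (ENNReal.ofReal (2 * critExp d)) volume ^ critExp d := by
  have hp := one_lt_critExp hd
  have e1 : ENNReal.ofReal (2 * critExp d) = 2 * ENNReal.ofReal (critExp d) := by
    rw [ENNReal.ofReal_mul (by norm_num)]
    norm_num
  rw [e1, ← eLpNorm_norm_rpow _ (by linarith : 0 < critExp d)]
  refine eLpNorm_congr_norm_ae (Eventually.of_forall fun x => ?_)
  have hl : |lam| = 1 := by rcases hlam with rfl | rfl <;> simp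
  have hd' : (3 : ℝ) ≤ d := by exact_mod_cast hd
  have h4 : 0 < 4 / ((d : ℝ) - 2) := by apply div_pos <;> linarith
  rw [norm_mul, Complex.norm_real, norm_mul, Real.norm_eq_abs, hl, one_mul,
    Real.norm_of_nonneg (by positivity), Real.norm_of_nonneg (by positivity), critExp,
    add_comm, Real.rpow_add_one' (norm_nonneg _) (by positivity)]

/-- If the power is not in `L²`, the default value 0 of `nonlinearity` makes the bound trivial. -/
theorem norm_nonlinearity_le_toReal {d : ℕ} (hd : 3 ≤ d) {lam : ℝ} (hlam : lam = 1 ∨ lam = -1)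
    (f : LTwo d) : ‖nonlinearity lam f‖
      ≤ (eLpNorm f (ENNReal.ofReal (2 * critExp d)) volume ^ critExp d).toReal := by
  unfold nonlinearity
  split_ifs with h
  · rw [Lp.norm_toLp, eLpNorm_nonlinearity hd hlam]
  · rw [norm_zero]
    exact ENNReal.toReal_nonneg

section spaceTime

variable {d : ℕ} {μ₁ μ₂ lam : ℝ} {u₀ u₁ : LTwo d} {u : ℝ → LTwo d}

/-- Freezing `u` at its initial value for negative times gives a curve continuous on all of `ℝ`, to
which lower semicontinuity of the norm applies. -/
theorem aemeasurable_forcing (h : IsGlobalSolution μ₁ μ₂ lam u₀ u₁ u) :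
    AEMeasurable (forcing μ₁ u) (volume.restrict (Ici 0)) := by
  have h1 : Continuous fun s => liouville μ₁ u (max s 0) := by
    unfold liouville
    have h2 : Continuous fun s : ℝ => (1 + max s 0) ^ (μ₁ / 2) :=
      (continuous_const.add (continuous_id.max continuous_const)).rpow_const fun s =>
        Or.inl (ne_of_gt (by
          have := le_max_right s 0
          change (0 : ℝ) < 1 + max s 0
          linarith))
    refine h2.smul ?_
    · exact h.continuousOn.comp_continuous (continuous_id.max continuous_const)
        fun s => le_max_right s 0
  have h2 : Measurable fun s => forcing μ₁ u (max s 0) :=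
    ((lowerSemicontinuous_eLpNorm (ENNReal.ofReal (2 * critExp d))).comp h1).measurable.pow_const _
  refine ⟨_, h2, ?_⟩
  refine (ae_restrict_mem measurableSet_Ici).mono fun s hs => ?_
  simp only [max_eq_left (mem_Ici.1 hs)]

theorem tailNorm_rpow (hd : 3 ≤ d) (t : ℝ) :
    tailNorm μ₁ u t ^ critExp d = ∫⁻ s in Ici t, forcing μ₁ u s := by
  have hp := one_lt_critExp hd
  unfold tailNorm spaceTimeNorm
  rw [← ENNReal.rpow_mul, one_div_mul_cancel (by linarith), ENNReal.rpow_one]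
  rfl

theorem tailNorm_anti (hd : 3 ≤ d) {t t' : ℝ} (h : t ≤ t') :
    tailNorm μ₁ u t' ≤ tailNorm μ₁ u t := by
  have hp := one_lt_critExp hd
  unfold tailNorm spaceTimeNorm
  gcongr

/-- Continuity from above of the finite measure with density `forcing μ₁ u`, along half-lines that
shrink to the empty set. -/
theorem tendsto_tailNorm (hd : 3 ≤ d) (hu : tailNorm μ₁ u 0 < ∞) :
    Tendsto (tailNorm μ₁ u) atTop (𝓝 0) := by
  have hp := one_lt_critExp hd
  have h1 : Tendsto (fun t => ∫⁻ s in Ici t, forcing μ₁ u s) atTop (𝓝 0) := by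
    have h2 := tendsto_measure_iInter_atTop (μ := volume.withDensity (forcing μ₁ u))
      (s := fun t : ℝ => Ici t) (fun t => measurableSet_Ici.nullMeasurableSet)
      (fun a b hab => Ici_subset_Ici.2 hab) ⟨0, by
        rw [withDensity_apply _ measurableSet_Ici, ← tailNorm_rpow hd]
        exact ENNReal.rpow_ne_top_of_nonneg (by linarith) hu.ne⟩
    have h3 : ⋂ t : ℝ, Ici t = ∅ := by
      ext x
      simp only [mem_iInter, mem_Ici, mem_empty_iff_false, iff_false, not_forall, not_le]
      exact ⟨x + 1, by linarith⟩
    rw [h3, measure_empty] at h2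
    refine h2.congr fun t => ?_
    exact withDensity_apply _ measurableSet_Ici
  have h4 := (ENNReal.continuous_rpow_const (y := 1 / critExp d)).tendsto _ |>.comp h1
  rw [ENNReal.zero_rpow_of_pos (by positivity)] at h4
  exact h4

theorem integrableOn_forcing (hd : 3 ≤ d) (h : IsGlobalSolution μ₁ μ₂ lam u₀ u₁ u)
    (hu : tailNorm μ₁ u 0 < ∞) : IntegrableOn (fun s => (forcing μ₁ u s).toReal) (Ici 0) := by
  have hp := one_lt_critExp hd
  refine integrable_toReal_of_lintegral_ne_top (aemeasurable_forcing h) ?_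
  rw [← tailNorm_rpow hd]
  exact ENNReal.rpow_ne_top_of_nonneg (by linarith) hu.ne

theorem integral_forcing (hd : 3 ≤ d) (h : IsGlobalSolution μ₁ μ₂ lam u₀ u₁ u)
    (hu : tailNorm μ₁ u 0 < ∞) {t : ℝ} (ht : 0 ≤ t) :
    ∫ s in Ici t, (forcing μ₁ u s).toReal = (tailNorm μ₁ u t).toReal ^ critExp d := by
  have hp := one_lt_critExp hd
  have hm : AEMeasurable (forcing μ₁ u) (volume.restrict (Ici t)) :=
    (aemeasurable_forcing h).mono_measure (Measure.restrict_mono (Ici_subset_Ici.2 ht) le_rfl)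
  rw [integral_toReal hm, ← tailNorm_rpow hd, ENNReal.toReal_rpow]
  refine ae_lt_top' hm ?_
  rw [← tailNorm_rpow hd]
  exact ENNReal.rpow_ne_top_of_nonneg (by linarith)
    ((tailNorm_anti hd ht).trans_lt hu).ne

/-- The nonlinearity is homogeneous of degree `p₁`, so passing from `u` to `(1+s)^(μ₁/2) u` leaves
the power `(μ₁/2)(1 - p₁) = -2μ₁/(d-2)`. -/
theorem norm_nonlinearity_le (hd : 3 ≤ d) (hlam : lam = 1 ∨ lam = -1) {s : ℝ} (hs : 0 ≤ s) :
    (1 + s) ^ (μ₁ / 2) * ‖nonlinearity lam (u s)‖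
      ≤ (1 + s) ^ (-(2 * μ₁ / ((d : ℝ) - 2))) * (forcing μ₁ u s).toReal := by
  have hp := one_lt_critExp hd
  have hd' : (3 : ℝ) ≤ d := by exact_mod_cast hd
  have hσ : (0:ℝ) < (1 + s) ^ (μ₁ / 2) := by positivity
  have e1 : eLpNorm (liouville μ₁ u s) (ENNReal.ofReal (2 * critExp d)) volume
      = ENNReal.ofReal ((1 + s) ^ (μ₁ / 2))
        * eLpNorm (u s) (ENNReal.ofReal (2 * critExp d)) volume := by
    unfold liouville
    rw [eLpNorm_congr_ae (Lp.coeFn_smul _ _), eLpNorm_const_smul, ← ofReal_norm,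
      Real.norm_of_nonneg hσ.le]
  have e2 : (forcing μ₁ u s).toReal = ((1 + s) ^ (μ₁ / 2)) ^ critExp d
      * (eLpNorm (u s) (ENNReal.ofReal (2 * critExp d)) volume ^ critExp d).toReal := by
    rw [forcing, e1, ENNReal.mul_rpow_of_nonneg _ _ (by linarith), ENNReal.toReal_mul,
      ENNReal.ofReal_rpow_of_pos hσ, ENNReal.toReal_ofReal (by positivity)]
  have e3 : (1 + s) ^ (-(2 * μ₁ / ((d : ℝ) - 2))) * ((1 + s) ^ (μ₁ / 2)) ^ critExp d
      = (1 + s) ^ (μ₁ / 2) := by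
    rw [← Real.rpow_mul (by positivity), ← Real.rpow_add (by positivity)]
    congr 1
    unfold critExp
    field_simp
    ring
  rw [e2, ← mul_assoc, e3]
  refine mul_le_mul_of_nonneg_left ?_ hσ.le
  exact norm_nonlinearity_le_toReal hd hlam _

end spaceTime

/-! ### Duhamel's formula on the Fourier side -/

namespace IsModeFamily

variable {μ s E : ℝ} {z z' : ℝ → ℝ → ℝ}

theorem isSymbol (h : IsModeFamily μ s E z z') (hμ : 0 ≤ μ) {t : ℝ} (hst : s ≤ t) :
    IsSymbol (z t) := .of_le (h.cont t hst).1 (h.abs_le hμ hst)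

theorem isSymbol_deriv (h : IsModeFamily μ s E z z') (hμ : 0 ≤ μ) {t : ℝ} (hst : s ≤ t) :
    IsSymbol (z' t) := .of_le (h.cont t hst).2 (h.abs_deriv_le hμ hst)

theorem abs_sub_le_abs (h : IsModeFamily μ s E z z') (hμ : 0 ≤ μ) {x y : ℝ} (hx : s ≤ x)
    (hy : s ≤ y) (r : ℝ) : |z x r - z y r| ≤ E * |x - y| := by
  rcases le_total x y with hxy | hxy
  · rw [abs_sub_comm, abs_sub_comm x, abs_of_nonneg (by linarith : 0 ≤ y - x)]
    exact h.abs_sub_le hμ hx hxy r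
  · rw [abs_of_nonneg (by linarith : 0 ≤ x - y)]
    exact h.abs_sub_le hμ hy hxy r

theorem hasDerivAt (h : IsModeFamily μ s E z z') {t : ℝ} (hst : s < t) (r : ℝ) :
    HasDerivAt (fun x => z x r) (z' t r) t :=
  ((h.mode r).hasDeriv t (h.nonneg_time.trans hst.le)).hasDerivAt
    (Ici_mem_nhds (h.nonneg_time.trans_lt hst))

theorem hasDerivAt_symbolOp (h : IsModeFamily μ s E z z') (hμ : 0 ≤ μ) {d : ℕ} {t : ℝ}
    (hst : s < t) (f : LTwo d) :
    HasDerivAt (fun x => symbolOp (z x) f) (symbolOp (z' t) f) t := by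
  refine _root_.hasDerivAt_symbolOp (C := E) ?_ (h.isSymbol_deriv hμ hst.le) ?_
    (h.hasDerivAt hst) f
  · filter_upwards [Ici_mem_nhds hst] with x hx
    exact h.isSymbol hμ hx
  · filter_upwards [Ici_mem_nhds hst] with x hx r
    exact h.abs_sub_le_abs hμ hx hst.le r

end IsModeFamily

/-- The terms of Duhamel's formula on the Fourier side: data `g₀`, `g₁` and source `N`, propagated by
families of modes `Y`, `Z 0` and `Z s`; the source is dominated by the integrable function `m`. -/
structure IsDuhamel {d : ℕ} (μ E₀ : ℝ) (e m : ℝ → ℝ) (Y Y' : ℝ → ℝ → ℝ) (Z Z' : ℝ → ℝ → ℝ → ℝ)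
    (N : ℝ → LTwo d) : Prop where
  nonneg_mass : 0 ≤ μ
  initial : IsModeFamily μ 0 E₀ Y Y'
  kernel : ∀ s, 0 ≤ s → IsModeFamily μ s (e s) (Z s) (Z' s)
  kernel_self : ∀ s, 0 ≤ s → ∀ r, Z s s r = 0
  source_le : ∀ s, 0 ≤ s → e s * ‖N s‖ ≤ m s
  integrable_source : IntegrableOn m (Ici 0)
  measurable : ∀ t, 0 ≤ t →
    AEStronglyMeasurable (fun s => symbolOp (Z s t) (N s)) (volume.restrict (Ioc 0 t))

/-- Other symbols may stand in for `Y` and `Z`: those of the time derivative, of a profile, or of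
the difference of two profiles. -/
noncomputable def duhamelSol {d : ℕ} (Y : ℝ → ℝ → ℝ) (Z : ℝ → ℝ → ℝ → ℝ) (g₀ g₁ : LTwo d)
    (N : ℝ → LTwo d) (t : ℝ) : LTwo d :=
  symbolOp (Y t) g₀ + symbolOp (Z 0 t) g₁ + ∫ s in Ioc 0 t, symbolOp (Z s t) (N s)

namespace IsDuhamel

variable {d : ℕ} {μ E₀ : ℝ} {e m : ℝ → ℝ} {Y Y' : ℝ → ℝ → ℝ} {Z Z' : ℝ → ℝ → ℝ → ℝ}
  {N : ℝ → LTwo d}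

theorem norm_symbolOp_source_le (h : IsDuhamel μ E₀ e m Y Y' Z Z' N) {s c : ℝ} (hs : 0 ≤ s)
    (hc : 0 ≤ c) {κ : ℝ → ℝ} (hκ : IsSymbol κ) (hb : ∀ r, |κ r| ≤ c * e s) :
    ‖symbolOp κ (N s)‖ ≤ c * m s :=
  calc ‖symbolOp κ (N s)‖ ≤ c * e s * ‖N s‖ := norm_symbolOp_le hκ hb _
    _ = c * (e s * ‖N s‖) := by ring
    _ ≤ c * m s := mul_le_mul_of_nonneg_left (h.source_le s hs) hc

theorem integrableOn_source (h : IsDuhamel μ E₀ e m Y Y' Z Z' N) {S : Set ℝ} (hS : S ⊆ Ici 0) :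
    IntegrableOn m S := h.integrable_source.mono_set hS

theorem integrableOn_symbolOp (h : IsDuhamel μ E₀ e m Y Y' Z Z' N) {t c : ℝ} (hc : 0 ≤ c)
    {κ : ℝ → ℝ → ℝ}
    (hκ : ∀ s ∈ Ioc 0 t, IsSymbol (κ s)) (hb : ∀ s ∈ Ioc 0 t, ∀ r, |κ s r| ≤ c * e s)
    (hm : AEStronglyMeasurable (fun s => symbolOp (κ s) (N s)) (volume.restrict (Ioc 0 t))) :
    IntegrableOn (fun s => symbolOp (κ s) (N s)) (Ioc 0 t) := by
  refine Integrable.mono' ((h.integrableOn_source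
    (fun s hs => hs.1.le : Ioc 0 t ⊆ Ici 0)).const_mul c) hm ?_
  refine (ae_restrict_mem measurableSet_Ioc).mono fun s hs => ?_
  exact h.norm_symbolOp_source_le hs.1.le hc (hκ s hs) (hb s hs)

theorem integrableOn_kernel (h : IsDuhamel μ E₀ e m Y Y' Z Z' N) {t : ℝ} (ht : 0 ≤ t) :
    IntegrableOn (fun s => symbolOp (Z s t) (N s)) (Ioc 0 t) := by
  refine h.integrableOn_symbolOp (c := 1 + t) (by positivity)
    (fun s hs => (h.kernel s hs.1.le).isSymbol h.nonneg_mass hs.2) (fun s hs r => ?_)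
    (h.measurable t ht)
  rw [mul_comm]
  exact (h.kernel s hs.1.le).abs_le h.nonneg_mass hs.2 r

/-- The truncated kernel `Z s (max x s)`, which vanishes for `x ≤ s`. -/
theorem aestronglyMeasurable_truncated (h : IsDuhamel μ E₀ e m Y Y' Z Z' N) {x T : ℝ} (hx : 0 ≤ x) :
    AEStronglyMeasurable (fun s => symbolOp (Z s (max x s)) (N s))
      (volume.restrict (Ioc 0 T)) := by
  have h1 : AEStronglyMeasurable ((Ioc 0 x).indicator fun s => symbolOp (Z s x) (N s))
      (volume.restrict (Ioc 0 T)) :=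
    ((aestronglyMeasurable_indicator_iff measurableSet_Ioc).2 (h.measurable x hx)).restrict
  refine h1.congr ((ae_restrict_mem measurableSet_Ioc).mono fun s hs => ?_)
  change _ = symbolOp (Z s (max x s)) (N s)
  by_cases hsx : s ≤ x
  · rw [indicator_of_mem (show s ∈ Ioc 0 x from ⟨hs.1, hsx⟩), max_eq_left hsx]
  · rw [indicator_of_notMem fun h' => hsx h'.2, max_eq_right (not_le.1 hsx).le]
    have : Z s s = fun _ => 0 := funext (h.kernel_self s hs.1.le)
    rw [this, symbolOp_const, zero_smul]

theorem integral_truncated (h : IsDuhamel μ E₀ e m Y Y' Z Z' N) {x T : ℝ}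
    (hxT : x ≤ T) : ∫ s in Ioc 0 T, symbolOp (Z s (max x s)) (N s)
      = ∫ s in Ioc 0 x, symbolOp (Z s x) (N s) := by
  rw [← integral_indicator measurableSet_Ioc, ← integral_indicator measurableSet_Ioc]
  refine integral_congr_ae (Eventually.of_forall fun s => ?_)
  by_cases hsx : s ∈ Ioc 0 x
  · rw [indicator_of_mem hsx, indicator_of_mem (show s ∈ Ioc 0 T from ⟨hsx.1, hsx.2.trans hxT⟩),
      max_eq_left hsx.2]
  · rw [indicator_of_notMem hsx]
    by_cases hsT : s ∈ Ioc 0 T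
    · have hxs : x ≤ s := by
        by_contra! hc
        exact hsx ⟨hsT.1, hc.le⟩
      have : Z s s = fun _ => 0 := funext (h.kernel_self s hsT.1.le)
      rw [indicator_of_mem hsT, max_eq_right hxs, this, symbolOp_const, zero_smul]
    · rw [indicator_of_notMem hsT]

theorem hasDerivAt_truncated (h : IsDuhamel μ E₀ e m Y Y' Z Z' N) {s t : ℝ} (hs : 0 ≤ s)
    (hst : s ≠ t) : HasDerivAt (fun x => symbolOp (Z s (max x s)) (N s))
      ((Iio t).indicator (fun s => symbolOp (Z' s t) (N s)) s) t := by
  rcases lt_or_gt_of_ne hst with hlt | hgt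
  · rw [indicator_of_mem (show s ∈ Iio t from hlt)]
    refine ((h.kernel s hs).hasDerivAt_symbolOp h.nonneg_mass hlt (N s)).congr_of_eventuallyEq ?_
    filter_upwards [Ici_mem_nhds hlt] with x hx
    rw [max_eq_left hx]
  · rw [indicator_of_notMem (by simpa using hgt.le)]
    refine (hasDerivAt_const t (symbolOp (Z s s) (N s))).congr_of_eventuallyEq ?_
    filter_upwards [Iic_mem_nhds hgt] with x hx
    rw [max_eq_right hx]

/-- Leibniz' rule with a moving endpoint. Since `Z s s = 0`, the truncated kernel is Lipschitz in
`x` across the diagonal, with constant dominated by `m s`; there is no boundary term, and one may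
differentiate over the fixed interval `(0, T]`. -/
theorem hasDerivAt_integral (h : IsDuhamel μ E₀ e m Y Y' Z Z' N) {t : ℝ} (ht : 0 < t) :
    IntegrableOn (fun s => symbolOp (Z' s t) (N s)) (Ioc 0 t) ∧
    HasDerivAt (fun x => ∫ s in Ioc 0 x, symbolOp (Z s x) (N s))
      (∫ s in Ioc 0 t, symbolOp (Z' s t) (N s)) t := by
  -- The margin 1 leaves room for `x` near `t` and for the points `t + 1/(n+1)` below.
  set T := t + 1 with hT
  set F : ℝ → ℝ → LTwo d := fun x s => symbolOp (Z s (max x s)) (N s) with hF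
  set F' : ℝ → LTwo d := (Iio t).indicator fun s => symbolOp (Z' s t) (N s) with hF'
  have hdiff : ∀ᵐ s ∂volume.restrict (Ioc 0 T), HasDerivAt (F · s) (F' s) t := by
    have hne : ∀ᵐ s ∂volume.restrict (Ioc 0 T), s ≠ t :=
      ae_restrict_of_ae (by simp [ae_iff])
    filter_upwards [ae_restrict_mem measurableSet_Ioc, hne] with s hs hst
    exact h.hasDerivAt_truncated hs.1.le hst
  have hmeas : ∀ x ∈ Icc 0 T, AEStronglyMeasurable (F x) (volume.restrict (Ioc 0 T)) :=
    fun x hx => h.aestronglyMeasurable_truncated hx.1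
  have hnhds : Icc 0 T ∈ 𝓝 t := Icc_mem_nhds ht (by linarith)
  -- Measurability is assumed only for the kernel itself; its derivative inherits it as an almost
  -- everywhere limit of difference quotients.
  have hFmeas' : AEStronglyMeasurable F' (volume.restrict (Ioc 0 T)) := by
    have hlim : Tendsto (fun n : ℕ => t + 1 / ((n : ℝ) + 1)) atTop (𝓝[≠] t) := by
      refine tendsto_nhdsWithin_iff.2 ⟨?_, Eventually.of_forall fun n => ?_⟩
      · simpa using (tendsto_const_nhds (x := t)).add tendsto_one_div_add_atTop_nhds_zero_nat
      · have : 0 < 1 / ((n : ℝ) + 1) := by positivity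
        simp only [mem_compl_iff, mem_singleton_iff]
        linarith
    refine aestronglyMeasurable_of_tendsto_ae atTop
      (f := fun (n : ℕ) s => slope (F · s) t (t + 1 / ((n : ℝ) + 1))) (fun n => ?_) ?_
    · have h1 : (1 : ℝ) / (n + 1) ≤ 1 := by
        rw [div_le_one (by positivity)]
        linarith [(Nat.cast_nonneg n : (0:ℝ) ≤ n)]
      have h2 : 0 < 1 / ((n : ℝ) + 1) := by positivity
      exact ((hmeas _ ⟨by linarith, by linarith⟩).sub
        (hmeas t ⟨ht.le, by linarith⟩)).const_smul ((t + 1 / ((n : ℝ) + 1) - t)⁻¹)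
    · filter_upwards [hdiff] with s hs
      exact (hasDerivAt_iff_tendsto_slope.1 hs).comp hlim
  have hint : Integrable (F t) (volume.restrict (Ioc 0 T)) := by
    refine Integrable.mono' ((h.integrableOn_source
      (fun s hs => hs.1.le : Ioc 0 T ⊆ Ici 0)).const_mul (1 + T))
      (hmeas t ⟨ht.le, by linarith⟩) ?_
    refine (ae_restrict_mem measurableSet_Ioc).mono fun s hs => ?_
    refine h.norm_symbolOp_source_le hs.1.le (by linarith)
      ((h.kernel s hs.1.le).isSymbol h.nonneg_mass (le_max_right _ _)) fun r => ?_
    have h1 := (h.kernel s hs.1.le).abs_le h.nonneg_mass (le_max_right t s) r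
    have h2 : e s * (1 + max t s) ≤ (1 + T) * e s := by
      rw [mul_comm]
      refine mul_le_mul_of_nonneg_right ?_ (h.kernel s hs.1.le).nonneg_energy
      have : max t s ≤ T := max_le (by linarith) hs.2
      linarith
    exact h1.trans h2
  have hlip : ∀ᵐ s ∂volume.restrict (Ioc 0 T),
      LipschitzOnWith (Real.nnabs (m s)) (F · s) (Icc 0 T) := by
    refine (ae_restrict_mem measurableSet_Ioc).mono fun s hs => ?_
    refine LipschitzOnWith.of_dist_le_mul fun x _ y _ => ?_
    have hm := h.kernel s hs.1.le
    have hsx := hm.isSymbol h.nonneg_mass (le_max_right x s)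
    have hsy := hm.isSymbol h.nonneg_mass (le_max_right y s)
    rw [dist_eq_norm, hF, ← symbolOp_sub hsx hsy, Real.coe_nnabs]
    have h1 : ‖symbolOp (fun r => Z s (max x s) r - Z s (max y s) r) (N s)‖ ≤ |x - y| * m s := by
      refine h.norm_symbolOp_source_le hs.1.le (abs_nonneg _) (hsx.sub hsy) fun r => ?_
      rw [mul_comm]
      refine (hm.abs_sub_le_abs h.nonneg_mass (le_max_right _ _) (le_max_right _ _) r).trans ?_
      exact mul_le_mul_of_nonneg_left (abs_max_sub_max_le_abs x y s) hm.nonneg_energy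
    refine h1.trans ?_
    rw [mul_comm, Real.dist_eq]
    exact mul_le_mul_of_nonneg_right (le_abs_self _) (abs_nonneg _)
  obtain ⟨h1, h2⟩ := hasDerivAt_integral_of_dominated_loc_of_lip hnhds
    (eventually_of_mem hnhds hmeas) hint hFmeas' hlip
    (h.integrableOn_source (fun s hs => hs.1.le : Ioc 0 T ⊆ Ici 0)) hdiff
  have hIoo : F' = fun s => (Iio t).indicator (fun s => symbolOp (Z' s t) (N s)) s := rfl
  have hinter : Ioc 0 T ∩ Iio t = Ioo 0 t := by
    ext s
    simp only [mem_inter_iff, mem_Ioc, mem_Iio, mem_Ioo]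
    constructor
    · exact fun hs => ⟨hs.1.1, hs.2⟩
    · exact fun hs => ⟨⟨hs.1, by linarith [hs.2]⟩, hs.2⟩
  have hinter' : Iio t ∩ Ioc 0 T = Ioo 0 t := by rw [inter_comm, hinter]
  constructor
  · rw [integrableOn_Ioc_iff_integrableOn_Ioo, ← hinter']
    rw [hIoo, integrable_indicator_iff measurableSet_Iio, IntegrableOn,
      Measure.restrict_restrict measurableSet_Iio] at h1
    exact h1
  · have h3 : ∫ s in Ioc 0 T, F' s = ∫ s in Ioc 0 t, symbolOp (Z' s t) (N s) := by
      rw [hF', setIntegral_indicator measurableSet_Iio, hinter, ← integral_Ioc_eq_integral_Ioo]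
    rw [← h3]
    refine h2.congr_of_eventuallyEq ?_
    filter_upwards [Iic_mem_nhds (by linarith : t < T)] with x hx
    exact (h.integral_truncated hx).symm

theorem integrableOn_kernel_deriv (h : IsDuhamel μ E₀ e m Y Y' Z Z' N) {t : ℝ} (ht : 0 ≤ t) :
    IntegrableOn (fun s => symbolOp (Z' s t) (N s)) (Ioc 0 t) := by
  rcases ht.eq_or_lt with rfl | ht
  · simp
  · exact (h.hasDerivAt_integral ht).1

theorem hasDerivAt_duhamelSol (h : IsDuhamel μ E₀ e m Y Y' Z Z' N) (g₀ g₁ : LTwo d) {t : ℝ}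
    (ht : 0 < t) :
    HasDerivAt (duhamelSol Y Z g₀ g₁ N) (duhamelSol Y' Z' g₀ g₁ N t) t :=
  ((h.initial.hasDerivAt_symbolOp h.nonneg_mass ht g₀).add
    ((h.kernel 0 le_rfl).hasDerivAt_symbolOp h.nonneg_mass ht g₁)).add (h.hasDerivAt_integral ht).2

/-- Norm bound for an expression of Duhamel's form. -/
theorem norm_duhamelSol_le (h : IsDuhamel μ E₀ e m Y Y' Z Z' N) (g₀ g₁ : LTwo d) {t ρ : ℝ}
    (hρ : 0 ≤ ρ) {θ : ℝ → ℝ} (hθ : ∀ s ∈ Icc 0 t, 0 ≤ θ s) (hθc : ContinuousOn θ (Icc 0 t))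
    {y : ℝ → ℝ → ℝ} {k : ℝ → ℝ → ℝ → ℝ} (hy : IsSymbol (y t)) (hk₀ : IsSymbol (k 0 t))
    (hk : ∀ s ∈ Ioc 0 t, IsSymbol (k s t)) (hyb : ∀ r, |y t r| ≤ ρ * E₀)
    (hk₀b : ∀ r, |k 0 t r| ≤ ρ * e 0)
    (hkb : ∀ s ∈ Ioc 0 t, ∀ r, |k s t r| ≤ ρ * (θ s * e s)) :
    ‖duhamelSol y k g₀ g₁ N t‖ ≤ ρ * (E₀ * ‖g₀‖ + e 0 * ‖g₁‖ + ∫ s in Ioc 0 t, θ s * m s) := by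
  have hint : IntegrableOn (fun s => ρ * (θ s * m s)) (Ioc 0 t) := by
    have h1 : IntegrableOn (fun s => θ s * m s) (Icc 0 t) :=
      (h.integrableOn_source (fun s hs => hs.1 : Icc 0 t ⊆ Ici 0)).continuousOn_mul hθc
        isCompact_Icc
    exact (h1.mono_set Ioc_subset_Icc_self).const_mul ρ
  have h1 : ‖∫ s in Ioc 0 t, symbolOp (k s t) (N s)‖ ≤ ∫ s in Ioc 0 t, ρ * (θ s * m s) := by
    refine norm_integral_le_of_norm_le hint ?_
    refine (ae_restrict_mem measurableSet_Ioc).mono fun s hs => ?_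
    rw [← mul_assoc]
    refine h.norm_symbolOp_source_le hs.1.le
      (mul_nonneg hρ (hθ s (Ioc_subset_Icc_self hs))) (hk s hs) fun r => ?_
    rw [mul_assoc]
    exact hkb s hs r
  rw [integral_const_mul] at h1
  have h2 := norm_symbolOp_le hy hyb g₀
  have h3 := norm_symbolOp_le hk₀ hk₀b g₁
  refine (norm_add₃_le).trans ?_
  linarith

end IsDuhamel

/-! ### Convergence of the wave profiles -/

/-- The decay rate of the wave profiles of the modes. -/
noncomputable def profileRate (μ t : ℝ) : ℝ := (1 + t) ^ (growthExp μ - 1) * logFactor μ t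

theorem profileRate_nonneg (μ : ℝ) {t : ℝ} (ht : 0 ≤ t) : 0 ≤ profileRate μ t :=
  mul_nonneg (by positivity) (zero_le_one.trans (one_le_logFactor μ ht))

/-- Bounded combinations `c₁ r z + c₂ z'` whose variation along modes decays. -/
structure IsProfile (μ C : ℝ) (c₁ c₂ : ℝ → ℝ → ℝ) : Prop where
  symbol_fst : ∀ t, IsSymbol (c₁ t)
  symbol_snd : ∀ t, IsSymbol (c₂ t)
  bound : ∀ (s E : ℝ) (z z' : ℝ → ℝ → ℝ), IsModeFamily μ s E z z' → ∀ t : ℝ, s ≤ t → ∀ r,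
    |c₁ t r * (r * z t r) + c₂ t r * z' t r| ≤ E
  variation : ∀ (s E : ℝ) (z z' : ℝ → ℝ → ℝ), IsModeFamily μ s E z z' → ∀ t t' : ℝ, s ≤ t →
    t ≤ t' → ∀ r, |(c₁ t' r * (r * z t' r) + c₂ t' r * z' t' r)
        - (c₁ t r * (r * z t r) + c₂ t r * z' t r)|
      ≤ μ * C * profileRate μ t * ((1 + s) ^ (1 - growthExp μ) * E)

theorem exists_isProfile {μ : ℝ} (hμ : 0 ≤ μ) : ∃ C : ℝ, 0 ≤ C ∧
    IsProfile μ C (fun t r => Real.cos (r * t)) (fun t r => -Real.sin (r * t)) ∧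
    IsProfile μ C (fun t r => Real.sin (r * t)) (fun t r => Real.cos (r * t)) ∧
    ∀ (s E : ℝ) (z z' : ℝ → ℝ → ℝ), IsModeFamily μ s E z z' → ∀ t : ℝ, s ≤ t →
      ∀ r, |z t r| ≤ C * (1 + t) * profileRate μ t * ((1 + s) ^ (1 - growthExp μ) * E) := by
  obtain ⟨C, hC0, hC⟩ := exists_family_bounds hμ
  refine ⟨C, hC0, ⟨fun t => .cos t, fun t => ?_, fun s E z z' hz t hst r => ?_,
    fun s E z z' hz t t' hst htt' r => ?_⟩, ⟨fun t => .sin t, fun t => .cos t,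
    fun s E z z' hz t hst r => (hz.profile_le hμ hst r).2,
    fun s E z z' hz t t' hst htt' r => (hC s E z z' hz t t' hst htt' r).2.2⟩,
    fun s E z z' hz t hst r => ?_⟩
  · have := (IsSymbol.const 0).sub (.sin t)
    simpa using this
  · rw [neg_mul, ← sub_eq_add_neg]
    exact (hz.profile_le hμ hst r).1
  · rw [neg_mul, neg_mul, ← sub_eq_add_neg, ← sub_eq_add_neg]
    exact (hC s E z z' hz t t' hst htt' r).2.1
  · have ht : 0 < 1 + t := by linarith [hz.nonneg_time]
    refine ((hC s E z z' hz t t hst le_rfl r).1).trans (le_of_eq ?_)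
    rw [profileRate, Real.rpow_sub_one ht.ne']
    field_simp

namespace IsDuhamel

variable {d : ℕ} {μ E₀ C : ℝ} {e m : ℝ → ℝ} {Y Y' : ℝ → ℝ → ℝ} {Z Z' : ℝ → ℝ → ℝ → ℝ}
  {N : ℝ → LTwo d} {c₁ c₂ : ℝ → ℝ → ℝ}

/-- Bounded multipliers pass through the Duhamel integral, so a profile of the solution is again of
Duhamel form, with the profiles of the modes as symbols. -/
theorem symbolOp_add_symbolOp_eq (h : IsDuhamel μ E₀ e m Y Y' Z Z' N) (g₀ g₁ : LTwo d)
    {p q : ℝ → ℝ} (hp : IsSymbol p) (hq : IsSymbol q) {t : ℝ} (ht : 0 ≤ t) :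
    IntegrableOn (fun s => symbolOp (fun r => p r * Z s t r + q r * Z' s t r) (N s)) (Ioc 0 t) ∧
    symbolOp p (duhamelSol Y Z g₀ g₁ N t) + symbolOp q (duhamelSol Y' Z' g₀ g₁ N t)
      = duhamelSol (fun t r => p r * Y t r + q r * Y' t r)
        (fun s t r => p r * Z s t r + q r * Z' s t r) g₀ g₁ N t := by
  have hμ := h.nonneg_mass
  have hY := h.initial.isSymbol hμ ht
  have hY' := h.initial.isSymbol_deriv hμ ht
  have hZ : ∀ s, 0 ≤ s → s ≤ t → IsSymbol (Z s t) := fun s hs hst => (h.kernel s hs).isSymbol hμ hst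
  have hZ' : ∀ s, 0 ≤ s → s ≤ t → IsSymbol (Z' s t) := fun s hs hst =>
    (h.kernel s hs).isSymbol_deriv hμ hst
  have hi := h.integrableOn_kernel ht
  have hi' := h.integrableOn_kernel_deriv ht
  have hcongr : EqOn (fun s => symbolOp p (symbolOp (Z s t) (N s))
        + symbolOp q (symbolOp (Z' s t) (N s)))
      (fun s => symbolOp (fun r => p r * Z s t r + q r * Z' s t r) (N s)) (Ioc 0 t) := by
    intro s hs
    simp only
    rw [symbolOp_add (hp.mul (hZ s hs.1.le hs.2)) (hq.mul (hZ' s hs.1.le hs.2)),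
      symbolOp_mul hp (hZ s hs.1.le hs.2), symbolOp_mul hq (hZ' s hs.1.le hs.2)]
  have hpi := (symbolOp p : LTwo d →L[ℂ] LTwo d).integrable_comp hi
  have hqi := (symbolOp q : LTwo d →L[ℂ] LTwo d).integrable_comp hi'
  refine ⟨(integrableOn_congr_fun hcongr measurableSet_Ioc).1 (hpi.add hqi), ?_⟩
  unfold duhamelSol
  rw [← setIntegral_congr_fun measurableSet_Ioc hcongr, integral_add hpi hqi,
    ContinuousLinearMap.integral_comp_comm _ hi, ContinuousLinearMap.integral_comp_comm _ hi',
    symbolOp_add (hp.mul hY) (hq.mul hY'), symbolOp_mul hp hY, symbolOp_mul hq hY',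
    symbolOp_add (hp.mul (hZ 0 le_rfl ht)) (hq.mul (hZ' 0 le_rfl ht)),
    symbolOp_mul hp (hZ 0 le_rfl ht), symbolOp_mul hq (hZ' 0 le_rfl ht)]
  simp only [map_add]
  abel

/-- The majorant of the data and of the past source. -/
noncomputable def past (μ E₀ : ℝ) (e m : ℝ → ℝ) (g₀ g₁ : LTwo d) (t : ℝ) : ℝ :=
  E₀ * ‖g₀‖ + e 0 * ‖g₁‖ + ∫ s in Ioc 0 t, (1 + s) ^ (1 - growthExp μ) * m s

/-- The data and the sources before `t` are modes already running at time `t`, whose profiles vary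
little; sources in `(t, t']` are bounded by their energy alone. The cutoff `χ` makes the weight `χ r
* r` a bounded symbol and does not enter the bound. -/
theorem norm_profile_cutoff_sub_le (h : IsDuhamel μ E₀ e m Y Y' Z Z' N) (hC : 0 ≤ C)
    (hc : IsProfile μ C c₁ c₂) (g₀ g₁ : LTwo d) {χ : ℝ → ℝ} (hχ : IsSymbol χ)
    (hrχ : IsSymbol fun r => χ r * r) (hχ1 : ∀ r, |χ r| ≤ 1) {t t' : ℝ} (ht : 0 ≤ t)
    (htt' : t ≤ t') :
    ‖(symbolOp (fun r => χ r * r * c₁ t' r) (duhamelSol Y Z g₀ g₁ N t')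
        + symbolOp (fun r => χ r * c₂ t' r) (duhamelSol Y' Z' g₀ g₁ N t'))
      - (symbolOp (fun r => χ r * r * c₁ t r) (duhamelSol Y Z g₀ g₁ N t)
        + symbolOp (fun r => χ r * c₂ t r) (duhamelSol Y' Z' g₀ g₁ N t))‖
      ≤ μ * C * profileRate μ t * past μ E₀ e m g₀ g₁ t + ∫ s in Ioc t t', m s := by
  have hμ := h.nonneg_mass
  have ht' := ht.trans htt'
  have hsp : ∀ t, IsSymbol fun r => χ r * r * c₁ t r := fun t => hrχ.mul (hc.symbol_fst t)
  have hsq : ∀ t, IsSymbol fun r => χ r * c₂ t r := fun t => hχ.mul (hc.symbol_snd t)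
  obtain ⟨hint', heq'⟩ := h.symbolOp_add_symbolOp_eq g₀ g₁ (hsp t') (hsq t') ht'
  obtain ⟨hint, heq⟩ := h.symbolOp_add_symbolOp_eq g₀ g₁ (hsp t) (hsq t) ht
  rw [heq, heq']
  set y : ℝ → ℝ → ℝ := fun x r => χ r * r * c₁ x r * Y x r + χ r * c₂ x r * Y' x r with hy
  set k : ℝ → ℝ → ℝ → ℝ := fun s x r => χ r * r * c₁ x r * Z s x r + χ r * c₂ x r * Z' s x r
    with hk
  have hysym : ∀ x, 0 ≤ x → IsSymbol (y x) := fun x hx =>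
    ((hsp x).mul (h.initial.isSymbol hμ hx)).add ((hsq x).mul (h.initial.isSymbol_deriv hμ hx))
  have hksym : ∀ s x, 0 ≤ s → s ≤ x → IsSymbol (k s x) := fun s x hs hx =>
    ((hsp x).mul ((h.kernel s hs).isSymbol hμ hx)).add
      ((hsq x).mul ((h.kernel s hs).isSymbol_deriv hμ hx))
  have hyeq : ∀ x r, y x r = χ r * (c₁ x r * (r * Y x r) + c₂ x r * Y' x r) := fun x r => by
    simp only [hy]; ring
  have hkeq : ∀ s x r, k s x r = χ r * (c₁ x r * (r * Z s x r) + c₂ x r * Z' s x r) :=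
    fun s x r => by simp only [hk]; ring
  -- The first term collects what was present at time `t`, the integral what was emitted in `(t,
  -- t']`.
  have hsplit : duhamelSol y k g₀ g₁ N t' - duhamelSol y k g₀ g₁ N t
      = duhamelSol (fun _ r => y t' r - y t r) (fun s _ r => k s t' r - k s t r) g₀ g₁ N t
        + ∫ s in Ioc t t', symbolOp (k s t') (N s) := by
    have h1 : ∫ s in Ioc 0 t', symbolOp (k s t') (N s)
        = (∫ s in Ioc 0 t, symbolOp (k s t') (N s)) + ∫ s in Ioc t t', symbolOp (k s t') (N s) := by
      rw [← Ioc_union_Ioc_eq_Ioc ht htt']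
      exact setIntegral_union (Ioc_disjoint_Ioc_of_le le_rfl) measurableSet_Ioc
        (hint'.mono_set (Ioc_subset_Ioc_right htt')) (hint'.mono_set (Ioc_subset_Ioc_left ht))
    have h2 : ∫ s in Ioc 0 t, symbolOp (fun r => k s t' r - k s t r) (N s)
        = (∫ s in Ioc 0 t, symbolOp (k s t') (N s)) - ∫ s in Ioc 0 t, symbolOp (k s t) (N s) := by
      rw [← integral_sub (hint'.mono_set (Ioc_subset_Ioc_right htt')) hint]
      exact setIntegral_congr_fun measurableSet_Ioc fun s hs =>
        symbolOp_sub (hksym s t' hs.1.le (hs.2.trans htt')) (hksym s t hs.1.le hs.2) _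
    change (symbolOp (y t') g₀ + symbolOp (k 0 t') g₁ + ∫ s in Ioc 0 t', symbolOp (k s t') (N s))
      - (symbolOp (y t) g₀ + symbolOp (k 0 t) g₁ + ∫ s in Ioc 0 t, symbolOp (k s t) (N s))
      = (symbolOp (fun r => y t' r - y t r) g₀ + symbolOp (fun r => k 0 t' r - k 0 t r) g₁
        + ∫ s in Ioc 0 t, symbolOp (fun r => k s t' r - k s t r) (N s)) + _
    rw [h1, h2, symbolOp_sub (hysym t' ht') (hysym t ht),
      symbolOp_sub (hksym 0 t' le_rfl ht') (hksym 0 t le_rfl ht)]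
    abel
  change ‖duhamelSol y k g₀ g₁ N t' - duhamelSol y k g₀ g₁ N t‖ ≤ _
  rw [hsplit]
  have hρ : 0 ≤ μ * C * profileRate μ t := by
    have := profileRate_nonneg μ ht
    positivity
  have hmulχ : ∀ (r x B : ℝ), |x| ≤ B → |χ r * x| ≤ B := fun r x B hx => by
    rw [abs_mul]
    exact (mul_le_of_le_one_left (abs_nonneg _) (hχ1 r)).trans hx
  have hcont : ContinuousOn (fun s : ℝ => (1 + s) ^ (1 - growthExp μ)) (Icc 0 t) := fun s hs =>
    (hasDerivAt_one_add_rpow hs.1).continuousAt.continuousWithinAt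
  refine (norm_add_le _ _).trans (add_le_add ?_ ?_)
  · refine h.norm_duhamelSol_le g₀ g₁ (θ := fun s => (1 + s) ^ (1 - growthExp μ)) hρ
      (fun s hs => by have := hs.1; positivity) hcont
      ((hysym t' ht').sub (hysym t ht)) ((hksym 0 t' le_rfl ht').sub (hksym 0 t le_rfl ht))
      (fun s hs => (hksym s t' hs.1.le (hs.2.trans htt')).sub (hksym s t hs.1.le hs.2))
      (fun r => ?_) (fun r => ?_) (fun s hs r => ?_)
    · rw [hyeq, hyeq, ← mul_sub]
      have := hc.variation 0 E₀ Y Y' h.initial t t' ht htt' r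
      simp only [add_zero, Real.one_rpow, one_mul] at this
      exact hmulχ _ _ _ this
    · rw [hkeq, hkeq, ← mul_sub]
      have := hc.variation 0 (e 0) _ _ (h.kernel 0 le_rfl) t t' ht htt' r
      simp only [add_zero, Real.one_rpow, one_mul] at this
      exact hmulχ _ _ _ this
    · rw [hkeq, hkeq, ← mul_sub]
      exact hmulχ _ _ _ (hc.variation s (e s) _ _ (h.kernel s hs.1.le) t t' hs.2 htt' r)
  · refine norm_integral_le_of_norm_le
      (h.integrableOn_source fun s hs => (ht.trans_lt hs.1).le) ?_
    refine (ae_restrict_mem measurableSet_Ioc).mono fun s hs => ?_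
    have hs0 : 0 ≤ s := (ht.trans_lt hs.1).le
    have := h.norm_symbolOp_source_le hs0 zero_le_one (hksym s t' hs0 hs.2) fun r => by
      rw [hkeq, one_mul]
      exact hmulχ _ _ _ (hc.bound s (e s) _ _ (h.kernel s hs0) t' hs.2 r)
    rwa [one_mul] at this

/-- Controls the undifferentiated solution, needed for the term `μ₁/(2(1+t)) v` in `∂ₜu`. -/
theorem norm_duhamelSol_growth (h : IsDuhamel μ E₀ e m Y Y' Z Z' N) (hC : 0 ≤ C)
    (hgrowth : ∀ (s E : ℝ) (z z' : ℝ → ℝ → ℝ), IsModeFamily μ s E z z' → ∀ t : ℝ, s ≤ t →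
      ∀ r, |z t r| ≤ C * (1 + t) * profileRate μ t * ((1 + s) ^ (1 - growthExp μ) * E))
    (g₀ g₁ : LTwo d) {t : ℝ} (ht : 0 ≤ t) :
    ‖duhamelSol Y Z g₀ g₁ N t‖
      ≤ C * (1 + t) * profileRate μ t * past μ E₀ e m g₀ g₁ t := by
  have hμ := h.nonneg_mass
  have hρ : 0 ≤ C * (1 + t) * profileRate μ t := by
    have := profileRate_nonneg μ ht
    positivity
  have hcont : ContinuousOn (fun s : ℝ => (1 + s) ^ (1 - growthExp μ)) (Icc 0 t) := fun s hs =>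
    (hasDerivAt_one_add_rpow hs.1).continuousAt.continuousWithinAt
  refine h.norm_duhamelSol_le g₀ g₁ (θ := fun s => (1 + s) ^ (1 - growthExp μ)) hρ
    (fun s hs => by have := hs.1; positivity) hcont (h.initial.isSymbol hμ ht)
    ((h.kernel 0 le_rfl).isSymbol hμ ht) (fun s hs => (h.kernel s hs.1.le).isSymbol hμ hs.2)
    (fun r => ?_) (fun r => ?_) (fun s hs r => hgrowth s _ _ _ (h.kernel s hs.1.le) t hs.2 r)
  · simpa using hgrowth 0 _ _ _ h.initial t ht r
  · simpa using hgrowth 0 _ _ _ (h.kernel 0 le_rfl) t ht r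

end IsDuhamel

/-! ### Removing the frequency cutoff -/

/-- It tends to 1 as `n → ∞`, stays at most 1, and decays fast enough for `cutoff n r * r` to be
bounded. -/
noncomputable def cutoff (n : ℕ) (r : ℝ) : ℝ := ((n : ℝ) + 1) / (n + 1 + r ^ 2)

theorem cutoff_pos (n : ℕ) (r : ℝ) : 0 < cutoff n r := by
  unfold cutoff
  positivity

theorem cutoff_le_one (n : ℕ) (r : ℝ) : cutoff n r ≤ 1 := by
  unfold cutoff
  rw [div_le_one (by positivity)]
  linarith [sq_nonneg r]

theorem abs_cutoff_le (n : ℕ) (r : ℝ) : |cutoff n r| ≤ 1 := by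
  rw [abs_of_pos (cutoff_pos n r)]
  exact cutoff_le_one n r

theorem continuous_cutoff (n : ℕ) : Continuous (cutoff n) := by
  unfold cutoff
  exact continuous_const.div (by fun_prop) fun r => by positivity

theorem isSymbol_cutoff (n : ℕ) : IsSymbol (cutoff n) :=
  .of_le (continuous_cutoff n) (abs_cutoff_le n)

theorem isSymbol_cutoff_mul (n : ℕ) : IsSymbol fun r => cutoff n r * r := by
  refine .of_le (C := n + 1) ((continuous_cutoff n).mul continuous_id) fun r => ?_
  have hn : (0:ℝ) ≤ n := Nat.cast_nonneg n
  rw [abs_mul, abs_of_pos (cutoff_pos n r), cutoff, div_mul_eq_mul_div, div_le_iff₀ (by positivity)]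
  refine mul_le_mul_of_nonneg_left ?_ (by positivity)
  nlinarith [sq_abs r, sq_nonneg (|r| - 1)]

/-- Bounds uniform in `n` survive the removal of the cutoff, by dominated convergence. -/
theorem norm_le_of_cutoff {d : ℕ} {f : LTwo d} {B : ℝ}
    (h : ∀ n : ℕ, ‖symbolOp (cutoff n) f‖ ≤ B) : ‖f‖ ≤ B := by
  have h1 : Tendsto (fun n : ℕ => symbolOp (cutoff n) f) atTop (𝓝 (symbolOp (fun _ => 1) f)) := by
    refine tendsto_symbolOp (C := 2) (Eventually.of_forall isSymbol_cutoff) (.const 1)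
      (Eventually.of_forall fun n r => ?_) (fun r => ?_) f
    · refine (abs_sub _ _).trans ?_
      rw [abs_one]
      linarith [abs_cutoff_le n r]
    · have h2 : Tendsto (fun n : ℕ => 1 - r ^ 2 / ((n : ℝ) + 1 + r ^ 2)) atTop (𝓝 (1 - 0)) := by
        refine tendsto_const_nhds.sub (Tendsto.div_atTop tendsto_const_nhds ?_)
        exact tendsto_atTop_add_const_right _ _
          (tendsto_atTop_add_const_right _ _ tendsto_natCast_atTop_atTop)
      rw [sub_zero] at h2
      refine h2.congr fun n => ?_
      have : (n : ℝ) + 1 + r ^ 2 ≠ 0 := by positivity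
      unfold cutoff
      field_simp
      ring
  rw [symbolOp_const, one_smul] at h1
  exact le_of_tendsto h1.norm (Eventually.of_forall h)

theorem exists_limit_of_le {E : Type*} [NormedAddCommGroup E] [CompleteSpace E] {A : ℝ → E}
    {b : ℝ → ℝ} (hb : Tendsto b atTop (𝓝 0))
    (h : ∀ t t', 0 ≤ t → t ≤ t' → ‖A t' - A t‖ ≤ b t) :
    ∃ L, Tendsto A atTop (𝓝 L) ∧ ∀ t, 0 ≤ t → ‖A t - L‖ ≤ b t := by
  have hc : Cauchy (map A atTop) := by
    refine Metric.cauchy_iff.2 ⟨inferInstance, fun ε hε => ?_⟩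
    obtain ⟨T, hT, hT0⟩ := ((hb.eventually (gt_mem_nhds (by linarith : 0 < ε / 2))).and
      (eventually_ge_atTop 0)).exists
    refine ⟨A '' Ici T, image_mem_map (Ici_mem_atTop T), ?_⟩
    rintro _ ⟨x, hx, rfl⟩ _ ⟨y, hy, rfl⟩
    have h1 := h T x hT0 hx
    have h2 := h T y hT0 hy
    rw [dist_eq_norm]
    calc ‖A x - A y‖ = ‖(A x - A T) - (A y - A T)‖ := by congr 1; abel
      _ ≤ ‖A x - A T‖ + ‖A y - A T‖ := norm_sub_le _ _
      _ < ε := by linarith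
  obtain ⟨L, hL⟩ := CompleteSpace.complete hc
  refine ⟨L, hL, fun t ht => ?_⟩
  rw [norm_sub_rev]
  exact le_of_tendsto (Tendsto.sub_const hL (A t)).norm
    ((eventually_ge_atTop t).mono fun t' ht' => h t t' ht ht')

/-! ### Tempered distributions given by functions -/

/-- The tempered distribution `T` is the locally integrable function `g`. -/
def IsDistFun {d : ℕ} (T : 𝓢'(Space d, ℂ)) (g : Space d → ℂ) : Prop :=
  LocallyIntegrable g volume ∧ ∀ φ : 𝓢(Space d, ℂ),
    Integrable (fun ξ => φ ξ * g ξ) volume ∧ T φ = ∫ ξ, φ ξ * g ξ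

theorem isDistFun_Lp {d : ℕ} {p : ℝ≥0∞} [hp : Fact (1 ≤ p)]
    (f : Lp ℂ p (volume : Measure (Space d))) : IsDistFun (f : 𝓢'(Space d, ℂ)) f := by
  refine ⟨(Lp.memLp f).locallyIntegrable hp.out, fun φ => ⟨?_, ?_⟩⟩
  · have := ENNReal.HolderConjugate.inv_one_sub_inv' hp.out
    have : ENNReal.HolderConjugate (1 - p⁻¹)⁻¹ p := ENNReal.HolderConjugate.symm
    exact memLp_one_iff_integrable.1
      ((Lp.memLp f).mul (φ.memLp (1 - p⁻¹)⁻¹ volume))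
  · rw [Lp.toTemperedDistribution_apply]
    rfl

namespace IsDistFun

variable {d : ℕ} {S T : 𝓢'(Space d, ℂ)} {g h : Space d → ℂ}

theorem congr (hT : IsDistFun T g) (hgh : g =ᵐ[volume] h) : IsDistFun T h := by
  refine ⟨(locallyIntegrable_congr hgh).1 hT.1, fun φ => ?_⟩
  have e : (fun ξ => φ ξ * g ξ) =ᵐ[volume] fun ξ => φ ξ * h ξ := by
    filter_upwards [hgh] with ξ hξ
    rw [hξ]
  exact ⟨(hT.2 φ).1.congr e, (hT.2 φ).2.trans (integral_congr_ae e)⟩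

theorem add (hS : IsDistFun S g) (hT : IsDistFun T h) : IsDistFun (S + T) fun ξ => g ξ + h ξ := by
  refine ⟨hS.1.add hT.1, fun φ => ?_⟩
  obtain ⟨h1, h2⟩ := hS.2 φ
  obtain ⟨h3, h4⟩ := hT.2 φ
  simp only [mul_add]
  refine ⟨h1.add h3, ?_⟩
  rw [integral_add h1 h3, ← h2, ← h4]
  rfl

theorem ae_eq (hg : IsDistFun T g) (hh : IsDistFun T h) : g =ᵐ[volume] h := by
  refine ae_eq_of_integral_contDiff_smul_eq hg.1 hh.1 fun φ hφ hφc => ?_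
  have hc : HasCompactSupport (Complex.ofRealCLM ∘ φ) := hφc.comp_left rfl
  have hs : ContDiff ℝ ((⊤ : ℕ∞) : WithTop ℕ∞) (Complex.ofRealCLM ∘ φ) :=
    Complex.ofRealCLM.contDiff.comp hφ
  have h1 := (hg.2 (hc.toSchwartzMap hs)).2
  rw [(hh.2 (hc.toSchwartzMap hs)).2] at h1
  exact h1.symm

end IsDistFun

theorem HasFourierFun.congr {d : ℕ} {T : 𝓢'(Space d, ℂ)} {g h : Space d → ℂ}
    (hT : HasFourierFun T g) (hgh : g =ᵐ[volume] h) : HasFourierFun T h :=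
  IsDistFun.congr (T := 𝓕 T) hT hgh

theorem HasFourierFun.sub_smul {d : ℕ} {S T : 𝓢'(Space d, ℂ)} {g h : Space d → ℂ}
    (hS : HasFourierFun S g) (hT : HasFourierFun T h) (c : ℂ) :
    HasFourierFun (S - c • T) fun ξ => g ξ - c * h ξ := by
  refine ⟨hS.1.sub (hT.1.smul c), fun φ => ?_⟩
  obtain ⟨h1, h2⟩ := hS.2 φ
  obtain ⟨h3, h4⟩ := hT.2 φ
  simp only [mul_sub, mul_left_comm _ c]
  refine ⟨h1.sub (h3.const_mul c), ?_⟩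
  rw [integral_sub h1 (h3.const_mul c), integral_const_mul, ← h2, ← h4]
  rfl

theorem hasFourierFun_Lp {d : ℕ} (f : LTwo d) :
    HasFourierFun (f : 𝓢'(Space d, ℂ)) (𝓕 f : LTwo d) := by
  have := isDistFun_Lp (𝓕 f : LTwo d)
  rw [← Lp.fourier_toTemperedDistribution_eq] at this
  exact this

theorem HasFourierFun.fourierFun_ae_eq {d : ℕ} {T : 𝓢'(Space d, ℂ)} {g : Space d → ℂ}
    (hT : HasFourierFun T g) : fourierFun T =ᵐ[volume] g := by
  have h : ∃ g, HasFourierFun T g := ⟨g, hT⟩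
  rw [fourierFun, dif_pos h]
  exact IsDistFun.ae_eq (T := 𝓕 T) h.choose_spec hT

theorem hasFourierFun_distOfFourier {d : ℕ} {g : Space d → ℂ} (h : ∃ T, HasFourierFun T g) :
    HasFourierFun (distOfFourier g) g := by
  rw [distOfFourier, dif_pos h]
  exact h.choose_spec

/-- Division by `2π|ξ|` of the Fourier transform of an `L²` function gives a tempered
distribution. -/
theorem exists_hasFourierFun_div {d : ℕ} (hd : 3 ≤ d) (A : LTwo d) :
    ∃ T, HasFourierFun T fun ξ => A ξ / ((2 * Real.pi * ‖ξ‖ : ℝ) : ℂ) := by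
  set g : Space d → ℂ := fun ξ => A ξ / ((2 * Real.pi * ‖ξ‖ : ℝ) : ℂ) with hg
  have hdfin : Module.finrank ℝ (Space d) = d := by simp
  have hmeas : AEStronglyMeasurable (fun ξ : Space d => (((2 * Real.pi * ‖ξ‖ : ℝ) : ℂ))⁻¹)
      volume := by
    have : Measurable fun ξ : Space d => (((2 * Real.pi * ‖ξ‖ : ℝ) : ℂ))⁻¹ := by fun_prop
    exact this.aestronglyMeasurable
  have hgm : AEStronglyMeasurable g volume := by
    simp only [hg, div_eq_mul_inv]
    exact (Lp.aestronglyMeasurable A).mul hmeas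
  -- Here the dimension enters: `|ξ|^(-2)` is integrable near the origin for `d ≥ 3`. Hence the
  -- quotient is in `L¹` near 0, and away from 0 it is dominated by `A`, hence in `L²`.
  have h2 : MemLp (fun ξ : Space d => (((2 * Real.pi * ‖ξ‖ : ℝ) : ℂ))⁻¹) 2
      (volume.restrict (Metric.ball 0 1)) := by
    rw [memLp_two_iff_integrable_sq_norm hmeas.restrict]
    refine integrableOn_ball_of_norm_le_rpow (C := 1) (α := 2) (by rw [hdfin]; omega)
      (by rw [hdfin]; exact_mod_cast hd) (Eventually.of_forall fun ξ => ?_) (hmeas.norm.pow 2)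
    rw [norm_pow, norm_norm, norm_inv, Complex.norm_real, Real.norm_of_nonneg (by positivity),
      one_mul, Real.rpow_neg (norm_nonneg _), inv_pow]
    norm_num
    rcases eq_or_ne ξ 0 with rfl | hξ
    · simp
    · have : 0 < ‖ξ‖ := norm_pos_iff.2 hξ
      refine inv_anti₀ (by positivity) ?_
      have hpi := Real.pi_gt_three
      gcongr
      nlinarith
  have hint : IntegrableOn g (Metric.ball 0 1) := by
    simp only [hg, div_eq_mul_inv]
    exact memLp_one_iff_integrable.1 (h2.mul ((Lp.memLp A).restrict (Metric.ball 0 1)))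
  have h1 : MemLp ((Metric.ball 0 1).indicator g) 1 volume :=
    memLp_one_iff_integrable.2 ((integrable_indicator_iff Metric.isOpen_ball.measurableSet).2 hint)
  have h3 : MemLp ((Metric.ball 0 1)ᶜ.indicator g) 2 volume := by
    refine (Lp.memLp A).of_le (hgm.indicator Metric.isOpen_ball.measurableSet.compl)
      (Eventually.of_forall fun ξ => ?_)
    by_cases hξ : ξ ∈ (Metric.ball (0 : Space d) 1)ᶜ
    · have hξ1 : 1 ≤ ‖ξ‖ := by simpa using hξ
      rw [indicator_of_mem hξ, hg, norm_div, Complex.norm_real,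
        Real.norm_of_nonneg (by positivity)]
      refine div_le_self (norm_nonneg _) ?_
      nlinarith [Real.pi_gt_three]
    · rw [indicator_of_notMem hξ, norm_zero]
      exact norm_nonneg _
  have hsum := (isDistFun_Lp (h1.toLp _)).add (isDistFun_Lp (h3.toLp _))
  refine ⟨𝓕⁻ (((h1.toLp _ : Lp ℂ 1 (volume : Measure (Space d))) : 𝓢'(Space d, ℂ))
    + ((h3.toLp _ : LTwo d) : 𝓢'(Space d, ℂ))), ?_⟩
  change IsDistFun (𝓕 (𝓕⁻ _)) g
  rw [FourierTransform.fourier_fourierInv_eq]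
  refine hsum.congr ?_
  filter_upwards [h1.coeFn_toLp, h3.coeFn_toLp] with ξ a b
  rw [a, b]
  exact congrFun (indicator_self_add_compl _ g) ξ

/-- The homogeneous Sobolev norm in terms of the Fourier transform. -/
theorem hDotOneNorm_le {d : ℕ} {T : 𝓢'(Space d, ℂ)} {g : Space d → ℂ} (hT : HasFourierFun T g)
    {A : LTwo d} (hA : (fun ξ => ((2 * Real.pi * ‖ξ‖ : ℝ) : ℂ) * g ξ) =ᵐ[volume] A) :
    hDotOneNorm T ≤ ENNReal.ofReal ‖A‖ := by
  refine (iInf₂_le g hT).trans ?_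
  rw [eLpNorm_congr_ae hA, ← Lp.enorm_def, ofReal_norm]

/-! ### The free wave with profile `(A, B)` -/

section wave

variable {d : ℕ} {φ₀ : 𝓢'(Space d, ℂ)} {φ₁ A : LTwo d}

theorem ae_norm_ne_zero (hd : 3 ≤ d) : ∀ᵐ ξ : Space d, ((2 * Real.pi * ‖ξ‖ : ℝ) : ℂ) ≠ 0 := by
  have : Nonempty (Fin d) := ⟨⟨0, by omega⟩⟩
  have : ∀ᵐ ξ : Space d, ξ ≠ 0 := by simp [ae_iff]
  filter_upwards [this] with ξ hξ
  have : 0 < ‖ξ‖ := norm_pos_iff.2 hξ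
  exact_mod_cast (by positivity : (2 * Real.pi * ‖ξ‖) ≠ 0)

/-- With `A` the transform of `|∇|φ₀`, the first component times `|ξ|` is a rotation of `(A, 𝓕 φ₁)`
and lies in `L²`; the division lemma makes it a genuine distribution. -/
theorem hasFourierFun_waveFst (hd : 3 ≤ d)
    (hφ : HasFourierFun φ₀ fun ξ => A ξ / ((2 * Real.pi * ‖ξ‖ : ℝ) : ℂ)) (t : ℝ) :
    HasFourierFun (waveFst t φ₀ φ₁) fun ξ =>
      (symbolOp (fun r => Real.cos (r * t)) A + symbolOp (fun r => Real.sin (r * t)) (𝓕 φ₁) :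
        LTwo d) ξ / ((2 * Real.pi * ‖ξ‖ : ℝ) : ℂ) := by
  set W : LTwo d := symbolOp (fun r => Real.cos (r * t)) A
    + symbolOp (fun r => Real.sin (r * t)) (𝓕 φ₁) with hW
  set g : Space d → ℂ := fun ξ =>
    ((Real.cos (t * (2 * Real.pi * ‖ξ‖)) : ℝ) : ℂ) * fourierFun φ₀ ξ
      + ((Real.sin (t * (2 * Real.pi * ‖ξ‖)) / (2 * Real.pi * ‖ξ‖) : ℝ) : ℂ) * (𝓕 φ₁ : LTwo d) ξ
    with hg
  have hae : (fun ξ => W ξ / ((2 * Real.pi * ‖ξ‖ : ℝ) : ℂ)) =ᵐ[volume] g := by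
    filter_upwards [hφ.fourierFun_ae_eq, coeFn_symbolOp (.cos t) A,
      coeFn_symbolOp (.sin t) (𝓕 φ₁ : LTwo d), Lp.coeFn_add (symbolOp (fun r => Real.cos (r * t)) A)
        (symbolOp (fun r => Real.sin (r * t)) (𝓕 φ₁))] with ξ h1 h2 h3 h4
    rw [hg, hW, h4, Pi.add_apply, h2, h3]
    simp only [h1, radial, mul_comm t]
    push_cast
    ring
  obtain ⟨T, hT⟩ := exists_hasFourierFun_div hd W
  exact (hasFourierFun_distOfFourier ⟨T, hT.congr hae⟩).congr hae.symm

theorem waveSnd_eq (hd : 3 ≤ d)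
    (hφ : HasFourierFun φ₀ fun ξ => A ξ / ((2 * Real.pi * ‖ξ‖ : ℝ) : ℂ)) (t : ℝ) :
    waveSnd t φ₀ φ₁ = 𝓕⁻ (symbolOp (fun r => Real.cos (r * t)) (𝓕 φ₁)
      - symbolOp (fun r => Real.sin (r * t)) A) := by
  refine ofFourier_eq ?_
  filter_upwards [hφ.fourierFun_ae_eq, coeFn_symbolOp (.sin t) A, ae_norm_ne_zero hd,
    coeFn_symbolOp (.cos t) (𝓕 φ₁ : LTwo d), Lp.coeFn_sub
      (symbolOp (fun r => Real.cos (r * t)) (𝓕 φ₁)) (symbolOp (fun r => Real.sin (r * t)) A)]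
    with ξ h1 h2 h0 h3 h4
  rw [h4, Pi.sub_apply, h2, h3, h1, mul_comm t]
  simp only [radial]
  rw [Complex.ofReal_mul (-(2 * Real.pi * ‖ξ‖)), Complex.ofReal_neg]
  generalize ((2 * Real.pi * ‖ξ‖ : ℝ) : ℂ) = ρ at h0
  field_simp
  ring

end wave

/-! ### Real-valuedness and Hermitian symmetry of the Fourier transform -/

/-- Hermitian symmetry of a function on frequency space. -/
def IsHermitian {d : ℕ} (g : Space d → ℂ) : Prop :=
  ∀ᵐ ξ, g (-ξ) = starRingEnd ℂ (g ξ)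

theorem star_fourierInv_of_real {d : ℕ} {φ : Space d → ℂ} (hφ : ∀ x, (φ x).im = 0) (ξ : Space d) :
    starRingEnd ℂ (𝓕⁻ φ ξ) = 𝓕⁻ φ (-ξ) := by
  rw [Real.fourierInv_eq', Real.fourierInv_eq', ← integral_conj]
  refine integral_congr_ae (Eventually.of_forall fun v => ?_)
  simp only [smul_eq_mul, map_mul, ← Complex.exp_conj, Complex.conj_ofReal, Complex.conj_I,
    inner_neg_right, Complex.conj_eq_iff_im.2 (hφ v)]
  congr 2
  push_cast
  ring

theorem star_fourier_comp_neg_of_real {d : ℕ} {φ : Space d → ℂ} (hφ : ∀ x, (φ x).im = 0)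
    (ξ : Space d) : starRingEnd ℂ (𝓕 (fun x => φ (-x)) ξ) = 𝓕 φ ξ := by
  rw [Real.fourier_eq', Real.fourier_eq', ← integral_conj,
    ← integral_neg_eq_self (fun v => Complex.exp (↑(-2 * Real.pi * inner ℝ v ξ) * Complex.I) • φ v)]
  refine integral_congr_ae (Eventually.of_forall fun v => ?_)
  simp only [smul_eq_mul, map_mul, ← Complex.exp_conj, Complex.conj_ofReal, Complex.conj_I,
    inner_neg_left, Complex.conj_eq_iff_im.2 (hφ _)]
  congr 2
  push_cast
  ring

/-- Pair `g` with the inverse transform of a real test function: both are Hermitian, so conjugating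
the integral amounts to `ξ ↦ -ξ`. -/
theorem IsHermitian.isRealDist {d : ℕ} {T : 𝓢'(Space d, ℂ)} {g : Space d → ℂ}
    (hT : HasFourierFun T g) (hg : IsHermitian g) : IsRealDist T := by
  intro φ hφ
  have h1 : T φ = ∫ ξ, (𝓕⁻ φ) ξ * g ξ := by
    rw [← (hT.2 (𝓕⁻ φ)).2, TemperedDistribution.fourier_apply,
      FourierTransform.fourier_fourierInv_eq]
  have h2 : starRingEnd ℂ (T φ) = T φ := by
    rw [h1, ← integral_conj]
    refine Eq.trans (integral_congr_ae ?_) (integral_neg_eq_self _ volume)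
    filter_upwards [hg] with ξ hξ
    rw [map_mul, ← hξ, SchwartzMap.fourierInv_coe, star_fourierInv_of_real hφ]
  exact Complex.conj_eq_iff_im.1 h2

theorem toSchwartzMap_real {d : ℕ} {φ : Space d → ℝ}
    (hφ : ContDiff ℝ ((⊤ : ℕ∞) : WithTop ℕ∞) φ) (hφc : HasCompactSupport φ) :
    ∃ ψ : 𝓢(Space d, ℂ), ∀ x, ψ x = (φ x : ℂ) := by
  have hc : HasCompactSupport (Complex.ofRealCLM ∘ φ) := hφc.comp_left rfl
  have hs : ContDiff ℝ ((⊤ : ℕ∞) : WithTop ℕ∞) (Complex.ofRealCLM ∘ φ) :=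
    Complex.ofRealCLM.contDiff.comp hφ
  exact ⟨hc.toSchwartzMap hs, fun x => rfl⟩

theorem IsRealDist.isRealFun {d : ℕ} {f : LTwo d} (hf : IsRealDist (f : 𝓢'(Space d, ℂ))) :
    IsRealFun f := by
  have hloc := (isDistFun_Lp f).1
  refine ae_eq_zero_of_integral_contDiff_smul_eq_zero (f := fun x => (f x).im) ?_ ?_
  · intro x
    obtain ⟨s, hs, hi⟩ := hloc x
    exact ⟨s, hs, hi.im⟩
  · intro φ hφ hφc
    obtain ⟨ψ, hψ⟩ := toSchwartzMap_real hφ hφc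
    have h1 := hf ψ fun x => by rw [hψ, Complex.ofReal_im]
    obtain ⟨h2, h3⟩ := (isDistFun_Lp f).2 ψ
    rw [h3] at h1
    have h4 := integral_im h2
    simp only [RCLike.im_eq_complex_im] at h4
    rw [h1] at h4
    rw [← h4]
    refine integral_congr_ae (Eventually.of_forall fun x => ?_)
    simp only [hψ, Complex.im_ofReal_mul, smul_eq_mul]

/-- Tested against real smooth compactly supported functions: the Fourier transform is moved onto
the test function, where the symmetry is explicit. -/
theorem IsRealFun.isHermitian {d : ℕ} {f : LTwo d} (hf : IsRealFun f) :
    IsHermitian (⇑(𝓕 f : LTwo d)) := by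
  have hT := hasFourierFun_Lp f
  set g : Space d → ℂ := ⇑(𝓕 f : LTwo d) with hg
  have hmp : MeasurePreserving (fun ξ : Space d => -ξ) volume volume :=
    Measure.measurePreserving_neg _
  have hgneg : MemLp (fun ξ => starRingEnd ℂ (g (-ξ))) 2 volume :=
    ((Lp.memLp (𝓕 f : LTwo d)).comp_measurePreserving hmp).star
  have key : (fun ξ => starRingEnd ℂ (g (-ξ))) =ᵐ[volume] g := by
    refine ae_eq_of_integral_contDiff_smul_eq (hgneg.locallyIntegrable (by norm_num)) hT.1
      fun φ hφ hφc => ?_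
    obtain ⟨ψ, hψ⟩ := toSchwartzMap_real hφ hφc
    obtain ⟨ψ', hψ'⟩ := toSchwartzMap_real (φ := fun x => φ (-x)) (hφ.comp contDiff_neg)
      (hφc.comp_homeomorph (Homeomorph.neg _))
    have hψ0 : ∀ x, (ψ x).im = 0 := fun x => by rw [hψ, Complex.ofReal_im]
    have e1 : ∫ ξ, φ ξ • starRingEnd ℂ (g (-ξ)) = starRingEnd ℂ (∫ ξ, ψ' ξ * g ξ) := by
      rw [← integral_conj, ← integral_neg_eq_self (fun ξ => φ ξ • starRingEnd ℂ (g (-ξ)))]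
      refine integral_congr_ae (Eventually.of_forall fun ξ => ?_)
      simp [hψ']
    have e2 : ∫ ξ, φ ξ • g ξ = ∫ ξ, ψ ξ * g ξ := by
      refine integral_congr_ae (Eventually.of_forall fun ξ => ?_)
      simp [hψ]
    rw [e1, e2, ← (hT.2 ψ').2, ← (hT.2 ψ).2, TemperedDistribution.fourier_apply,
      TemperedDistribution.fourier_apply, ((isDistFun_Lp f).2 _).2, ((isDistFun_Lp f).2 _).2,
      ← integral_conj]
    refine integral_congr_ae ?_
    filter_upwards [hf] with x hx
    have e3 : (ψ' : Space d → ℂ) = fun x => ψ (-x) := by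
      ext x
      rw [hψ', hψ]
    rw [map_mul, Complex.conj_eq_iff_im.2 hx, SchwartzMap.fourier_coe, SchwartzMap.fourier_coe, e3,
      star_fourier_comp_neg_of_real hψ0]
  filter_upwards [key] with ξ hξ
  rw [← hξ, Complex.conj_conj]

namespace IsHermitian

variable {d : ℕ}

theorem congr {f g : Space d → ℂ} (hf : IsHermitian f) (h : f =ᵐ[volume] g) : IsHermitian g := by
  have hneg := (Measure.measurePreserving_neg (volume : Measure (Space d))).quasiMeasurePreserving.ae h
  filter_upwards [hf, h, hneg] with ξ h1 h2 h3
  rw [← h2, ← h3, h1]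

theorem symbolOp {κ : ℝ → ℝ} (hκ : IsSymbol κ) {f : LTwo d} (hf : IsHermitian f) :
    IsHermitian (symbolOp κ f) := by
  refine congr (f := fun ξ => radial κ ξ * f ξ) ?_ (coeFn_symbolOp hκ f).symm
  filter_upwards [hf] with ξ h
  simp [radial, h]

theorem add {f g : LTwo d} (hf : IsHermitian f) (hg : IsHermitian g) :
    IsHermitian (⇑(f + g : LTwo d)) := by
  refine congr (f := fun ξ => f ξ + g ξ) ?_ (Lp.coeFn_add f g).symm
  filter_upwards [hf, hg] with ξ h1 h2
  rw [h1, h2, map_add]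

theorem smul {f : LTwo d} (hf : IsHermitian f) (c : ℝ) : IsHermitian (⇑(c • f : LTwo d)) := by
  have := hf.symbolOp (IsSymbol.const c)
  rwa [symbolOp_const] at this

theorem sub {f g : LTwo d} (hf : IsHermitian f) (hg : IsHermitian g) :
    IsHermitian (⇑(f - g : LTwo d)) := by
  have := hf.add (hg.smul (-1))
  rwa [neg_smul, one_smul, ← sub_eq_add_neg] at this

/-- A subsequence converges almost everywhere at both `ξ` and `-ξ`, as reflection preserves null
sets. -/
theorem of_tendsto {ι : Type*} {l : Filter ι} [l.NeBot] [l.IsCountablyGenerated] {f : ι → LTwo d}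
    {g : LTwo d} (h : Tendsto f l (𝓝 g)) (hf : ∀ᶠ i in l, IsHermitian (f i)) :
    IsHermitian g := by
  obtain ⟨v, hv⟩ := exists_seq_tendsto l
  obtain ⟨N, hN⟩ := eventually_atTop.1 (hv.eventually hf)
  obtain ⟨ns, hns, hae⟩ := (tendstoInMeasure_of_tendsto_Lp (h.comp hv)).exists_seq_tendsto_ae
  have hneg := (Measure.measurePreserving_neg
    (volume : Measure (Space d))).quasiMeasurePreserving.ae hae
  have hall : ∀ᵐ ξ : Space d, ∀ n : ℕ, N ≤ n →
      f (v n) (-ξ) = starRingEnd ℂ (f (v n) ξ) :=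
    ae_all_iff.2 fun n => by
      by_cases hn : N ≤ n
      · filter_upwards [hN n hn] with ξ h _
        exact h
      · exact Eventually.of_forall fun ξ h => absurd h hn
  filter_upwards [hae, hneg, hall] with ξ h1 h2 h3
  refine tendsto_nhds_unique h2 ?_
  refine ((Complex.continuous_conj.tendsto _).comp h1).congr' ?_
  filter_upwards [eventually_ge_atTop N] with n hn
  exact (h3 (ns n) (hn.trans (hns.id_le n))).symm

end IsHermitian

/-! ### Asymptotic profiles of Duhamel solutions -/

/-- The unbounded factor `r` is absorbed into `P`, which is in `L²` because the solution is in `H¹`;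
only the cutoff stays outside. -/
theorem symbolOp_mul_id_mul {d : ℕ} {χ c : ℝ → ℝ} (hχ : IsSymbol χ)
    (hrχ : IsSymbol fun r => χ r * r) (hc : IsSymbol c) {v P : LTwo d}
    (hP : P =ᵐ[volume] fun ξ => radial id ξ * v ξ) :
    symbolOp (fun r => χ r * r * c r) v = symbolOp χ (symbolOp c P) := by
  rw [← symbolOp_mul hχ hc]
  apply Lp.ext
  filter_upwards [coeFn_symbolOp (hrχ.mul hc) v, coeFn_symbolOp (hχ.mul hc) P, hP] with ξ h1 h2 h3
  rw [h1, h2, h3]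
  simp only [radial, id]
  push_cast
  ring

/-- At each frequency the passage to profiles is a rotation by the angle `rt`; this inverts it. -/
theorem symbolOp_rotation {d : ℕ} (t : ℝ) (P V : LTwo d) :
    symbolOp (fun r => Real.cos (r * t)) (symbolOp (fun r => Real.cos (r * t)) P
        + symbolOp (fun r => -Real.sin (r * t)) V)
      + symbolOp (fun r => Real.sin (r * t)) (symbolOp (fun r => Real.sin (r * t)) P
        + symbolOp (fun r => Real.cos (r * t)) V) = P ∧
    symbolOp (fun r => Real.cos (r * t)) (symbolOp (fun r => Real.sin (r * t)) P
        + symbolOp (fun r => Real.cos (r * t)) V)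
      - symbolOp (fun r => Real.sin (r * t)) (symbolOp (fun r => Real.cos (r * t)) P
        + symbolOp (fun r => -Real.sin (r * t)) V) = V := by
  have hc := IsSymbol.cos t
  have hs := IsSymbol.sin t
  have hn : IsSymbol fun r => -Real.sin (r * t) := by
    simpa using (IsSymbol.const 0).sub hs
  have e1 : ∀ f : LTwo d, f = symbolOp (fun _ => 1) f := fun f => by rw [symbolOp_const, one_smul]
  have e0 : ∀ f : LTwo d, symbolOp (fun _ => 0) f = 0 := fun f => by rw [symbolOp_const, zero_smul]
  have p1 : (fun r => Real.cos (r * t) * Real.cos (r * t) + Real.sin (r * t) * Real.sin (r * t))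
      = fun _ => 1 := by
    ext r
    rw [← sq, ← sq, Real.cos_sq_add_sin_sq]
  have p2 : (fun r => Real.cos (r * t) * -Real.sin (r * t) + Real.sin (r * t) * Real.cos (r * t))
      = fun _ => 0 := by
    ext r
    ring
  have p3 : (fun r => Real.cos (r * t) * Real.sin (r * t) - Real.sin (r * t) * Real.cos (r * t))
      = fun _ => 0 := by
    ext r
    ring
  have p4 : (fun r => Real.cos (r * t) * Real.cos (r * t) - Real.sin (r * t) * -Real.sin (r * t))
      = fun _ => 1 := by
    rw [← p1]
    ext r
    ring
  simp only [map_add, ← symbolOp_mul hc hc, ← symbolOp_mul hc hs, ← symbolOp_mul hc hn,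
    ← symbolOp_mul hs hc, ← symbolOp_mul hs hs, ← symbolOp_mul hs hn]
  constructor
  · rw [add_add_add_comm, ← symbolOp_add (hc.mul hc) (hs.mul hs),
      ← symbolOp_add (hc.mul hn) (hs.mul hc), p1, p2, ← e1, e0, add_zero]
  · rw [add_sub_add_comm, ← symbolOp_sub (hc.mul hs) (hs.mul hc),
      ← symbolOp_sub (hc.mul hc) (hs.mul hn), p3, p4, ← e1, e0, zero_add]

namespace IsDuhamel

variable {d : ℕ} {μ E₀ C : ℝ} {e m : ℝ → ℝ} {Y Y' : ℝ → ℝ → ℝ} {Z Z' : ℝ → ℝ → ℝ → ℝ}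
  {N : ℝ → LTwo d} {c₁ c₂ : ℝ → ℝ → ℝ} {g₀ g₁ : LTwo d} {P : ℝ → LTwo d} {b : ℝ → ℝ}

theorem exists_profile_limit (h : IsDuhamel μ E₀ e m Y Y' Z Z' N) (hC : 0 ≤ C)
    (hc : IsProfile μ C c₁ c₂)
    (hP : ∀ t, 0 ≤ t → P t =ᵐ[volume] fun ξ => radial id ξ * duhamelSol Y Z g₀ g₁ N t ξ)
    (hb : ∀ t t', 0 ≤ t → t ≤ t' →
      μ * C * profileRate μ t * past μ E₀ e m g₀ g₁ t + ∫ s in Ioc t t', m s ≤ b t)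
    (hb0 : Tendsto b atTop (𝓝 0)) :
    ∃ L : LTwo d,
      Tendsto (fun t => symbolOp (c₁ t) (P t) + symbolOp (c₂ t) (duhamelSol Y' Z' g₀ g₁ N t))
        atTop (𝓝 L) ∧
      ∀ t, 0 ≤ t →
        ‖symbolOp (c₁ t) (P t) + symbolOp (c₂ t) (duhamelSol Y' Z' g₀ g₁ N t) - L‖ ≤ b t := by
  refine exists_limit_of_le hb0 fun t t' ht htt' => norm_le_of_cutoff fun n => ?_
  have hχ := isSymbol_cutoff n
  have hrχ := isSymbol_cutoff_mul n
  refine le_trans (le_of_eq ?_) ((h.norm_profile_cutoff_sub_le hC hc g₀ g₁ hχ hrχ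
    (abs_cutoff_le n) ht htt').trans (hb t t' ht htt'))
  rw [symbolOp_mul_id_mul hχ hrχ (hc.symbol_fst t) (hP t ht),
    symbolOp_mul_id_mul hχ hrχ (hc.symbol_fst t') (hP t' (ht.trans htt')),
    symbolOp_mul hχ (hc.symbol_snd t), symbolOp_mul hχ (hc.symbol_snd t')]
  simp only [map_add, map_sub]

/-- The pair `(|ξ| v, v')` converges to a free wave. -/
theorem exists_free_wave (h : IsDuhamel μ E₀ e m Y Y' Z Z' N) (hC : 0 ≤ C)
    (hcos : IsProfile μ C (fun t r => Real.cos (r * t)) (fun t r => -Real.sin (r * t)))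
    (hsin : IsProfile μ C (fun t r => Real.sin (r * t)) (fun t r => Real.cos (r * t)))
    (hP : ∀ t, 0 ≤ t → P t =ᵐ[volume] fun ξ => radial id ξ * duhamelSol Y Z g₀ g₁ N t ξ)
    (hb : ∀ t t', 0 ≤ t → t ≤ t' →
      μ * C * profileRate μ t * past μ E₀ e m g₀ g₁ t + ∫ s in Ioc t t', m s ≤ b t)
    (hb0 : Tendsto b atTop (𝓝 0)) :
    ∃ A B : LTwo d,
      ((∀ t, 0 < t → IsHermitian (P t) ∧ IsHermitian (duhamelSol Y' Z' g₀ g₁ N t)) →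
        IsHermitian A ∧ IsHermitian B) ∧
      ∀ t, 0 ≤ t →
        ‖P t - (symbolOp (fun r => Real.cos (r * t)) A + symbolOp (fun r => Real.sin (r * t)) B)‖
          ≤ 2 * b t ∧
        ‖duhamelSol Y' Z' g₀ g₁ N t
          - (symbolOp (fun r => Real.cos (r * t)) B - symbolOp (fun r => Real.sin (r * t)) A)‖
          ≤ 2 * b t := by
  obtain ⟨A, hA, hAb⟩ := h.exists_profile_limit hC hcos hP hb hb0
  obtain ⟨B, hB, hBb⟩ := h.exists_profile_limit hC hsin hP hb hb0
  refine ⟨A, B, fun hherm => ⟨.of_tendsto hA ?_, .of_tendsto hB ?_⟩, fun t ht => ?_⟩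
  · filter_upwards [eventually_gt_atTop 0] with t ht
    exact ((hherm t ht).1.symbolOp (hcos.symbol_fst t)).add
      ((hherm t ht).2.symbolOp (hcos.symbol_snd t))
  · filter_upwards [eventually_gt_atTop 0] with t ht
    exact ((hherm t ht).1.symbolOp (hsin.symbol_fst t)).add
      ((hherm t ht).2.symbolOp (hsin.symbol_snd t))
  · have hc1 : ∀ f : LTwo d, ‖symbolOp (fun r => Real.cos (r * t)) f‖ ≤ ‖f‖ := fun f => by
      simpa using norm_symbolOp_le (.cos t) (fun r => Real.abs_cos_le_one (r * t)) f
    have hs1 : ∀ f : LTwo d, ‖symbolOp (fun r => Real.sin (r * t)) f‖ ≤ ‖f‖ := fun f => by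
      simpa using norm_symbolOp_le (.sin t) (fun r => Real.abs_sin_le_one (r * t)) f
    have ha := hAb t ht
    have hb' := hBb t ht
    obtain ⟨r1, r2⟩ := symbolOp_rotation t (P t) (duhamelSol Y' Z' g₀ g₁ N t)
    constructor
    -- Rotating back mixes both profile errors; each is at most `b t`, hence `2 * b t`.
    · nth_rw 1 [← r1]
      rw [add_sub_add_comm, ← map_sub, ← map_sub]
      refine (norm_add_le _ _).trans ?_
      linarith [(hc1 _).trans ha, (hs1 _).trans hb']
    · nth_rw 1 [← r2]
      rw [sub_sub_sub_comm, ← map_sub, ← map_sub]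
      refine (norm_sub_le _ _).trans ?_
      linarith [(hs1 _).trans ha, (hc1 _).trans hb']

end IsDuhamel

/-! ### Decay rates -/

/-- The combined rate of the mass term and of a source decaying like `(1 + t)^(-α)`. -/
noncomputable def decayRate (μ α t : ℝ) : ℝ :=
  (1 + t) ^ (max (growthExp μ - 1) (-α)) * logFactor μ t

theorem decayRate_nonneg (μ α : ℝ) {t : ℝ} (ht : 0 ≤ t) : 0 ≤ decayRate μ α t :=
  mul_nonneg (by positivity) (zero_le_one.trans (one_le_logFactor μ ht))

theorem massRate_eq (d : ℕ) (μ₁ μ : ℝ) {t : ℝ} (ht : 0 ≤ t) :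
    massRate d μ₁ μ t
      = (1 + t) ^ (-(μ₁ / 2)) * decayRate μ (2 * μ₁ / ((d : ℝ) - 2)) t := by
  have h1 : 0 < 1 + t := by linarith
  have e : ∀ x, (1 + t) ^ (-(μ₁ / 2)) * (1 + t) ^ x = (1 + t) ^ (x - μ₁ / 2) := fun x => by
    rw [← Real.rpow_add h1]
    ring_nf
  unfold massRate decayRate logFactor
  rw [← mul_assoc, e]
  split_ifs with h
  · rw [growthExp_of_le h.le, h]
    norm_num
  · rw [mul_one, growthExp]
    ring_nf

theorem tendsto_decayRate {μ α : ℝ} (hμ : 0 < μ) (hα : 0 < α) :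
    Tendsto (decayRate μ α) atTop (𝓝 0) := by
  set c := max (growthExp μ - 1) (-α) with hc
  have hc0 : 0 < -c := by
    have : c < 0 := max_lt (by linarith [growthExp_lt_one hμ]) (by linarith)
    linarith
  have h1 : Tendsto (fun t : ℝ => 1 + t) atTop atTop := tendsto_atTop_add_const_left _ _ tendsto_id
  have h2 : Tendsto (fun x : ℝ => x ^ c) atTop (𝓝 0) := by
    have := tendsto_rpow_neg_atTop hc0
    rwa [neg_neg] at this
  have h3 : Tendsto (fun x : ℝ => x ^ c * (1 + Real.log x)) atTop (𝓝 0) := by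
    have h4 : Tendsto (fun x : ℝ => Real.log x / x ^ (-c)) atTop (𝓝 0) :=
      (isLittleO_log_rpow_atTop hc0).tendsto_div_nhds_zero
    have h5 := h2.add h4
    rw [add_zero] at h5
    refine h5.congr' ?_
    filter_upwards [eventually_gt_atTop 0] with x hx
    rw [Real.rpow_neg hx.le, div_inv_eq_mul]
    ring
  unfold decayRate logFactor
  split_ifs
  · exact h3.comp h1
  · simp only [mul_one]
    exact h2.comp h1

/-- The power of `1 + s` is at most 1 or at most the same power of `1 + t`, according to the sign of
its exponent. The two cases give the two entries of the maximum in `decayRate`. -/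
theorem profileRate_mul_le {μ α s t : ℝ} (hs : 0 ≤ s) (hst : s ≤ t) :
    profileRate μ t * (1 + s) ^ (1 - growthExp μ - α) ≤ decayRate μ α t := by
  have ht := hs.trans hst
  have h1 : 0 < 1 + t := by linarith
  have hl : 0 ≤ logFactor μ t := zero_le_one.trans (one_le_logFactor μ ht)
  unfold profileRate decayRate
  rw [mul_right_comm]
  refine mul_le_mul_of_nonneg_right ?_ hl
  rcases le_total (1 - growthExp μ - α) 0 with h | h
  · calc (1 + t) ^ (growthExp μ - 1) * (1 + s) ^ (1 - growthExp μ - α)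
        ≤ (1 + t) ^ (growthExp μ - 1) * 1 :=
          mul_le_mul_of_nonneg_left (Real.rpow_le_one_of_one_le_of_nonpos (by linarith) h)
            (by positivity)
      _ ≤ _ := by
          rw [mul_one]
          exact Real.rpow_le_rpow_of_exponent_le (by linarith) (le_max_left _ _)
  · calc (1 + t) ^ (growthExp μ - 1) * (1 + s) ^ (1 - growthExp μ - α)
        ≤ (1 + t) ^ (growthExp μ - 1) * (1 + t) ^ (1 - growthExp μ - α) :=
          mul_le_mul_of_nonneg_left (Real.rpow_le_rpow (by linarith) (by linarith) h)
            (by positivity)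
      _ = (1 + t) ^ (-α) := by
          rw [← Real.rpow_add h1]
          ring_nf
      _ ≤ _ := Real.rpow_le_rpow_of_exponent_le (by linarith) (le_max_right _ _)

section Source

variable {F : ℝ → ℝ} {α : ℝ}

theorem integrableOn_rpow_mul (hF : IntegrableOn F (Ici 0)) (hα : 0 ≤ α) :
    IntegrableOn (fun s => (1 + s) ^ (-α) * F s) (Ici 0) := by
  refine Integrable.bdd_mul (c := 1) hF ?_ ?_
  · refine ContinuousOn.aestronglyMeasurable (fun s hs => ?_) measurableSet_Ici
    exact (hasDerivAt_one_add_rpow hs).continuousAt.continuousWithinAt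
  · refine (ae_restrict_mem measurableSet_Ici).mono fun s hs => ?_
    have hs : (0:ℝ) ≤ s := hs
    rw [Real.norm_of_nonneg (by positivity)]
    exact Real.rpow_le_one_of_one_le_of_nonpos (by linarith) (by linarith)

theorem setIntegral_rpow_mul_le (hF : IntegrableOn F (Ici 0)) (hF0 : ∀ s, 0 ≤ F s) (hα : 0 ≤ α)
    {t t' : ℝ} (ht : 0 ≤ t) :
    ∫ s in Ioc t t', (1 + s) ^ (-α) * F s ≤ (1 + t) ^ (-α) * ∫ s in Ici t, F s := by
  have hsub : Ioc t t' ⊆ Ici 0 := fun s hs => (ht.trans_lt hs.1).le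
  calc ∫ s in Ioc t t', (1 + s) ^ (-α) * F s ≤ ∫ s in Ioc t t', (1 + t) ^ (-α) * F s := by
        refine setIntegral_mono_on ((integrableOn_rpow_mul hF hα).mono_set hsub)
          ((hF.mono_set hsub).const_mul _) measurableSet_Ioc fun s hs => ?_
        exact mul_le_mul_of_nonneg_right (Real.rpow_le_rpow_of_nonpos (by linarith)
          (by linarith [hs.1]) (by linarith)) (hF0 s)
    _ = (1 + t) ^ (-α) * ∫ s in Ioc t t', F s := integral_const_mul _ _
    _ ≤ _ := by
        refine mul_le_mul_of_nonneg_left ?_ (by positivity)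
        exact setIntegral_mono_set (hF.mono_set (Ici_subset_Ici.2 ht))
          (Eventually.of_forall hF0) (Eventually.of_forall fun s hs => le_of_lt hs.1)

/-- The rate at time `t` absorbs the weight of every past source, leaving the total mass of `F`. -/
theorem profileRate_mul_past_le {d : ℕ} {μ E₀ : ℝ} {e : ℝ → ℝ} {g₀ g₁ : LTwo d}
    (hE₀ : 0 ≤ E₀)
    (he : 0 ≤ e 0) (hF : IntegrableOn F (Ici 0)) (hF0 : ∀ s, 0 ≤ F s) {t : ℝ} (ht : 0 ≤ t) :
    profileRate μ t * IsDuhamel.past μ E₀ e (fun s => (1 + s) ^ (-α) * F s) g₀ g₁ t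
      ≤ decayRate μ α t * (E₀ * ‖g₀‖ + e 0 * ‖g₁‖ + ∫ s in Ici 0, F s) := by
  have hsub : Ioc 0 t ⊆ Ici 0 := fun s hs => hs.1.le
  have hdec := decayRate_nonneg μ α ht
  have h0 : profileRate μ t ≤ decayRate μ α t := by
    unfold profileRate decayRate
    refine mul_le_mul_of_nonneg_right ?_ (zero_le_one.trans (one_le_logFactor μ ht))
    exact Real.rpow_le_rpow_of_exponent_le (by linarith) (le_max_left _ _)
  have hle : ∀ s ∈ Ioc 0 t, profileRate μ t * ((1 + s) ^ (1 - growthExp μ) * ((1 + s) ^ (-α) * F s))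
      ≤ decayRate μ α t * F s := fun s hs => by
    have h1 : 0 < 1 + s := by linarith [hs.1]
    rw [← mul_assoc, ← mul_assoc, mul_assoc (profileRate μ t), ← Real.rpow_add h1,
      ← sub_eq_add_neg]
    exact mul_le_mul_of_nonneg_right (profileRate_mul_le hs.1.le hs.2) (hF0 s)
  have hint : profileRate μ t * ∫ s in Ioc 0 t, (1 + s) ^ (1 - growthExp μ) * ((1 + s) ^ (-α) * F s)
      ≤ decayRate μ α t * ∫ s in Ici 0, F s := by
    rw [← integral_const_mul]
    refine (integral_mono_of_nonneg ?_ ((hF.mono_set hsub).const_mul (decayRate μ α t)) ?_).trans ?_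
    · refine (ae_restrict_mem measurableSet_Ioc).mono fun s hs => ?_
      have h1 : 0 < 1 + s := by linarith [hs.1]
      have h2 := profileRate_nonneg μ ht
      have h3 := hF0 s
      change 0 ≤ _
      positivity
    · exact (ae_restrict_mem measurableSet_Ioc).mono hle
    · rw [integral_const_mul]
      exact mul_le_mul_of_nonneg_left (setIntegral_mono_set hF (Eventually.of_forall hF0)
        (Eventually.of_forall hsub)) hdec
  unfold IsDuhamel.past
  rw [mul_add, mul_add _ (E₀ * ‖g₀‖ + e 0 * ‖g₁‖)]
  exact add_le_add (mul_le_mul_of_nonneg_right h0 (by positivity)) hint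

end Source

/-! ### Global solutions on the Fourier side -/

theorem memLp_bracket_mul {d : ℕ} {f : LTwo d} (hf : hOneNorm f < ∞) :
    MemLp (fun ξ => radial bracket ξ * (𝓕 f : LTwo d) ξ) 2 volume :=
  ⟨(continuous_radial continuous_bracket).aestronglyMeasurable.mul (Lp.aestronglyMeasurable _), hf⟩

theorem exists_bracket_mul {d : ℕ} {f : LTwo d} (hf : hOneNorm f < ∞) : ∃ g : LTwo d,
    g =ᵐ[volume] (fun ξ => radial bracket ξ * (𝓕 f : LTwo d) ξ) ∧ ‖g‖ = (hOneNorm f).toReal :=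
  ⟨_, (memLp_bracket_mul hf).coeFn_toLp, Lp.norm_toLp _ _⟩

theorem exists_id_mul {d : ℕ} {f : LTwo d} (hf : hOneNorm f < ∞) : ∃ P : LTwo d,
    P =ᵐ[volume] (fun ξ => radial id ξ * (𝓕 f : LTwo d) ξ) := by
  refine ⟨_, MemLp.coeFn_toLp ((memLp_bracket_mul hf).of_le
    ((continuous_radial continuous_id).aestronglyMeasurable.mul (Lp.aestronglyMeasurable _))
    (Eventually.of_forall fun ξ => ?_))⟩
  rw [Pi.mul_apply, norm_mul, norm_mul, norm_radial, norm_radial]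
  refine mul_le_mul_of_nonneg_right (abs_le_abs_of_nonneg (by simp only [id]; positivity) ?_)
    (norm_nonneg _)
  exact Real.le_sqrt_of_sq_le (by simp only [id]; linarith)

noncomputable def initialMode (μ₁ μ₂ t r : ℝ) : ℝ := (bracket r)⁻¹ * liouvilleMode μ₁ μ₂ r 0 1 0 t

noncomputable def initialModeDeriv (μ₁ μ₂ t r : ℝ) : ℝ :=
  (bracket r)⁻¹ * liouvilleModeDeriv μ₁ μ₂ r 0 1 0 t

noncomputable def kernelMode (μ₁ μ₂ s t r : ℝ) : ℝ := liouvilleMode μ₁ μ₂ r s 0 1 t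

noncomputable def kernelModeDeriv (μ₁ μ₂ s t r : ℝ) : ℝ := liouvilleModeDeriv μ₁ μ₂ r s 0 1 t

section Solution

variable {μ₁ μ₂ : ℝ}

theorem isModeFamily_initialMode (hμ₁ : 0 ≤ μ₁) (hμ : 0 ≤ massParam μ₁ μ₂) :
    IsModeFamily (massParam μ₁ μ₂) 0 (1 + μ₁ / 2 + massParam μ₁ μ₂)
      (initialMode μ₁ μ₂) (initialModeDeriv μ₁ μ₂) := isModeFamily_initial hμ₁ hμ

theorem isModeFamily_kernelMode (hμ : 0 ≤ massParam μ₁ μ₂) {s : ℝ} (hs : 0 ≤ s) :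
    IsModeFamily (massParam μ₁ μ₂) s ((1 + s) ^ (μ₁ / 2))
      (kernelMode μ₁ μ₂ s) (kernelModeDeriv μ₁ μ₂ s) := isModeFamily_kernel hμ hs

theorem fourier_multiplier {d : ℕ} {κ κ' : ℝ → ℝ} {t : ℝ} (ht : 0 ≤ t) (hκ' : IsSymbol κ')
    (h : ∀ r, κ' r = (1 + t) ^ (μ₁ / 2) * κ r) (f : LTwo d) :
    (1 + t) ^ (μ₁ / 2) • (𝓕 (multiplier (fun ξ => ((κ (2 * Real.pi * ‖ξ‖) : ℝ) : ℂ)) f) : LTwo d)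
      = symbolOp κ' (𝓕 f) := by
  have h0 : (1 + t) ^ (μ₁ / 2) ≠ 0 := by positivity
  have hκe : κ = fun r => ((1 + t) ^ (μ₁ / 2))⁻¹ * κ' r := by
    ext r
    rw [h, inv_mul_cancel_left₀ h0]
  have hκ : IsSymbol κ := by
    rw [hκe]
    exact (IsSymbol.const _).mul hκ'
  rw [multiplier_eq hκ, FourierTransform.fourier_fourierInv_eq, ← symbolOp_const,
    ← symbolOp_mul (.const _) hκ, ← funext h]

theorem fourier_dampedPropagatorOne {d : ℕ} (hμ : 0 ≤ massParam μ₁ μ₂) {s t : ℝ} (hs : 0 ≤ s)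
    (hst : s ≤ t) (f : LTwo d) :
    (1 + t) ^ (μ₁ / 2) • (𝓕 (dampedPropagatorOne μ₁ μ₂ t s f) : LTwo d)
      = symbolOp (kernelMode μ₁ μ₂ s t) (𝓕 f) :=
  fourier_multiplier (κ := fun r => dampedMode μ₁ μ₂ r s 0 1 t) (hs.trans hst)
    ((isModeFamily_kernelMode hμ hs).isSymbol hμ hst) (fun _ => rfl) f

/-- Use `bracket r ≤ 1 + |r|`: the energy bounds `r z` and the linear growth bounds `z`. -/
theorem isSymbol_bracket_mul_initialMode (hμ₁ : 0 ≤ μ₁) (hμ : 0 ≤ massParam μ₁ μ₂) {t : ℝ}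
    (ht : 0 ≤ t) : IsSymbol fun r => bracket r * initialMode μ₁ μ₂ t r := by
  have h := isModeFamily_initialMode hμ₁ hμ
  set E := 1 + μ₁ / 2 + massParam μ₁ μ₂ with hE
  refine .of_le (C := E * (1 + t) + E) (continuous_bracket.mul (h.cont t ht).1) fun r => ?_
  have h1 : bracket r ≤ 1 + |r| := Real.sqrt_le_iff.2
    ⟨by positivity, by nlinarith [sq_abs r, abs_nonneg r]⟩
  have h2 : |r| * |initialMode μ₁ μ₂ t r| ≤ E := by
    rw [← abs_mul]
    have h3 := h.energy_le hμ ht r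
    exact abs_le_of_sq_le_sq (by linarith [sq_nonneg (initialModeDeriv μ₁ μ₂ t r)]) h.nonneg_energy
  have h3 := h.abs_le hμ ht r
  rw [abs_mul, abs_of_pos (bracket_pos r)]
  nlinarith [abs_nonneg (initialMode μ₁ μ₂ t r)]

theorem fourier_dampedPropagatorZero {d : ℕ} (hμ₁ : 0 ≤ μ₁) (hμ : 0 ≤ massParam μ₁ μ₂) {t : ℝ}
    (ht : 0 ≤ t) {f g : LTwo d}
    (hg : g =ᵐ[volume] fun ξ => radial bracket ξ * (𝓕 f : LTwo d) ξ) :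
    (1 + t) ^ (μ₁ / 2) • (𝓕 (dampedPropagatorZero μ₁ μ₂ t 0 f) : LTwo d)
      = symbolOp (initialMode μ₁ μ₂ t) g := by
  have h := isSymbol_bracket_mul_initialMode hμ₁ hμ ht
  have h' := (isModeFamily_initialMode hμ₁ hμ).isSymbol hμ ht
  refine (fourier_multiplier (κ := fun r => dampedMode μ₁ μ₂ r 0 1 0 t) ht h (fun r => ?_) f).trans ?_
  · rw [initialMode, mul_inv_cancel_left₀ (bracket_pos r).ne']
    rfl
  · apply Lp.ext
    filter_upwards [coeFn_symbolOp h (𝓕 f : LTwo d), coeFn_symbolOp h' g, hg] with ξ h1 h2 h3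
    rw [h1, h2, h3]
    simp only [radial]
    push_cast
    ring

/-- The Fourier transform on `L²` as a real-linear map. -/
noncomputable def fourierOp (d : ℕ) : LTwo d →L[ℝ] LTwo d :=
  (FourierTransform.fourierCLM ℂ (LTwo d) : LTwo d →L[ℂ] LTwo d).restrictScalars ℝ

noncomputable def fourierInvOp (d : ℕ) : LTwo d →L[ℝ] LTwo d :=
  (FourierTransform.fourierInvCLM ℂ (LTwo d) : LTwo d →L[ℂ] LTwo d).restrictScalars ℝ

theorem fourierOp_apply {d : ℕ} (f : LTwo d) : fourierOp d f = 𝓕 f := rfl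

theorem fourierInvOp_apply {d : ℕ} (f : LTwo d) : fourierInvOp d f = 𝓕⁻ f := rfl

theorem fourier_real_smul {d : ℕ} (c : ℝ) (f : LTwo d) : (𝓕 (c • f) : LTwo d) = c • 𝓕 f :=
  (fourierOp d).map_smul c f

variable {d : ℕ} {lam : ℝ} {u₀ u₁ g₀ : LTwo d} {u : ℝ → LTwo d}

/-- The Fourier transform of `(1 + t)^{μ₁/2} u(t)`. -/
noncomputable def solutionMode (μ₁ μ₂ lam : ℝ) (g₀ u₁ : LTwo d) (u : ℝ → LTwo d) : ℝ → LTwo d :=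
  duhamelSol (initialMode μ₁ μ₂) (kernelMode μ₁ μ₂) g₀ (𝓕 u₁)
    (fun s => 𝓕 (nonlinearity lam (u s)))

noncomputable def solutionModeDeriv (μ₁ μ₂ lam : ℝ) (g₀ u₁ : LTwo d) (u : ℝ → LTwo d) :
    ℝ → LTwo d :=
  duhamelSol (initialModeDeriv μ₁ μ₂) (kernelModeDeriv μ₁ μ₂) g₀ (𝓕 u₁)
    (fun s => 𝓕 (nonlinearity lam (u s)))

/-- Consistency with the prescribed velocity. It is needed because Duhamel's formula is
differentiated only at positive times. -/
theorem solutionModeDeriv_zero (hμ₁ : 0 ≤ μ₁) (hμ : 0 ≤ massParam μ₁ μ₂)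
    (hg₀ : g₀ =ᵐ[volume] fun ξ => radial bracket ξ * (𝓕 u₀ : LTwo d) ξ) :
    solutionModeDeriv μ₁ μ₂ lam g₀ u₁ u 0 = 𝓕 u₁ + (μ₁ / 2) • (𝓕 u₀ : LTwo d) := by
  have h1 : symbolOp (initialModeDeriv μ₁ μ₂ 0) g₀ = (μ₁ / 2) • (𝓕 u₀ : LTwo d) := by
    rw [← symbolOp_const]
    apply Lp.ext
    filter_upwards [coeFn_symbolOp ((isModeFamily_initialMode hμ₁ hμ).isSymbol_deriv hμ le_rfl) g₀,
      coeFn_symbolOp (.const (μ₁ / 2)) (𝓕 u₀ : LTwo d), hg₀] with ξ e1 e2 e3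
    rw [e1, e2, e3, ← mul_assoc]
    congr 1
    simp only [radial, initialModeDeriv, liouvilleModeDeriv_self]
    rw [← Complex.ofReal_mul]
    congr 1
    have := (bracket_pos (2 * Real.pi * ‖ξ‖)).ne'
    simp only [add_zero, Real.one_rpow, zero_add, div_one, mul_one, one_mul]
    field_simp
  have h2 : kernelModeDeriv μ₁ μ₂ 0 0 = fun _ => 1 := by
    ext r
    rw [kernelModeDeriv, liouvilleModeDeriv_self]
    simp
  rw [solutionModeDeriv, duhamelSol, h1, h2, symbolOp_const, one_smul, Ioc_self,
    setIntegral_empty, add_zero, add_comm]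

namespace IsGlobalSolution

theorem fourier_integral (hμ : 0 ≤ massParam μ₁ μ₂) (h : IsGlobalSolution μ₁ μ₂ lam u₀ u₁ u)
    {t : ℝ} (ht : 0 ≤ t) :
    IntegrableOn (fun s => symbolOp (kernelMode μ₁ μ₂ s t) (𝓕 (nonlinearity lam (u s)))) (Ioc 0 t) ∧
    (1 + t) ^ (μ₁ / 2) •
        (𝓕 (∫ s in (0 : ℝ)..t, dampedPropagatorOne μ₁ μ₂ t s (nonlinearity lam (u s))) : LTwo d)
      = ∫ s in Ioc 0 t, symbolOp (kernelMode μ₁ μ₂ s t) (𝓕 (nonlinearity lam (u s))) := by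
  have hi := (intervalIntegrable_iff_integrableOn_Ioc_of_le ht).1 (h.integrable t ht)
  have hi' := ((fourierOp d).integrable_comp hi).smul ((1 + t) ^ (μ₁ / 2))
  have hcongr : EqOn (fun s => (1 + t) ^ (μ₁ / 2) •
      fourierOp d (dampedPropagatorOne μ₁ μ₂ t s (nonlinearity lam (u s))))
      (fun s => symbolOp (kernelMode μ₁ μ₂ s t) (𝓕 (nonlinearity lam (u s)))) (Ioc 0 t) :=
    fun s hs => fourier_dampedPropagatorOne hμ hs.1.le hs.2 _
  refine ⟨(integrableOn_congr_fun hcongr measurableSet_Ioc).1 hi', ?_⟩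
  rw [← setIntegral_congr_fun measurableSet_Ioc hcongr, integral_smul,
    ContinuousLinearMap.integral_comp_comm _ hi, intervalIntegral.integral_of_le ht, fourierOp_apply]

theorem isDuhamel (hd : 3 ≤ d) (hlam : lam = 1 ∨ lam = -1) (hμ₁ : 0 ≤ μ₁)
    (hμ : 0 ≤ massParam μ₁ μ₂) (h : IsGlobalSolution μ₁ μ₂ lam u₀ u₁ u)
    (hu : tailNorm μ₁ u 0 < ∞) :
    IsDuhamel (massParam μ₁ μ₂) (1 + μ₁ / 2 + massParam μ₁ μ₂) (fun s => (1 + s) ^ (μ₁ / 2))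
      (fun s => (1 + s) ^ (-(2 * μ₁ / ((d : ℝ) - 2))) * (forcing μ₁ u s).toReal)
      (initialMode μ₁ μ₂) (initialModeDeriv μ₁ μ₂) (kernelMode μ₁ μ₂) (kernelModeDeriv μ₁ μ₂)
      (fun s => (𝓕 (nonlinearity lam (u s)) : LTwo d)) where
  nonneg_mass := hμ
  initial := isModeFamily_initialMode hμ₁ hμ
  kernel s hs := isModeFamily_kernelMode hμ hs
  kernel_self s _ r := by rw [kernelMode, liouvilleMode_self, mul_zero]
  source_le s hs := by
    rw [Lp.norm_fourier_eq]
    exact norm_nonlinearity_le hd hlam hs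
  integrable_source := by
    have hd' : (3 : ℝ) ≤ d := by exact_mod_cast hd
    exact integrableOn_rpow_mul (integrableOn_forcing hd h hu)
      (div_nonneg (by linarith) (by linarith))
  measurable t ht := (h.fourier_integral hμ ht).1.aestronglyMeasurable

theorem fourier_eq (hμ₁ : 0 ≤ μ₁) (hμ : 0 ≤ massParam μ₁ μ₂)
    (h : IsGlobalSolution μ₁ μ₂ lam u₀ u₁ u)
    (hg₀ : g₀ =ᵐ[volume] fun ξ => radial bracket ξ * (𝓕 u₀ : LTwo d) ξ)
    {t : ℝ} (ht : 0 ≤ t) :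
    (1 + t) ^ (μ₁ / 2) • (𝓕 (u t) : LTwo d) = solutionMode μ₁ μ₂ lam g₀ u₁ u t := by
  rw [h.duhamel t ht, FourierTransform.fourier_add, FourierTransform.fourier_add, smul_add, smul_add,
    (h.fourier_integral hμ ht).2, fourier_dampedPropagatorOne hμ le_rfl ht,
    fourier_dampedPropagatorZero hμ₁ hμ ht hg₀]
  rfl

theorem eq_fourierInv (hμ₁ : 0 ≤ μ₁) (hμ : 0 ≤ massParam μ₁ μ₂)
    (h : IsGlobalSolution μ₁ μ₂ lam u₀ u₁ u)
    (hg₀ : g₀ =ᵐ[volume] fun ξ => radial bracket ξ * (𝓕 u₀ : LTwo d) ξ)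
    {t : ℝ} (ht : 0 ≤ t) :
    u t = (1 + t) ^ (-(μ₁ / 2)) • fourierInvOp d (solutionMode μ₁ μ₂ lam g₀ u₁ u t) := by
  have h1 : 0 < 1 + t := by linarith
  rw [← h.fourier_eq hμ₁ hμ hg₀ ht, map_smul, smul_smul, ← Real.rpow_add h1, neg_add_cancel,
    Real.rpow_zero, one_smul, fourierInvOp_apply, FourierTransform.fourierInv_fourier_eq]

theorem exists_hasDerivWithinAt (hμ₁ : 0 ≤ μ₁) (hμ : 0 ≤ massParam μ₁ μ₂)
    (h : IsGlobalSolution μ₁ μ₂ lam u₀ u₁ u)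
    (hg₀ : g₀ =ᵐ[volume] fun ξ => radial bracket ξ * (𝓕 u₀ : LTwo d) ξ)
    (hd : 3 ≤ d) (hlam : lam = 1 ∨ lam = -1)
    (hu : tailNorm μ₁ u 0 < ∞) {t : ℝ} (ht : 0 ≤ t) :
    ∃ w : LTwo d, HasDerivWithinAt u w (Ici 0) t ∧
      𝓕 w = (1 + t) ^ (-(μ₁ / 2)) • (solutionModeDeriv μ₁ μ₂ lam g₀ u₁ u t
        - (μ₁ / 2 / (1 + t)) • solutionMode μ₁ μ₂ lam g₀ u₁ u t) := by
  -- At time 0 the derivative is part of the definition of a solution; at later times it comes from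
  -- differentiating Duhamel's formula and the factor `(1+t)^(-μ₁/2)`.
  rcases ht.eq_or_lt with rfl | ht'
  · refine ⟨u₁, h.initial_velocity, ?_⟩
    rw [solutionModeDeriv_zero hμ₁ hμ hg₀, ← h.fourier_eq hμ₁ hμ hg₀ le_rfl, h.initial_value]
    simp
  · have h1 : 0 < 1 + t := by linarith
    have hv := (fourierInvOp d).hasFDerivAt.comp_hasDerivAt t
      ((h.isDuhamel hd hlam hμ₁ hμ hu).hasDerivAt_duhamelSol g₀ (𝓕 u₁) ht')
    have hsm := (hasDerivAt_one_add_rpow (a := -(μ₁ / 2)) ht).smul hv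
    refine ⟨_, (hsm.congr_of_eventuallyEq ?_).hasDerivWithinAt, ?_⟩
    · filter_upwards [Ici_mem_nhds ht'] with x hx
      exact h.eq_fourierInv hμ₁ hμ hg₀ hx
    · have e : ∀ f : LTwo d, (𝓕 (fourierInvOp d f) : LTwo d) = f := fun f =>
        FourierTransform.fourier_fourierInv_eq f
      rw [FourierTransform.fourier_add, fourier_real_smul, fourier_real_smul, e]
      simp only [Function.comp_apply]
      rw [e, smul_sub, smul_smul, Real.rpow_sub_one h1.ne']
      have e2 : -(μ₁ / 2) * ((1 + t) ^ (-(μ₁ / 2)) / (1 + t))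
          = -((1 + t) ^ (-(μ₁ / 2)) * (μ₁ / 2 / (1 + t))) := by ring
      rw [e2, neg_smul, ← sub_eq_add_neg]
      rfl

end IsGlobalSolution

end Solution

namespace IsGlobalSolution

variable {d : ℕ} {μ₁ μ₂ lam : ℝ} {u₀ u₁ g₀ : LTwo d} {u : ℝ → LTwo d}

theorem isHermitian_solutionMode (hμ₁ : 0 ≤ μ₁) (hμ : 0 ≤ massParam μ₁ μ₂)
    (h : IsGlobalSolution μ₁ μ₂ lam u₀ u₁ u)
    (hg₀ : g₀ =ᵐ[volume] fun ξ => radial bracket ξ * (𝓕 u₀ : LTwo d) ξ)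
    (hreal : ∀ t, 0 ≤ t → IsRealFun (u t)) {t : ℝ} (ht : 0 ≤ t) :
    IsHermitian (solutionMode μ₁ μ₂ lam g₀ u₁ u t) := by
  rw [← h.fourier_eq hμ₁ hμ hg₀ ht]
  exact (hreal t ht).isHermitian.smul _

/-- Difference quotients in time inherit the symmetry, and it passes to their `L²` limit. -/
theorem isHermitian_solutionModeDeriv (hd : 3 ≤ d) (hlam : lam = 1 ∨ lam = -1) (hμ₁ : 0 ≤ μ₁)
    (hμ : 0 ≤ massParam μ₁ μ₂) (h : IsGlobalSolution μ₁ μ₂ lam u₀ u₁ u)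
    (hu : tailNorm μ₁ u 0 < ∞)
    (hg₀ : g₀ =ᵐ[volume] fun ξ => radial bracket ξ * (𝓕 u₀ : LTwo d) ξ)
    (hreal : ∀ t, 0 ≤ t → IsRealFun (u t)) {t : ℝ} (ht : 0 < t) :
    IsHermitian (solutionModeDeriv μ₁ μ₂ lam g₀ u₁ u t) := by
  have hv := (h.isDuhamel hd hlam hμ₁ hμ hu).hasDerivAt_duhamelSol g₀ (𝓕 u₁) ht
  refine .of_tendsto (hasDerivAt_iff_tendsto_slope.1 hv) ?_
  filter_upwards [mem_nhdsWithin_of_mem_nhds (Ici_mem_nhds ht)] with x hx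
  rw [slope_def_module]
  exact ((h.isHermitian_solutionMode hμ₁ hμ hg₀ hreal hx).sub
    (h.isHermitian_solutionMode hμ₁ hμ hg₀ hreal ht.le)).smul _

/-- The size of the data and of the solution. -/
noncomputable def dataSize (d : ℕ) (μ₁ μ₂ a b c : ℝ) : ℝ :=
  (1 + μ₁ / 2 + massParam μ₁ μ₂) * a + b + c ^ critExp d

/-- Scattering of the rescaled solution on the Fourier side. -/
theorem exists_scattering (hd : 3 ≤ d) (hlam : lam = 1 ∨ lam = -1) (hμ₁ : 0 < μ₁)
    (hμ : 0 ≤ massParam μ₁ μ₂) (h : IsGlobalSolution μ₁ μ₂ lam u₀ u₁ u)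
    (hu : tailNorm μ₁ u 0 < ∞)
    (hg₀ : g₀ =ᵐ[volume] fun ξ => radial bracket ξ * (𝓕 u₀ : LTwo d) ξ)
    {C : ℝ} (hC : 0 ≤ C)
    (hcos : IsProfile (massParam μ₁ μ₂) C (fun t r => Real.cos (r * t))
      (fun t r => -Real.sin (r * t)))
    (hsin : IsProfile (massParam μ₁ μ₂) C (fun t r => Real.sin (r * t))
      (fun t r => Real.cos (r * t)))
    (hgrowth : ∀ (s E : ℝ) (z z' : ℝ → ℝ → ℝ), IsModeFamily (massParam μ₁ μ₂) s E z z' →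
      ∀ t : ℝ, s ≤ t → ∀ r, |z t r| ≤ C * (1 + t) * profileRate (massParam μ₁ μ₂) t
        * ((1 + s) ^ (1 - growthExp (massParam μ₁ μ₂)) * E))
    {P : ℝ → LTwo d} (hP : ∀ t, 0 ≤ t →
      P t =ᵐ[volume] fun ξ => radial id ξ * solutionMode μ₁ μ₂ lam g₀ u₁ u t ξ) :
    ∃ A B : LTwo d,
      ((∀ t, 0 ≤ t → IsRealFun (u t)) → IsHermitian A ∧ IsHermitian B) ∧
      ∀ t, 0 ≤ t →
        ‖P t - (symbolOp (fun r => Real.cos (r * t)) A + symbolOp (fun r => Real.sin (r * t)) B)‖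
          ≤ 2 * C * dataSize d μ₁ μ₂ ‖g₀‖ ‖u₁‖ (tailNorm μ₁ u 0).toReal
            * (massParam μ₁ μ₂ * decayRate (massParam μ₁ μ₂) (2 * μ₁ / ((d : ℝ) - 2)) t)
            + 2 * ((1 + t) ^ (-(2 * μ₁ / ((d : ℝ) - 2))) * (tailNorm μ₁ u t).toReal ^ critExp d) ∧
        ‖solutionModeDeriv μ₁ μ₂ lam g₀ u₁ u t
          - (symbolOp (fun r => Real.cos (r * t)) B - symbolOp (fun r => Real.sin (r * t)) A)‖
          ≤ 2 * C * dataSize d μ₁ μ₂ ‖g₀‖ ‖u₁‖ (tailNorm μ₁ u 0).toReal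
            * (massParam μ₁ μ₂ * decayRate (massParam μ₁ μ₂) (2 * μ₁ / ((d : ℝ) - 2)) t)
            + 2 * ((1 + t) ^ (-(2 * μ₁ / ((d : ℝ) - 2))) * (tailNorm μ₁ u t).toReal ^ critExp d) ∧
        ‖solutionMode μ₁ μ₂ lam g₀ u₁ u t‖
          ≤ C * dataSize d μ₁ μ₂ ‖g₀‖ ‖u₁‖ (tailNorm μ₁ u 0).toReal
            * ((1 + t) * decayRate (massParam μ₁ μ₂) (2 * μ₁ / ((d : ℝ) - 2)) t) := by
  have hd' : (3 : ℝ) ≤ d := by exact_mod_cast hd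
  have hp := one_lt_critExp hd
  have hα : 0 < 2 * μ₁ / ((d : ℝ) - 2) := div_pos (by linarith) (by linarith)
  set α := 2 * μ₁ / ((d : ℝ) - 2) with hαdef
  set K := dataSize d μ₁ μ₂ ‖g₀‖ ‖u₁‖ (tailNorm μ₁ u 0).toReal with hK
  have hD := h.isDuhamel hd hlam hμ₁.le hμ hu
  have hF := integrableOn_forcing hd h hu
  have hF0 : ∀ s, 0 ≤ (forcing μ₁ u s).toReal := fun s => ENNReal.toReal_nonneg
  have hpast : ∀ t, 0 ≤ t → profileRate (massParam μ₁ μ₂) t *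
      IsDuhamel.past (massParam μ₁ μ₂) (1 + μ₁ / 2 + massParam μ₁ μ₂)
        (fun s => (1 + s) ^ (μ₁ / 2)) (fun s => (1 + s) ^ (-α) * (forcing μ₁ u s).toReal)
        g₀ (𝓕 u₁) t ≤ decayRate (massParam μ₁ μ₂) α t * K := fun t ht => by
    refine (profileRate_mul_past_le (by positivity) (by positivity) hF hF0 ht).trans (le_of_eq ?_)
    rw [integral_forcing hd h hu le_rfl, Lp.norm_fourier_eq]
    simp [hK, dataSize]
  -- First the variation of everything present at time `t`, then all sources still to come.
  set b : ℝ → ℝ := fun t => C * K * (massParam μ₁ μ₂ * decayRate (massParam μ₁ μ₂) α t)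
    + (1 + t) ^ (-α) * (tailNorm μ₁ u t).toReal ^ critExp d with hb
  have hb1 : ∀ t t', 0 ≤ t → t ≤ t' → massParam μ₁ μ₂ * C * profileRate (massParam μ₁ μ₂) t *
      IsDuhamel.past (massParam μ₁ μ₂) (1 + μ₁ / 2 + massParam μ₁ μ₂)
        (fun s => (1 + s) ^ (μ₁ / 2)) (fun s => (1 + s) ^ (-α) * (forcing μ₁ u s).toReal)
        g₀ (𝓕 u₁) t + ∫ s in Ioc t t', (1 + s) ^ (-α) * (forcing μ₁ u s).toReal ≤ b t := by
    intro t t' ht _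
    refine add_le_add ?_ ?_
    · have := mul_le_mul_of_nonneg_left (hpast t ht) (mul_nonneg hμ hC)
      refine le_trans (le_of_eq ?_) (this.trans (le_of_eq ?_)) <;> ring
    · rw [← integral_forcing hd h hu ht]
      exact setIntegral_rpow_mul_le hF hF0 hα.le ht
  have hb0 : Tendsto b atTop (𝓝 0) := by
    have h1 : Tendsto (fun t => massParam μ₁ μ₂ * decayRate (massParam μ₁ μ₂) α t) atTop (𝓝 0) := by
      -- For `μ = 0` the rate itself does not decay; its prefactor vanishes instead.
      rcases hμ.eq_or_lt with h0 | h0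
      · simp [← h0]
      · simpa using (tendsto_decayRate h0 hα).const_mul (massParam μ₁ μ₂)
    have h2 : Tendsto (fun t : ℝ => (1 + t) ^ (-α)) atTop (𝓝 0) :=
      (tendsto_rpow_neg_atTop hα).comp (tendsto_atTop_add_const_left _ _ tendsto_id)
    have h3 : Tendsto (fun t => (tailNorm μ₁ u t).toReal ^ critExp d) atTop (𝓝 0) := by
      have h4 := (ENNReal.tendsto_toReal ENNReal.zero_ne_top).comp (tendsto_tailNorm hd hu)
      have h5 := h4.rpow_const (p := critExp d) (Or.inr (by linarith))
      rwa [ENNReal.toReal_zero, Real.zero_rpow (by linarith)] at h5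
    simpa using (h1.const_mul (C * K)).add (h2.mul h3)
  obtain ⟨A, B, hAB, hbound⟩ := hD.exists_free_wave hC hcos hsin hP hb1 hb0
  refine ⟨A, B, fun hreal => hAB fun t ht => ⟨?_, ?_⟩, fun t ht => ⟨?_, ?_, ?_⟩⟩
  · refine IsHermitian.congr
      (f := fun ξ => radial id ξ * solutionMode μ₁ μ₂ lam g₀ u₁ u t ξ) ?_ (hP t ht.le).symm
    filter_upwards [h.isHermitian_solutionMode hμ₁.le hμ hg₀ hreal ht.le] with ξ hξ
    rw [map_mul, hξ, radial, radial, norm_neg, Complex.conj_ofReal]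
  · exact h.isHermitian_solutionModeDeriv hd hlam hμ₁.le hμ hu hg₀ hreal ht
  · refine (hbound t ht).1.trans (le_of_eq ?_)
    simp only [hb]
    ring
  · refine (hbound t ht).2.trans (le_of_eq ?_)
    simp only [hb]
    ring
  · refine (hD.norm_duhamelSol_growth hC hgrowth g₀ (𝓕 u₁) ht).trans ?_
    have := mul_le_mul_of_nonneg_left (hpast t ht) (by positivity : 0 ≤ C * (1 + t))
    refine le_trans (le_of_eq ?_) (this.trans (le_of_eq ?_)) <;> ring

end IsGlobalSolution

/-! ### Return to physical space and the scattering theorem -/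

theorem tailNorm_rpow_le {d : ℕ} (hd : 3 ≤ d) {μ₁ : ℝ} {u : ℝ → LTwo d} (hu : tailNorm μ₁ u 0 < ∞)
    {t : ℝ} (ht : 0 ≤ t) : (tailNorm μ₁ u t).toReal ^ critExp d
      ≤ (tailNorm μ₁ u 0).toReal ^ (critExp d - 1) * (tailNorm μ₁ u t).toReal := by
  have hp := one_lt_critExp hd
  have h0 : 0 ≤ (tailNorm μ₁ u t).toReal := ENNReal.toReal_nonneg
  have hle : (tailNorm μ₁ u t).toReal ≤ (tailNorm μ₁ u 0).toReal :=
    ENNReal.toReal_mono hu.ne (tailNorm_anti hd ht)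
  calc (tailNorm μ₁ u t).toReal ^ critExp d
      = (tailNorm μ₁ u t).toReal ^ ((critExp d - 1) + 1) := by rw [sub_add_cancel]
    _ = (tailNorm μ₁ u t).toReal ^ (critExp d - 1) * (tailNorm μ₁ u t).toReal := by
        rw [Real.rpow_add_one' h0 (by linarith)]
    _ ≤ _ := mul_le_mul_of_nonneg_right (Real.rpow_le_rpow h0 hle (by linarith)) h0

theorem mainTheorem7 (d : ℕ) (hd3 : 3 ≤ d) (hd5 : d ≤ 5) (μ₁ μ₂ : ℝ) (hμ₁ : 0 < μ₁)
    (hμ : 0 ≤ massParam μ₁ μ₂) :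
    ∃ C : ℝ → ℝ → ℝ → ℝ, ∀ (lam : ℝ), (lam = 1 ∨ lam = -1) →
      ∀ (u₀ u₁ : LTwo d) (u : ℝ → LTwo d), IsGlobalSolution μ₁ μ₂ lam u₀ u₁ u →
      tailNorm μ₁ u 0 < ∞ →
      DifferentiableOn ℝ u (Ici 0) ∧ Tendsto (tailNorm μ₁ u) atTop (𝓝 0) ∧
      ∃ (φ₀ : 𝓢'(Space d, ℂ)) (φ₁ : LTwo d), MemHDotOne φ₀ ∧
        ((∀ t, 0 ≤ t → IsRealFun (u t)) → IsRealDist φ₀ ∧ IsRealFun φ₁) ∧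
        ∀ t : ℝ, 0 ≤ t →
          hDotOneNorm ((u t : 𝓢'(Space d, ℂ))
              - (((1 + t) ^ (-(μ₁ / 2)) : ℝ) : ℂ) • waveFst t φ₀ φ₁)
            ≤ ENNReal.ofReal (C (hOneNorm u₀).toReal ‖u₁‖ (tailNorm μ₁ u 0).toReal *
              (massParam μ₁ μ₂ * massRate d μ₁ (massParam μ₁ μ₂) t
                + (1 + t) ^ (-(2 * μ₁ / ((d : ℝ) - 2)) - μ₁ / 2) * (tailNorm μ₁ u t).toReal)) ∧
          ‖derivWithin u (Ici 0) t - (1 + t) ^ (-(μ₁ / 2)) • waveSnd t φ₀ φ₁‖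
            ≤ C (hOneNorm u₀).toReal ‖u₁‖ (tailNorm μ₁ u 0).toReal *
              ((massParam μ₁ μ₂ + μ₁) * massRate d μ₁ (massParam μ₁ μ₂) t
                + (1 + t) ^ (-(2 * μ₁ / ((d : ℝ) - 2)) - μ₁ / 2) * (tailNorm μ₁ u t).toReal) := by
  obtain ⟨C, hC, hcos, hsin, hgrowth⟩ := exists_isProfile hμ
  -- The first summand pays for the mass term and the second for the future source; the factors 2
  -- come from rotating two profile errors back.
  refine ⟨fun a b c => 2 * C * IsGlobalSolution.dataSize d μ₁ μ₂ a b c + 2 * c ^ (critExp d - 1),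
    fun lam hlam u₀ u₁ u h hu => ?_⟩
  have hu₀ : hOneNorm u₀ < ∞ := h.initial_value ▸ h.mem_hOne 0 le_rfl
  obtain ⟨g₀, hg₀, hg₀n⟩ := exists_bracket_mul hu₀
  have hQ : ∀ t, ∃ Q : LTwo d, 0 ≤ t → Q =ᵐ[volume] fun ξ => radial id ξ * (𝓕 (u t) : LTwo d) ξ :=
    fun t => by
      by_cases ht : 0 ≤ t
      · obtain ⟨Q, hQ⟩ := exists_id_mul (h.mem_hOne t ht)
        exact ⟨Q, fun _ => hQ⟩
      · exact ⟨0, fun h => absurd h ht⟩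
  choose Q hQ using hQ
  have hP : ∀ t, 0 ≤ t → ((1 + t) ^ (μ₁ / 2) • Q t : LTwo d) =ᵐ[volume]
      fun ξ => radial id ξ * solutionMode μ₁ μ₂ lam g₀ u₁ u t ξ := fun t ht => by
    rw [← h.fourier_eq hμ₁.le hμ hg₀ ht]
    filter_upwards [hQ t ht, Lp.coeFn_smul ((1 + t) ^ (μ₁ / 2)) (Q t),
      Lp.coeFn_smul ((1 + t) ^ (μ₁ / 2)) (𝓕 (u t) : LTwo d)] with ξ h1 h2 h3
    rw [h2, h3, Pi.smul_apply, Pi.smul_apply, h1, mul_smul_comm]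
  obtain ⟨A, B, hAB, hbound⟩ := h.exists_scattering hd3 hlam hμ₁ hμ hu hg₀ hC hcos hsin hgrowth hP
  rw [hg₀n] at hbound
  set K := IsGlobalSolution.dataSize d μ₁ μ₂ (hOneNorm u₀).toReal ‖u₁‖ (tailNorm μ₁ u 0).toReal
    with hK
  have hK0 : 0 ≤ K := by
    rw [hK, IsGlobalSolution.dataSize]
    positivity
  have hderiv := fun t (ht : 0 ≤ t) =>
    h.exists_hasDerivWithinAt hμ₁.le hμ hg₀ hd3 hlam hu ht
  -- `A` is the limit of the profile already weighted by `|ξ|`, so `φ₀` is `|∇|⁻¹` applied to its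
  -- inverse transform.
  obtain ⟨φ₀, hφ₀⟩ := exists_hasFourierFun_div hd3 A
  have hB : (𝓕 (𝓕⁻ B : LTwo d) : LTwo d) = B := FourierTransform.fourier_fourierInv_eq B
  refine ⟨fun t ht => ?_, tendsto_tailNorm hd3 hu, φ₀, 𝓕⁻ B, ?_, fun hreal => ⟨?_, ?_⟩,
    fun t ht => ?_⟩
  · obtain ⟨w, hw, -⟩ := hderiv t ht
    exact hw.differentiableWithinAt
  · refine (hDotOneNorm_le hφ₀ (A := A) ?_).trans_lt ENNReal.ofReal_lt_top
    filter_upwards [ae_norm_ne_zero hd3] with ξ hξ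
    exact mul_div_cancel₀ _ hξ
  · refine IsHermitian.isRealDist hφ₀ ?_
    filter_upwards [(hAB hreal).1] with ξ hξ
    rw [hξ, norm_neg, map_div₀, Complex.conj_ofReal]
  · refine IsRealDist.isRealFun (IsHermitian.isRealDist (hasFourierFun_Lp _) ?_)
    rw [hB]
    exact (hAB hreal).2
  · obtain ⟨hb1, hb2, hb3⟩ := hbound t ht
    have h1 : 0 < 1 + t := by linarith
    have hσ : 0 < (1 + t) ^ (-(μ₁ / 2)) := by positivity
    have hσσ : (1 + t) ^ (-(μ₁ / 2)) * (1 + t) ^ (μ₁ / 2) = 1 := by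
      rw [← Real.rpow_add h1, neg_add_cancel, Real.rpow_zero]
    -- The future source yields `o(t)^{p₁}`; all powers but one are estimated by `o(0)` and go into
    -- the constant.
    have htail := mul_le_mul_of_nonneg_left (tailNorm_rpow_le hd3 hu ht)
      (by positivity : 0 ≤ (1 + t) ^ (-(2 * μ₁ / ((d : ℝ) - 2))))
    have hdec := decayRate_nonneg (massParam μ₁ μ₂) (2 * μ₁ / ((d : ℝ) - 2)) ht
    have hsplit : (1 + t) ^ (-(2 * μ₁ / ((d : ℝ) - 2)) - μ₁ / 2)
        = (1 + t) ^ (-(μ₁ / 2)) * (1 + t) ^ (-(2 * μ₁ / ((d : ℝ) - 2))) := by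
      rw [← Real.rpow_add h1]
      ring_nf
    have ho0 : 0 ≤ (tailNorm μ₁ u 0).toReal ^ (critExp d - 1) := by positivity
    have ho : 0 ≤ (tailNorm μ₁ u t).toReal := ENNReal.toReal_nonneg
    have hτ : 0 ≤ (1 + t) ^ (-(2 * μ₁ / ((d : ℝ) - 2))) := by positivity
    simp only [massRate_eq d μ₁ _ ht, hsplit]
    set σ := (1 + t) ^ (-(μ₁ / 2))
    set τ := (1 + t) ^ (-(2 * μ₁ / ((d : ℝ) - 2)))
    set D := decayRate (massParam μ₁ μ₂) (2 * μ₁ / ((d : ℝ) - 2)) t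
    set o := (tailNorm μ₁ u t).toReal
    set k := (tailNorm μ₁ u 0).toReal ^ (critExp d - 1)
    have hx : 0 ≤ k * (massParam μ₁ μ₂ * D) := by positivity
    have hx' : 0 ≤ k * (μ₁ * D) := by positivity
    have hy : 0 ≤ C * K * (τ * o) := by positivity
    have hz : 0 ≤ C * K * (μ₁ * D) := by positivity
    constructor
    · have hT := (hasFourierFun_Lp (u t)).sub_smul
        (hasFourierFun_waveFst hd3 hφ₀ (φ₁ := (𝓕⁻ B : LTwo d)) t) (σ : ℂ)
      rw [hB] at hT
      set W : LTwo d := symbolOp (fun r => Real.cos (r * t)) A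
        + symbolOp (fun r => Real.sin (r * t)) B with hW
      refine (hDotOneNorm_le hT (A := σ • ((1 + t) ^ (μ₁ / 2) • Q t - W)) ?_).trans
        (ENNReal.ofReal_le_ofReal ?_)
      · rw [smul_sub, smul_smul, hσσ, one_smul]
        filter_upwards [ae_norm_ne_zero hd3, hQ t ht, Lp.coeFn_sub (Q t) (σ • W),
          Lp.coeFn_smul σ W] with ξ e1 e2 e3 e4
        rw [e3, Pi.sub_apply, e4, e2, Pi.smul_apply, Complex.real_smul, mul_sub]
        congr 1
        field_simp
      · rw [norm_smul, Real.norm_of_nonneg hσ.le]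
        refine (mul_le_mul_of_nonneg_left hb1 hσ.le).trans ?_
        have : 2 * C * K * (massParam μ₁ μ₂ * D) + 2 * (τ * o ^ critExp d)
            ≤ (2 * C * K + 2 * k) * (massParam μ₁ μ₂ * D + τ * o) := by nlinarith
        refine (mul_le_mul_of_nonneg_left this hσ.le).trans (le_of_eq ?_)
        ring
    · obtain ⟨w, hw, hwF⟩ := hderiv t ht
      rw [hw.derivWithin (uniqueDiffOn_Ici 0 t ht), waveSnd_eq hd3 hφ₀, hB]
      set V : LTwo d := symbolOp (fun r => Real.cos (r * t)) B
        - symbolOp (fun r => Real.sin (r * t)) A with hV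
      have e1 : (𝓕 (w - σ • (𝓕⁻ V : LTwo d)) : LTwo d)
          = σ • ((solutionModeDeriv μ₁ μ₂ lam g₀ u₁ u t - V)
            - (μ₁ / 2 / (1 + t)) • solutionMode μ₁ μ₂ lam g₀ u₁ u t) := by
        have e2 := (fourierOp d).map_sub w (σ • (𝓕⁻ V : LTwo d))
        rw [map_smul] at e2
        simp only [fourierOp_apply] at e2
        rw [e2, hwF, FourierTransform.fourier_fourierInv_eq, ← smul_sub]
        congr 1
        abel
      rw [← Lp.norm_fourier_eq, e1, norm_smul, Real.norm_of_nonneg hσ.le]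
      -- The division by `1 + t` exactly offsets the extra `1 + t` in the growth bound, leaving `μ₁`
      -- times the decay rate.
      have e3 : ‖(μ₁ / 2 / (1 + t)) • solutionMode μ₁ μ₂ lam g₀ u₁ u t‖ ≤ C * K * (μ₁ / 2 * D) := by
        rw [norm_smul, Real.norm_of_nonneg (by positivity)]
        refine (mul_le_mul_of_nonneg_left hb3 (by positivity)).trans (le_of_eq ?_)
        field_simp
      have e4 := (norm_sub_le _ _).trans (add_le_add hb2 e3)
      refine (mul_le_mul_of_nonneg_left e4 hσ.le).trans ?_
      have : 2 * C * K * (massParam μ₁ μ₂ * D) + 2 * (τ * o ^ critExp d) + C * K * (μ₁ / 2 * D)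
          ≤ (2 * C * K + 2 * k) * ((massParam μ₁ μ₂ + μ₁) * D + τ * o) := by nlinarith
      refine (mul_le_mul_of_nonneg_left this hσ.le).trans (le_of_eq ?_)
      ring
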